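/- Let $T=(V,E,w)$ be a tree with $n=|V|\ge 1$ vertices and vertex weights $w(v)\ge 0$. A hidden target $x\in V$ is to be located by queries. A query to $v$ costs $w(v)$; the reply is either that $x=v$, which ends the search, or the unique neighbor of $v$ that is closer to $x$ than $v$ is. A search strategy is a decision tree whose inner nodes are queries, with one branch for each neighbor as a possible reply, and whose leaves announce a vertex, such that every target $x$ is located correctly. Its cost for the target $x$ is the sum of the weights of the vertices queried when $x$ is the target; its cost is the maximum over all $x\in V$; and $\mathrm{OPT}(T)$ is the minimum cost of a search strategy for $T$. Theorem. There are a single algorithm and an absolute constant $C$ such that, for every real $0<\varepsilon<1$ and every node-weighted tree $T$ with $n$ vertices and real weights, the algorithm, given $\varepsilon$ and $T$ (its adjacency matrix and its weights), halts after at most $C\cdot n^{C\log n/\varepsilon^2}$ steps and outputs an explicit search strategy (a decision tree stored as a linked structure) of cost at most $(1+\varepsilon)\,\mathrm{OPT}(T)$. Thus its running time is $n^{O(\log n/\varepsilon^2)}$, and the weighted tree search problem admits a quasi-polynomial-time approximation scheme. Here an algorithm is a deterministic program on a random access machine with finitely many unbounded arrays of natural numbers and of real numbers, whose unit-cost operations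 are constants, array access, addition, subtraction (truncated at $0$ for natural numbers), the embedding of the natural numbers into the reals, comparisons and Boolean connectives of tests (no multiplication and no rounding). -/

import Mathlib

namespace TreeSearch

/-! ### Node-weighted trees, decision trees and their cost -/

/-- A node-weighted tree on the vertex set `{0, …, n - 1}`. -/
structure WeightedTree (n : ℕ) where
  graph : SimpleGraph (Fin n)
  isTree : graph.IsTree
  weight : Fin n → ℝ
  weight_nonneg : ∀ v, 0 ≤ weight v

namespace WeightedTree

variable {n : ℕ}

theorem exists_closer (T : WeightedTree n) {v x : Fin n} (h : v ≠ x) :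
    ∃ u : T.graph.neighborSet v, T.graph.dist u x < T.graph.dist v x := by
  obtain ⟨p, hp⟩ := T.isTree.connected.exists_walk_length_eq_dist v x
  cases p with
  | nil => exact absurd rfl h
  | cons hadj q =>
    refine ⟨⟨_, hadj⟩, ?_⟩
    have h1 := SimpleGraph.dist_le q
    rw [SimpleGraph.Walk.length_cons] at hp
    simp only
    omega

/-- The negative reply to a query of `v` when the target is `x ≠ v`: the neighbour of `v` that lies
closer to `x` than `v` does. (It is unique, the graph being a tree.) -/
noncomputable def reply (T : WeightedTree n) (v x : Fin n) (h : v ≠ x) : T.graph.neighborSet v :=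
  (T.exists_closer h).choose

/-- Decision trees: a leaf announces the location of the target; an inner node queries a vertex `v`,
stops if the reply is that `v` is the target, and has one subtree for each neighbour of `v`,
with which it continues if this neighbour is the reply. -/
inductive DecisionTree (T : WeightedTree n) : Type
  | answer (v : Fin n) : DecisionTree T
  | query (v : Fin n) (next : T.graph.neighborSet v → DecisionTree T) : DecisionTree T

namespace DecisionTree

variable {T : WeightedTree n}

/-- The sequence of vertices queried when the target is `x`. -/
noncomputable def queries (x : Fin n) : DecisionTree T → List (Fin n)
  | answer _ => []
  | query v next => if h : v = x then [v] else v :: queries x (next (T.reply v x h))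

/-- The vertex at which the target is located in the end, when the target is `x`. -/
noncomputable def located (x : Fin n) : DecisionTree T → Fin n
  | answer v => v
  | query v next => if h : v = x then v else located x (next (T.reply v x h))

/-- A search strategy is a decision tree that locates every target. -/
def IsStrategy (S : DecisionTree T) : Prop := ∀ x, S.located x = x

/-- The total weight of the vertices queried when the target is `x`. -/
noncomputable def costAt (S : DecisionTree T) (x : Fin n) : ℝ :=
  ((S.queries x).map T.weight).sum

/-- The worst-case cost. -/
noncomputable def cost (S : DecisionTree T) : ℝ := ⨆ x, S.costAt x

end DecisionTree

/-- The least worst-case cost of a search strategy. -/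
noncomputable def opt (T : WeightedTree n) : ℝ :=
  sInf {t | ∃ S : DecisionTree T, S.IsStrategy ∧ S.cost = t}

end WeightedTree

/-! ### A random access machine with integer and real arrays

Programs work on finitely many (named) arrays of natural numbers and of real numbers, all unbounded.
The only arithmetic operations are addition, subtraction (truncated at `0` for natural numbers)
and the embedding of the natural numbers into the reals; there is neither multiplication nor
rounding, and numbers are inspected only by comparisons. Every operation costs one time unit. -/

/-- The memory: `m.nat a i` and `m.real a i` are the `i`-th entries of the arrays named `a`. -/
structure Memory where
  nat : ℕ → ℕ → ℕ
  real : ℕ → ℕ → ℝ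

namespace Memory

def setNat (m : Memory) (a i k : ℕ) : Memory :=
  { m with nat := Function.update m.nat a (Function.update (m.nat a) i k) }

noncomputable def setReal (m : Memory) (a i : ℕ) (r : ℝ) : Memory :=
  { m with real := Function.update m.real a (Function.update (m.real a) i r) }

end Memory

/-- Expressions of type `ℕ`. -/
inductive NatExp : Type
  | const (k : ℕ) : NatExp
  | get (a : ℕ) (i : NatExp) : NatExp
  | add (e f : NatExp) : NatExp
  | sub (e f : NatExp) : NatExp

namespace NatExp

def eval (m : Memory) : NatExp → ℕ
  | const k => k
  | get a i => m.nat a (eval m i)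
  | add e f => eval m e + eval m f
  | sub e f => eval m e - eval m f

/-- The number of time units that an evaluation takes. -/
def time : NatExp → ℕ
  | const _ => 1
  | get _ i => time i + 1
  | add e f => time e + time f + 1
  | sub e f => time e + time f + 1

end NatExp

/-- Expressions of type `ℝ`. -/
inductive RealExp : Type
  | ofNat (e : NatExp) : RealExp
  | get (a : ℕ) (i : NatExp) : RealExp
  | add (e f : RealExp) : RealExp
  | sub (e f : RealExp) : RealExp

namespace RealExp

noncomputable def eval (m : Memory) : RealExp → ℝ
  | ofNat e => (e.eval m : ℝ)
  | get a i => m.real a (i.eval m)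
  | add e f => eval m e + eval m f
  | sub e f => eval m e - eval m f

def time : RealExp → ℕ
  | ofNat e => e.time + 1
  | get _ i => i.time + 1
  | add e f => time e + time f + 1
  | sub e f => time e + time f + 1

end RealExp

/-- Tests. -/
inductive Test : Type
  | natLt (e f : NatExp) : Test
  | realLt (e f : RealExp) : Test
  | neg (b : Test) : Test
  | both (b c : Test) : Test

namespace Test

def Holds (m : Memory) : Test → Prop
  | natLt e f => e.eval m < f.eval m
  | realLt e f => e.eval m < f.eval m
  | neg b => ¬ Holds m b
  | both b c => Holds m b ∧ Holds m c

def time : Test → ℕ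
  | natLt e f => e.time + f.time + 1
  | realLt e f => e.time + f.time + 1
  | neg b => time b + 1
  | both b c => time b + time c + 1

end Test

/-- Programs. -/
inductive Program : Type
  | skip : Program
  | setNat (a : ℕ) (i e : NatExp) : Program
  | setReal (a : ℕ) (i : NatExp) (e : RealExp) : Program
  | seq (p q : Program) : Program
  | branch (b : Test) (p q : Program) : Program
  | loop (b : Test) (p : Program) : Program

/-- `Runs p m t m'`: started in the memory `m`, the program `p` halts after `t` time units, and
leaves the memory `m'`. (Programs are deterministic: `t` and `m'` are determined by `p` and `m`.) -/
inductive Runs : Program → Memory → ℕ → Memory → Prop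
  | skip (m : Memory) : Runs Program.skip m 1 m
  | setNat (m : Memory) (a : ℕ) (i e : NatExp) :
      Runs (Program.setNat a i e) m (i.time + e.time + 1) (m.setNat a (i.eval m) (e.eval m))
  | setReal (m : Memory) (a : ℕ) (i : NatExp) (e : RealExp) :
      Runs (Program.setReal a i e) m (i.time + e.time + 1) (m.setReal a (i.eval m) (e.eval m))
  | seq {p q : Program} {m m₁ m₂ : Memory} {s t : ℕ} (hp : Runs p m s m₁) (hq : Runs q m₁ t m₂) :
      Runs (Program.seq p q) m (s + t) m₂
  | branch_true {b : Test} {p q : Program} {m m₁ : Memory} {t : ℕ} (hb : b.Holds m)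
      (hp : Runs p m t m₁) : Runs (Program.branch b p q) m (b.time + t) m₁
  | branch_false {b : Test} {p q : Program} {m m₁ : Memory} {t : ℕ} (hb : ¬ b.Holds m)
      (hq : Runs q m t m₁) : Runs (Program.branch b p q) m (b.time + t) m₁
  | loop_true {b : Test} {p : Program} {m m₁ m₂ : Memory} {s t : ℕ} (hb : b.Holds m)
      (hp : Runs p m s m₁) (hl : Runs (Program.loop b p) m₁ t m₂) :
      Runs (Program.loop b p) m (b.time + s + t) m₂
  | loop_false {b : Test} {p : Program} {m : Memory} (hb : ¬ b.Holds m) :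
      Runs (Program.loop b p) m b.time m

/-! ### Input and output -/

open Classical in
/-- The initial memory: natural array `0` holds `n` at position `0`, natural array `1` holds the
adjacency matrix row by row, real array `0` holds the weights, and real array `1` holds `ε` at
position `0`. All other entries are `0`. -/
noncomputable def input {n : ℕ} (T : WeightedTree n) (ε : ℝ) : Memory where
  nat a k :=
    if a = 0 ∧ k = 0 then n
    else if a = 1 ∧ ∃ i j : Fin n, T.graph.Adj i j ∧ k = (i : ℕ) * n + j then 1
    else 0
  real a k :=
    if h : a = 0 ∧ k < n then T.weight ⟨k, h.2⟩
    else if a = 1 ∧ k = 0 then ε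
    else 0

/-- A decision tree is stored as a linked structure in the natural arrays `2`, `3` and `4`: for the
node number `k`, entry `k` of array `2` tells whether it is a leaf (`0`) or an inner node (`1`),
entry `k` of array `3` is the vertex that is announced or queried there, and entry `k * n + u` of
array `4` is the number of the node with which an inner node continues after the reply `u`. -/
def StoredAt {n : ℕ} {T : WeightedTree n} (m : Memory) : T.DecisionTree → ℕ → Prop
  | .answer v, k => m.nat 2 k = 0 ∧ m.nat 3 k = v
  | .query v next, k => m.nat 2 k = 1 ∧ m.nat 3 k = v ∧
      ∀ u : T.graph.neighborSet v, StoredAt m (next u) (m.nat 4 (k * n + (u : Fin n)))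

end TreeSearch

/-! Rounding time turns tree search into a problem about load vectors. Fix a time unit `η` and group
the units into boxes of `n` units. A strategy of cost at most `η * n * (K - G)`, with `G` slightly
above `log₂ n`, becomes a schedule inside `K` boxes, in which every vertex is either idle or
processed in an interval of whole units (`exists_isSchedule`). Rounding up costs at most one unit
per vertex, hence one box in total. After a query of `v`, the largest remaining component proceeds
at once and every other one waits for the next box boundary. A waiting component has at most half of
the vertices, so waiting costs at most `log₂ n` boxes. Because of the waiting, a box that begins
before `v` ends carries, besides `v`, only load of one component. This gives a local criterion: if
the intervals of all vertices of a connected set end after the beginning of box `i`, their total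
load in box `i` is at most `n`.

Now forget the times and keep only the loads. Written to the base `n + 1`, the load vector of a
vertex is a number, its code. An idle vertex gets load `1` in one extra box of capacity `1`. The
criterion becomes `Growth.Balanced`, and `exists_balanced` extracts balanced codes from a strategy.
Conversely, balanced codes suffice to rebuild a strategy: in each component, query a vertex whose
code has the lowest leading position `p`. All codes of the component reach every box `i ≤ p`, so
balance bounds the load of the whole component there; beyond `p` the queried vertex has no load
(`feasible_query`). Every search path then has load at most `n` in each box, so the cost is at most
`η * n * K` (`Feasible.cost_le`). Since `K` is `⌈2 / ε⌉` times `G`, this loses only a factor `1 + ε`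
(`mul_boxCount_le`).

Balanced codes are found by dynamic programming over the removal of leaves. The code of a leaf is
merged into that of its neighbour by adding digits up to the neighbour's leading position, and
balance is preserved in both directions (`Growth.merge_mergeState`, `Growth.balanced_of_merge`). The
tables store, for each code, the smallest possible maximum of weight over number of reserved units.
Thus the best `η` is minimised directly, with no guess of the optimum. The machine cannot divide, so
all quotients are multiplied by one common product (`cofactor_mul`). There are `2 * (n + 1) ^ K`
codes, and the program has a fixed nesting of loops, each bounded by this number, which makes the
running time polynomial in it (`exists_timeBound_le_pow`). -/

namespace TreeSearch

/-! ### Sides of a vertex and connected sets in a tree -/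

namespace WeightedTree

variable {n : ℕ}

/-- An edge to a closer neighbour followed by a shortest walk has length `dist v x`, hence is a
path. Paths in a tree are unique, so the two paths share their second vertex. -/
theorem closer_unique (T : WeightedTree n) {v x a b : Fin n} (ha : T.graph.Adj v a)
    (hb : T.graph.Adj v b) (hax : T.graph.dist a x < T.graph.dist v x)
    (hbx : T.graph.dist b x < T.graph.dist v x) : a = b := by
  obtain ⟨p, hp⟩ := T.isTree.connected.exists_walk_length_eq_dist a x
  obtain ⟨q, hq⟩ := T.isTree.connected.exists_walk_length_eq_dist b x
  have hP : (SimpleGraph.Walk.cons ha p).IsPath := by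
    apply SimpleGraph.Walk.isPath_of_length_eq_dist
    have := SimpleGraph.dist_le (SimpleGraph.Walk.cons ha p)
    simp only [SimpleGraph.Walk.length_cons] at *
    omega
  have hQ : (SimpleGraph.Walk.cons hb q).IsPath := by
    apply SimpleGraph.Walk.isPath_of_length_eq_dist
    have := SimpleGraph.dist_le (SimpleGraph.Walk.cons hb q)
    simp only [SimpleGraph.Walk.length_cons] at *
    omega
  have h := (T.isTree.existsUnique_path v x).unique hP hQ
  have h2 := congrArg (fun w : T.graph.Walk v x => w.getVert 1) h
  simpa using h2

/-- The reply to a query of `v` with target `x`, which is `v` itself for `x = v`. -/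
noncomputable def rep (T : WeightedTree n) (v x : Fin n) : Fin n :=
  if h : v ≠ x then (T.reply v x h : Fin n) else v

variable (T : WeightedTree n)

theorem rep_of_ne {v x : Fin n} (h : v ≠ x) : T.rep v x = T.reply v x h := by
  simp [rep, h]

theorem adj_rep {v x : Fin n} (h : v ≠ x) : T.graph.Adj v (T.rep v x) := by
  rw [T.rep_of_ne h]
  exact (T.reply v x h).2

theorem dist_rep_lt {v x : Fin n} (h : v ≠ x) :
    T.graph.dist (T.rep v x) x < T.graph.dist v x := by
  rw [T.rep_of_ne h]
  exact (T.exists_closer h).choose_spec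

theorem rep_eq {v x u : Fin n} (ha : T.graph.Adj v u) (hd : T.graph.dist u x < T.graph.dist v x) :
    T.rep v x = u := by
  have h : v ≠ x := by
    rintro rfl
    simp at hd
  exact T.closer_unique (T.adj_rep h) ha (T.dist_rep_lt h) hd

theorem rep_of_adj {v u : Fin n} (h : T.graph.Adj v u) : T.rep v u = u := by
  apply T.rep_eq h
  rw [SimpleGraph.dist_self]
  exact T.isTree.connected.pos_dist_of_ne h.ne

/-- An edge that avoids `v` lies on one side of `v`. Its ends have different distances from `v`, and
the reply for the nearer end is also a step towards the farther one. -/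
theorem rep_eq_of_adj {v a b : Fin n} (hab : T.graph.Adj a b) (ha : v ≠ a) (hb : v ≠ b) :
    T.rep v a = T.rep v b := by
  have key : ∀ {a b : Fin n}, T.graph.Adj a b → v ≠ a → T.graph.dist v a < T.graph.dist v b →
      T.rep v a = T.rep v b := by
    intro a b hab ha hlt
    symm
    apply T.rep_eq (T.adj_rep ha)
    have h1 := T.dist_rep_lt ha
    have h2 : T.graph.dist (T.rep v a) b ≤ T.graph.dist (T.rep v a) a + T.graph.dist a b :=
      T.isTree.connected.dist_triangle
    rw [SimpleGraph.dist_eq_one_iff_adj.mpr hab] at h2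
    omega
  rcases lt_or_gt_of_ne (T.isTree.dist_ne_of_adj v hab) with h | h
  · exact key hab ha h
  · exact (key hab.symm hb h).symm

/-- A set of vertices is gathered if it is not separated by any vertex outside it; in a tree, this
means that it is connected. -/
def Gathered (Y : Finset (Fin n)) : Prop :=
  ∀ v, v ∉ Y → ∀ x ∈ Y, ∀ y ∈ Y, T.rep v x = T.rep v y

theorem gathered_univ : T.Gathered Finset.univ := fun v hv => absurd (Finset.mem_univ v) hv

theorem gathered_singleton (v : Fin n) : T.Gathered {v} := by
  intro w _ x hx y hy
  rw [Finset.mem_singleton] at hx hy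
  rw [hx, hy]

variable {T}

theorem Gathered.insert {Y : Finset (Fin n)} (hY : T.Gathered Y) {u v : Fin n} (hu : u ∈ Y)
    (h : T.graph.Adj u v) : T.Gathered (insert v Y) := by
  intro w hw
  rw [Finset.mem_insert, not_or] at hw
  have key : ∀ x ∈ Insert.insert v Y, T.rep w x = T.rep w u := by
    intro x hx
    rcases Finset.mem_insert.mp hx with rfl | hx
    · exact T.rep_eq_of_adj h.symm hw.1 (fun e => hw.2 (e ▸ hu))
    · exact hY w hw.2 x hx u hu
  intro x hx y hy
  rw [key x hx, key y hy]

/-- If `v` separates `w` from `x`, then `v` and `x` look the same from `w`. The induction walks from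
`x` towards `v`; up to `v` the walk stays on the side of `x`, and so never meets `w`. -/
theorem rep_eq_of_rep_ne {v w x : Fin n} (hw : w ≠ v) (hx : x ≠ v) (h : T.rep v w ≠ T.rep v x) :
    T.rep w x = T.rep w v := by
  have key : ∀ (d : ℕ) (x : Fin n), T.graph.dist v x = d → x ≠ v → T.rep v w ≠ T.rep v x →
      T.rep w x = T.rep w v := by
    intro d
    induction d with
    | zero =>
      intro x hd hx
      exact absurd ((T.isTree.connected.dist_eq_zero_iff).mp hd).symm hx
    | succ d ih =>
      intro x hd hx h
      have hwx : w ≠ x := by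
        rintro rfl
        exact h rfl
      have hadj := T.adj_rep hx
      have hlt := T.dist_rep_lt hx
      have htri : T.graph.dist v x ≤ T.graph.dist v (T.rep x v) + T.graph.dist (T.rep x v) x :=
        T.isTree.connected.dist_triangle
      rw [SimpleGraph.dist_eq_one_iff_adj.mpr hadj.symm] at htri
      rw [SimpleGraph.dist_comm (u := T.rep x v), SimpleGraph.dist_comm (u := x)] at hlt
      by_cases hv : T.rep x v = v
      · rw [hv] at hadj
        exact T.rep_eq_of_adj hadj hwx hw
      · have h1 : T.rep v (T.rep x v) = T.rep v x :=
          (T.rep_eq_of_adj hadj (Ne.symm hx) (Ne.symm hv)).symm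
        have hw2 : w ≠ T.rep x v := by
          intro e
          apply h
          rw [← h1, ← e]
        rw [T.rep_eq_of_adj hadj hwx hw2]
        exact ih _ (by omega) hv (by rwa [h1])
  exact key _ x rfl hx h

/-- The targets in `Z` for which the reply to a query of `v` is `u`. -/
noncomputable def side (T : WeightedTree n) (Z : Finset (Fin n)) (v u : Fin n) : Finset (Fin n) :=
  Z.filter fun x => v ≠ x ∧ T.rep v x = u

theorem mem_side {Z : Finset (Fin n)} {v u x : Fin n} :
    x ∈ T.side Z v u ↔ x ∈ Z ∧ v ≠ x ∧ T.rep v x = u := by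
  simp [side]

/-- The candidates that remain after a reply are again connected, so the induction over decision
trees only meets gathered sets. -/
theorem Gathered.side {Z : Finset (Fin n)} (hZ : T.Gathered Z) (v u : Fin n) :
    T.Gathered (T.side Z v u) := by
  intro w hw x hx y hy
  rw [mem_side] at hw hx hy
  by_cases hwZ : w ∈ Z
  · by_cases hwv : w = v
    · rw [hwv, hx.2.2, hy.2.2]
    · have h1 : T.rep v w ≠ u := fun e => hw ⟨hwZ, Ne.symm hwv, e⟩
      rw [rep_eq_of_rep_ne hwv hx.2.1.symm (by rw [hx.2.2]; exact h1),
        rep_eq_of_rep_ne hwv hy.2.1.symm (by rw [hy.2.2]; exact h1)]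
  · exact hZ w hwZ x hx.1 y hy.1

end WeightedTree

/-! ### From a decision tree to a schedule in boxes -/

namespace WeightedTree

variable {n : ℕ} {T : WeightedTree n}

namespace DecisionTree

theorem located_query_of_ne {v x : Fin n} {next : T.graph.neighborSet v → T.DecisionTree}
    (h : v ≠ x) : (query v next).located x = (next (T.reply v x h)).located x := by
  simp [located, h]

theorem queries_query_self {v : Fin n} {next : T.graph.neighborSet v → T.DecisionTree} :
    (query v next).queries v = [v] := by
  simp [queries]

theorem queries_query_of_ne {v x : Fin n} {next : T.graph.neighborSet v → T.DecisionTree}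
    (h : v ≠ x) : (query v next).queries x = v :: (next (T.reply v x h)).queries x := by
  simp [queries, h]

theorem costAt_query_self {v : Fin n} {next : T.graph.neighborSet v → T.DecisionTree} :
    (query v next).costAt v = T.weight v := by
  simp [costAt, queries_query_self]

theorem costAt_query_of_ne {v x : Fin n} {next : T.graph.neighborSet v → T.DecisionTree}
    (h : v ≠ x) :
    (query v next).costAt x = T.weight v + (next (T.reply v x h)).costAt x := by
  simp [costAt, queries_query_of_ne h]

theorem costAt_nonneg (S : T.DecisionTree) (x : Fin n) : 0 ≤ S.costAt x := by
  apply List.sum_nonneg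
  intro r hr
  obtain ⟨v, _, rfl⟩ := List.mem_map.mp hr
  exact T.weight_nonneg v

theorem costAt_le_cost (S : T.DecisionTree) (x : Fin n) : S.costAt x ≤ S.cost :=
  le_ciSup (f := fun x => S.costAt x) (Set.finite_range _).bddAbove x

theorem cost_nonneg (S : T.DecisionTree) : 0 ≤ S.cost :=
  Real.iSup_nonneg fun x => S.costAt_nonneg x

end DecisionTree

/-- The number of time units in `[s, e)` that belong to the `i`-th box of length `M`. -/
def boxLoad (M s e i : ℕ) : ℕ := min e ((i + 1) * M) - max s (i * M)

theorem boxLoad_self (M s i : ℕ) : boxLoad M s s i = 0 := by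
  unfold boxLoad
  omega

theorem boxLoad_of_le {M s e i : ℕ} (h : (i + 1) * M ≤ s) : boxLoad M s e i = 0 := by
  unfold boxLoad
  omega

theorem Gathered.subset_side {Y Z : Finset (Fin n)} (hY : T.Gathered Y) (hYZ : Y ⊆ Z) {v y : Fin n}
    (hv : v ∉ Y) (hy : y ∈ Y) : Y ⊆ T.side Z v (T.rep v y) := by
  intro x hx
  rw [mem_side]
  exact ⟨hYZ hx, fun e => hv (e ▸ hx), hY v hv x hx y hy⟩

/-- With `a` a largest side, this leaves less than half of `Z` for any other side, which is what
bounds the number of waits by a binary logarithm. -/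
theorem card_side_add_card_side {Z : Finset (Fin n)} {v a b : Fin n} (hv : v ∈ Z) (hab : a ≠ b) :
    (T.side Z v a).card + (T.side Z v b).card + 1 ≤ Z.card := by
  rw [← Finset.card_union_of_disjoint]
  · have h : v ∉ T.side Z v a ∪ T.side Z v b := by
      simp [mem_side]
    rw [← Finset.card_insert_of_notMem h]
    apply Finset.card_le_card
    intro x hx
    rcases Finset.mem_insert.mp hx with rfl | hx
    · exact hv
    · rcases Finset.mem_union.mp hx with hx | hx
      · exact (mem_side.mp hx).1
      · exact (mem_side.mp hx).1
  · rw [Finset.disjoint_left]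
    intro x hx hx'
    exact hab ((mem_side.mp hx).2.2.symm.trans (mem_side.mp hx').2.2)

theorem card_side_lt {Z : Finset (Fin n)} {v a : Fin n} (hv : v ∈ Z) :
    (T.side Z v a).card + 1 ≤ Z.card := by
  apply Nat.succ_le_of_lt
  apply Finset.card_lt_card
  refine ⟨fun x hx => (mem_side.mp hx).1, fun h => ?_⟩
  exact (mem_side.mp (h hv)).2.1 rfl

/-- A decision tree for the targets in `Z` gives a schedule from time `σ` on: the vertex `x` is either
idle, or is processed in the time units `[st x, en x)`. -/
structure IsSchedule (T : WeightedTree n) (η c : ℝ) (M σ : ℕ) (Z : Finset (Fin n))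
    (st en : Fin n → ℕ) (idle : Fin n → Prop) : Prop where
  eq_of_idle : ∀ x ∈ Z, idle x → st x = en x
  start_le : ∀ x ∈ Z, ¬ idle x → σ ≤ st x
  lt_end : ∀ x ∈ Z, ¬ idle x → st x < en x
  weight_le : ∀ x ∈ Z, ¬ idle x → T.weight x ≤ η * ((en x - st x : ℕ) : ℝ)
  end_le : ∀ x ∈ Z, ¬ idle x →
    η * en x ≤ η * σ + c + η * Z.card + η * M * (Nat.log 2 Z.card : ℕ)
  -- An idle vertex counts as ending after every box.
  load_le : ∀ Y ⊆ Z, T.Gathered Y → ∀ i, (∀ v ∈ Y, idle v ∨ i * M < en v) →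
    ∑ x ∈ Y, boxLoad M (st x) (en x) i ≤ M
  -- This is what makes the induction work: a schedule that starts in the middle of a box must fit
  -- into the rest of that box.
  total_load_le : ∀ i, i * M ≤ σ → ∑ x ∈ Z, boxLoad M (st x) (en x) i ≤ (i + 1) * M - σ
  card_le_of_idle : ∀ Y ⊆ Z, T.Gathered Y → (∀ v ∈ Y, idle v) → Y.card ≤ 1

theorem exists_isSchedule_of_card_le_one (η c : ℝ) (M σ : ℕ) (Z : Finset (Fin n))
    (hZ : Z.card ≤ 1) : ∃ st en idle, T.IsSchedule η c M σ Z st en idle := by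
  refine ⟨fun _ => 0, fun _ => 0, fun _ => True, ?_, ?_, ?_, ?_, ?_, ?_, ?_, ?_⟩
  · simp
  · simp
  · simp
  · simp
  · simp
  · simp [boxLoad_self]
  · simp [boxLoad_self]
  · intro Y hY _ _
    exact (Finset.card_le_card hY).trans hZ

/-- The vertex `v` occupies `[σ, e)`, a largest side continues at `e`, and all other sides start at
the box boundary `f`. A wait of at most `M` units is paid for by the logarithm, since a waiting side
has less than half of the vertices. -/
theorem exists_isSchedule_query {η : ℝ} (hη : 0 < η) {M : ℕ} (hM : 0 < M) {v : Fin n}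
    {Z : Finset (Fin n)} (hv : v ∈ Z) {c : ℝ} (hcv : T.weight v ≤ c) (σ : ℕ)
    (ih : ∀ (u : T.graph.neighborSet v) (τ : ℕ),
      ∃ st en idle, T.IsSchedule η (c - T.weight v) M τ (T.side Z v u) st en idle) :
    ∃ st en idle, T.IsSchedule η c M σ Z st en idle := by
  classical
  -- The maximum may range over all vertices, because the side of a vertex that is not a neighbour
  -- of `v` is empty.
  obtain ⟨a, -, ha⟩ := Finset.exists_max_image Finset.univ (fun u => (T.side Z v u).card)
    ⟨v, Finset.mem_univ v⟩
  -- The floor plus one, rather than the ceiling, gives even a vertex of weight zero a unit; this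
  -- keeps its code nonzero.
  obtain ⟨e, he1, he2, he3⟩ : ∃ e : ℕ, σ < e ∧ T.weight v ≤ η * ((e - σ : ℕ) : ℝ) ∧
      η * e ≤ η * σ + T.weight v + η := by
    refine ⟨σ + (⌊T.weight v / η⌋₊ + 1), by omega, ?_, ?_⟩
    · rw [Nat.add_sub_cancel_left]
      have h := Nat.lt_floor_add_one (T.weight v / η)
      rw [div_lt_iff₀ hη] at h
      push_cast
      linarith
    · have h := Nat.floor_le (div_nonneg (T.weight_nonneg v) hη.le)
      rw [le_div_iff₀ hη] at h
      push_cast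
      linarith
  obtain ⟨f, hf1, hf2⟩ : ∃ f, (∀ i, i * M < e → (i + 1) * M ≤ f) ∧ e ≤ f ∧ f ≤ e + M := by
    refine ⟨(e / M + 1) * M, ?_, ?_, ?_⟩
    · intro i hi
      apply Nat.mul_le_mul_right
      have := (Nat.le_div_iff_mul_le hM).mpr hi.le
      omega
    · have h1 := Nat.lt_div_mul_add hM (a := e)
      rw [Nat.add_mul]
      omega
    · have h1 := Nat.div_mul_le_self e M
      rw [Nat.add_mul]
      omega
  choose st en idle h using fun u : T.graph.neighborSet v => ih u (if (u : Fin n) = a then e else f)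
  set st' : Fin n → ℕ := fun x => if h : v ≠ x then st (T.reply v x h) x else σ with hst'
  set en' : Fin n → ℕ := fun x => if h : v ≠ x then en (T.reply v x h) x else e with hen'
  set idle' : Fin n → Prop := fun x => if h : v ≠ x then idle (T.reply v x h) x else False
    with hidle'
  have hstv : st' v = σ := by simp [hst']
  have henv : en' v = e := by simp [hen']
  have hidlev : ¬ idle' v := by simp [hidle']
  have hstu : ∀ (u : T.graph.neighborSet v), ∀ x ∈ T.side Z v u,
      st' x = st u x ∧ en' x = en u x ∧ (idle' x ↔ idle u x) := by
    intro u x hx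
    obtain ⟨_, hvx, hu⟩ := mem_side.mp hx
    rw [T.rep_of_ne hvx] at hu
    have hu' : T.reply v x hvx = u := Subtype.ext hu
    simp only [hst', hen', hidle', dif_pos hvx, hu', and_self]
  have hside : ∀ x ∈ Z, v ≠ x → ∃ u : T.graph.neighborSet v, x ∈ T.side Z v u := by
    intro x hx hvx
    refine ⟨T.reply v x hvx, mem_side.mpr ⟨hx, hvx, T.rep_of_ne hvx⟩⟩
  -- A connected set that avoids `v` lies on a single side, where the schedule of that side takes
  -- over.
  have hsub : ∀ Y ⊆ Z, T.Gathered Y → v ∉ Y → Y = ∅ ∨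
      ∃ u : T.graph.neighborSet v, Y ⊆ T.side Z v u := by
    intro Y hY hYg hvY
    rcases Y.eq_empty_or_nonempty with rfl | ⟨y, hy⟩
    · exact Or.inl rfl
    · have hvy : v ≠ y := fun e => hvY (e ▸ hy)
      exact Or.inr ⟨⟨_, T.adj_rep hvy⟩, hYg.subset_side hY hvY hy⟩
  have hτ : ∀ u : T.graph.neighborSet v, e ≤ (if (u : Fin n) = a then e else f) := by
    intro u
    split_ifs
    · exact le_rfl
    · exact hf2.1
  -- The waiting sides start after every box that begins before `e`. In such a box only side `a`
  -- follows `v`, and it fits into the rest of the box by `total_load_le`.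
  have hrest : ∀ i, i * M < e →
      ∑ x ∈ Z.erase v, boxLoad M (st' x) (en' x) i ≤ (i + 1) * M - e := by
    intro i hi
    rw [← Finset.sum_filter_add_sum_filter_not (Z.erase v) (fun x => T.rep v x = a)]
    have h2 : ∑ x ∈ (Z.erase v).filter (fun x => ¬ T.rep v x = a),
        boxLoad M (st' x) (en' x) i = 0 := by
      apply Finset.sum_eq_zero
      intro x hx
      rw [Finset.mem_filter, Finset.mem_erase] at hx
      obtain ⟨⟨hxv, hxZ⟩, hxa⟩ := hx
      obtain ⟨u, hu⟩ := hside x hxZ (Ne.symm hxv)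
      obtain ⟨e1, e2, e3⟩ := hstu u x hu
      rw [e1, e2]
      have hua : (u : Fin n) ≠ a := by rwa [← (mem_side.mp hu).2.2]
      by_cases hid : idle u x
      · rw [(h u).eq_of_idle x hu hid, boxLoad_self]
      · apply boxLoad_of_le
        have := (h u).start_le x hu hid
        rw [if_neg hua] at this
        exact (hf1 i hi).trans this
    have h1 : ∑ x ∈ (Z.erase v).filter (fun x => T.rep v x = a), boxLoad M (st' x) (en' x) i ≤
        (i + 1) * M - e := by
      have hs : (Z.erase v).filter (fun x => T.rep v x = a) = T.side Z v a := by
        ext x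
        simp only [Finset.mem_filter, Finset.mem_erase, mem_side]
        tauto
      rw [hs]
      rcases (T.side Z v a).eq_empty_or_nonempty with h0 | ⟨y, hy⟩
      · simp [h0]
      · have hay : T.graph.Adj v a := by
          have := T.adj_rep (mem_side.mp hy).2.1
          rwa [(mem_side.mp hy).2.2] at this
        have h3 := (h ⟨a, hay⟩).total_load_le i (by simpa using hi.le)
        simp only [if_true] at h3
        refine le_trans (le_of_eq ?_) h3
        apply Finset.sum_congr rfl
        intro x hx
        obtain ⟨e1, e2, -⟩ := hstu ⟨a, hay⟩ x hx
        rw [e1, e2]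
    omega
  have hsum : ∀ i, i * M < e → ∑ x ∈ Z, boxLoad M (st' x) (en' x) i ≤
      (min e ((i + 1) * M) - max σ (i * M)) + ((i + 1) * M - e) := by
    intro i hi
    rw [← Finset.add_sum_erase Z _ hv, hstv, henv]
    exact Nat.add_le_add_left (hrest i hi) _
  refine ⟨st', en', idle', ?_, ?_, ?_, ?_, ?_, ?_, ?_, ?_⟩
  · intro x hx hid
    by_cases hvx : v = x
    · exact absurd hid (hvx ▸ hidlev)
    · obtain ⟨u, hu⟩ := hside x hx hvx
      obtain ⟨e1, e2, e3⟩ := hstu u x hu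
      rw [e1, e2]
      exact (h u).eq_of_idle x hu (e3.mp hid)
  · intro x hx hid
    by_cases hvx : v = x
    · rw [← hvx, hstv]
    · obtain ⟨u, hu⟩ := hside x hx hvx
      obtain ⟨e1, e2, e3⟩ := hstu u x hu
      rw [e1]
      have := (h u).start_le x hu (fun i => hid (e3.mpr i))
      have := hτ u
      omega
  · intro x hx hid
    by_cases hvx : v = x
    · rw [← hvx, hstv, henv]
      exact he1
    · obtain ⟨u, hu⟩ := hside x hx hvx
      obtain ⟨e1, e2, e3⟩ := hstu u x hu
      rw [e1, e2]
      exact (h u).lt_end x hu (fun i => hid (e3.mpr i))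
  · intro x hx hid
    by_cases hvx : v = x
    · rw [← hvx, hstv, henv]
      exact he2
    · obtain ⟨u, hu⟩ := hside x hx hvx
      obtain ⟨e1, e2, e3⟩ := hstu u x hu
      rw [e1, e2]
      exact (h u).weight_le x hu (fun i => hid (e3.mpr i))
  · intro x hx hid
    have hZ1 : (1 : ℝ) ≤ Z.card := by
      exact_mod_cast Finset.card_pos.mpr ⟨v, hv⟩
    by_cases hvx : v = x
    · rw [← hvx, henv]
      have h1 : 0 ≤ η * M * (Nat.log 2 Z.card : ℕ) := by positivity
      nlinarith
    · obtain ⟨u, hu⟩ := hside x hx hvx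
      obtain ⟨e1, e2, e3⟩ := hstu u x hu
      rw [e2]
      have h1 := (h u).end_le x hu (fun i => hid (e3.mpr i))
      refine h1.trans ?_
      have hc1 := card_side_lt (T := T) (a := u) hv
      have hc1' : ((T.side Z v u).card : ℝ) + 1 ≤ Z.card := by exact_mod_cast hc1
      by_cases hua : (u : Fin n) = a
      · rw [if_pos hua]
        have hlog : (Nat.log 2 (T.side Z v u).card : ℝ) ≤ Nat.log 2 Z.card := by
          exact_mod_cast Nat.log_mono_right (by omega)
        have h2 : η * M * (Nat.log 2 (T.side Z v u).card : ℝ) ≤ η * M * Nat.log 2 Z.card :=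
          mul_le_mul_of_nonneg_left hlog (by positivity)
        nlinarith
      · rw [if_neg hua]
        have hc2 := card_side_add_card_side (T := T) hv hua
        have hc3 := ha u (Finset.mem_univ _)
        have hpos : (T.side Z v u).card ≠ 0 := Finset.card_ne_zero_of_mem hu
        have hlog : (Nat.log 2 (T.side Z v u).card : ℝ) + 1 ≤ Nat.log 2 Z.card := by
          have : Nat.log 2 (T.side Z v u).card + 1 ≤ Nat.log 2 Z.card := by
            rw [← Nat.log_mul_base (by norm_num) hpos]
            exact Nat.log_mono_right (by omega)
          exact_mod_cast this
        have h2 : η * M * ((Nat.log 2 (T.side Z v u).card : ℝ) + 1) ≤ η * M * Nat.log 2 Z.card :=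
          mul_le_mul_of_nonneg_left hlog (by positivity)
        have hf3 : η * (f : ℝ) ≤ η * (e + M) := by
          apply mul_le_mul_of_nonneg_left _ hη.le
          exact_mod_cast hf2.2
        nlinarith
  · intro Y hY hYg i hi
    by_cases hvY : v ∈ Y
    · have hie : i * M < e := by
        rcases hi v hvY with h0 | h0
        · exact absurd h0 hidlev
        · rwa [henv] at h0
      have h1 : ∑ x ∈ Y, boxLoad M (st' x) (en' x) i ≤ ∑ x ∈ Z, boxLoad M (st' x) (en' x) i :=
        Finset.sum_le_sum_of_subset hY
      have h2 := hsum i hie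
      have h3 : (i + 1) * M = i * M + M := by ring
      omega
    · rcases hsub Y hY hYg hvY with rfl | ⟨u, hu⟩
      · simp
      · have h1 := (h u).load_le Y hu hYg i (by
          intro y hy
          obtain ⟨e1, e2, e3⟩ := hstu u y (hu hy)
          rw [← e2, ← e3]
          exact hi y hy)
        refine le_trans (le_of_eq ?_) h1
        apply Finset.sum_congr rfl
        intro x hx
        obtain ⟨e1, e2, -⟩ := hstu u x (hu hx)
        rw [e1, e2]
  · intro i hi
    have h2 := hsum i (by omega)
    omega
  · intro Y hY hYg hi
    have hvY : v ∉ Y := fun hvY => hidlev (hi v hvY)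
    rcases hsub Y hY hYg hvY with rfl | ⟨u, hu⟩
    · simp
    · exact (h u).card_le_of_idle Y hu hYg fun y hy => (hstu u y (hu hy)).2.2.mp (hi y hy)

/-- The induction over the decision tree keeps `Z` gathered and lowers the budget `c` by the weight
of each vertex of `Z` that is queried. -/
theorem exists_isSchedule {η : ℝ} (hη : 0 < η) {M : ℕ} (hM : 0 < M) (S : T.DecisionTree) :
    ∀ (Z : Finset (Fin n)), T.Gathered Z → (∀ x ∈ Z, S.located x = x) →
    ∀ c : ℝ, (∀ x ∈ Z, S.costAt x ≤ c) → ∀ σ : ℕ,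
    ∃ st en idle, T.IsSchedule η c M σ Z st en idle := by
  induction S with
  | answer v =>
    -- A leaf announces one vertex, so it can be correct for at most one target, which may then stay
    -- idle.
    intro Z _ hloc c _ σ
    apply exists_isSchedule_of_card_le_one
    apply Finset.card_le_one.mpr
    intro a ha b hb
    rw [← hloc a ha, ← hloc b hb]
    rfl
  | query v next ih =>
    intro Z hZ hloc c hc σ
    have key : ∀ u : T.graph.neighborSet v, ∀ x (h : v ≠ x), T.rep v x = u → x ∈ Z →
        (next u).located x = x ∧ T.weight v + (next u).costAt x ≤ c := by
      intro u x h hu hx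
      have hu' : T.reply v x h = u := Subtype.ext ((T.rep_of_ne h).symm.trans hu)
      have h1 := hloc x hx
      have h2 := hc x hx
      rw [DecisionTree.located_query_of_ne h, hu'] at h1
      rw [DecisionTree.costAt_query_of_ne h, hu'] at h2
      exact ⟨h1, h2⟩
    by_cases hv : v ∈ Z
    · have hcv := hc v hv
      rw [DecisionTree.costAt_query_self] at hcv
      apply exists_isSchedule_query hη hM hv hcv
      intro u τ
      apply ih u _ (hZ.side v u)
      · intro x hx
        rw [mem_side] at hx
        exact (key u x hx.2.1 hx.2.2 hx.1).1
      · intro x hx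
        rw [mem_side] at hx
        have := (key u x hx.2.1 hx.2.2 hx.1).2
        linarith
    -- A query outside the gathered set `Z` has the same reply for all of `Z`: it yields no
    -- information and is dropped.
    · rcases Z.eq_empty_or_nonempty with rfl | ⟨y, hy⟩
      · apply exists_isSchedule_of_card_le_one
        simp
      · have hne : ∀ x ∈ Z, v ≠ x := fun x hx e => hv (e ▸ hx)
        apply ih ⟨_, T.adj_rep (hne y hy)⟩ Z hZ
        · intro x hx
          exact (key _ x (hne x hx) (hZ v hv x hx y hy) hx).1
        · intro x hx
          have := (key ⟨_, T.adj_rep (hne y hy)⟩ x (hne x hx) (hZ v hv x hx y hy) hx).2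
          have := T.weight_nonneg v
          linarith

end WeightedTree

/-! ### Load vectors as numbers -/

/-- The `i`-th digit of `x` to the base `B`. -/
def digit (B x i : ℕ) : ℕ := x / B ^ i % B

theorem digit_succ (B x i : ℕ) : digit B x (i + 1) = digit B (x / B) i := by
  rw [digit, digit, pow_succ', Nat.div_div_eq_div_mul]

theorem digit_zero_right (B x : ℕ) : digit B x 0 = x % B := by
  simp [digit]

theorem digit_lt {B : ℕ} (hB : 0 < B) (x i : ℕ) : digit B x i < B := Nat.mod_lt _ hB

theorem digit_eq_zero_of_lt {B x i : ℕ} (h : x < B ^ i) : digit B x i = 0 := by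
  simp [digit, Nat.div_eq_of_lt h]

/-- The sum of the digits of `x` to the base `B`. -/
def digitSum (B x : ℕ) : ℕ := (Nat.digits B x).sum

theorem digitSum_eq {B : ℕ} (hB : 1 < B) (x : ℕ) :
    digitSum B x = if x = 0 then 0 else x % B + digitSum B (x / B) := by
  split_ifs with h
  · simp [digitSum, h]
  · rw [digitSum, Nat.digits_def' hB (Nat.pos_of_ne_zero h)]
    simp [digitSum]

theorem digitSum_eq_sum {B : ℕ} (hB : 1 < B) :
    ∀ (K x : ℕ), x < B ^ K → digitSum B x = ∑ i ∈ Finset.range K, digit B x i := by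
  intro K
  induction K with
  | zero =>
    intro x hx
    have : x = 0 := by simpa using hx
    simp [this, digitSum]
  | succ K ih =>
    intro x hx
    rw [Finset.sum_range_succ', digitSum_eq hB]
    simp only [digit_succ, digit_zero_right]
    rw [← ih (x / B) (Nat.div_lt_of_lt_mul (by rwa [pow_succ'] at hx))]
    split_ifs with h
    · subst h
      simp [digitSum]
    · exact Nat.add_comm _ _

theorem digitSum_le {B : ℕ} (x : ℕ) : digitSum B x ≤ x := Nat.digit_sum_le B x

theorem digitSum_pos {B x : ℕ} (hB : 1 < B) (hx : 0 < x) : 0 < digitSum B x := by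
  induction x using Nat.strong_induction_on with
  | _ x ih =>
    rw [digitSum_eq hB, if_neg hx.ne']
    rcases Nat.eq_zero_or_pos (x / B) with h | h
    · have := Nat.div_add_mod x B
      rw [h] at this
      omega
    · have := ih _ (Nat.div_lt_self hx hB) h
      omega

theorem sum_mul_pow_lt {B : ℕ} (d : ℕ → ℕ) (hd : ∀ i, d i < B) (K : ℕ) :
    ∑ i ∈ Finset.range K, d i * B ^ i < B ^ K := by
  induction K with
  | zero => simp
  | succ K ih =>
    rw [Finset.sum_range_succ]
    have h1 : (d K + 1) * B ^ K ≤ B * B ^ K := Nat.mul_le_mul_right _ (hd K)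
    rw [pow_succ']
    nlinarith

theorem digit_sum_mul_pow {B : ℕ} :
    ∀ (K : ℕ) (d : ℕ → ℕ), (∀ i, d i < B) → ∀ i < K,
      digit B (∑ j ∈ Finset.range K, d j * B ^ j) i = d i := by
  intro K
  induction K with
  | zero => intro d _ i hi; omega
  | succ K ih =>
    intro d hd i hi
    have hB : 0 < B := (Nat.zero_le _).trans_lt (hd 0)
    have hsplit : ∑ j ∈ Finset.range (K + 1), d j * B ^ j =
        d 0 + B * ∑ j ∈ Finset.range K, d (j + 1) * B ^ j := by
      rw [Finset.sum_range_succ', Finset.mul_sum, Nat.add_comm]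
      congr 1
      · simp
      · apply Finset.sum_congr rfl
        intro j _
        rw [pow_succ']
        ring
    rw [hsplit]
    cases i with
    | zero =>
      rw [digit_zero_right, Nat.add_mul_mod_self_left, Nat.mod_eq_of_lt (hd 0)]
    | succ i =>
      rw [digit_succ, Nat.add_mul_div_left _ _ hB, Nat.div_eq_of_lt (hd 0), Nat.zero_add]
      exact ih (fun j => d (j + 1)) (fun j => hd _) i (by omega)

/-- Adds the digits of `y` to those of `x`, leaving out the digits of `y` beyond the first digit of
`x`. The result is `0` if a sum of digits is not a digit, and otherwise one more than the number
with the resulting digits. -/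
def merge (B x y : ℕ) : ℕ :=
  if h : x = 0 ∨ B ≤ 1 then 1
  else if x % B + y % B < B ∧ 0 < merge B (x / B) (y / B) then
    x % B + y % B + B * (merge B (x / B) (y / B) - 1) + 1
  else 0
termination_by x
decreasing_by all_goals exact Nat.div_lt_self (by omega) (by omega)

theorem merge_zero (B y : ℕ) : merge B 0 y = 1 := by
  rw [merge]
  simp

theorem merge_of_pos {B x : ℕ} (hB : 1 < B) (hx : 0 < x) (y : ℕ) :
    merge B x y = if x % B + y % B < B ∧ 0 < merge B (x / B) (y / B) then
      x % B + y % B + B * (merge B (x / B) (y / B) - 1) + 1 else 0 := by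
  rw [merge, dif_neg (by omega)]

/-- The second part says that merging leaves the position of the leading digit of `x` unchanged.
This holds because digits of `y` beyond that position are not added. -/
theorem merge_spec {B : ℕ} (hB : 1 < B) (x : ℕ) : ∀ y z, merge B x y = z + 1 → ∀ i,
    (digit B z i = digit B x i + if B ^ i ≤ x then digit B y i else 0) ∧
      (B ^ i ≤ z ↔ B ^ i ≤ x) := by
  induction x using Nat.strong_induction_on with
  | _ x ih =>
    intro y z h
    rcases Nat.eq_zero_or_pos x with rfl | hx
    · rw [merge_zero] at h
      have hz : z = 0 := by omega
      subst hz
      intro i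
      have : ¬ B ^ i ≤ 0 := by
        have : 0 < B ^ i := by positivity
        omega
      simp [this]
    · rw [merge_of_pos hB hx] at h
      split_ifs at h with hc
      obtain ⟨w, hw⟩ : ∃ w, merge B (x / B) (y / B) = w + 1 := ⟨_, (Nat.succ_pred_eq_of_pos hc.2).symm⟩
      rw [hw, Nat.add_sub_cancel] at h
      have hz : z = x % B + y % B + B * w := by omega
      have hz1 : z % B = x % B + y % B := by
        rw [hz, Nat.add_mul_mod_self_left, Nat.mod_eq_of_lt hc.1]
      have hz2 : z / B = w := by
        rw [hz, Nat.add_mul_div_left _ _ (by omega), Nat.div_eq_of_lt hc.1, Nat.zero_add]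
      have ih' := ih _ (Nat.div_lt_self hx hB) _ _ hw
      intro i
      cases i with
      | zero =>
        simp only [digit_zero_right, pow_zero]
        refine ⟨by rw [if_pos (show 1 ≤ x from hx), hz1], ?_⟩
        have h0 := (ih' 0).2
        rw [pow_zero] at h0
        refine ⟨fun _ => hx, fun _ => ?_⟩
        by_contra hz0
        have hz0' : z = 0 := by omega
        rw [hz0', Nat.zero_mod] at hz1
        rw [hz0', Nat.zero_div] at hz2
        have h4 := Nat.div_add_mod x B
        have h5 : x / B = 0 := by
          rw [← hz2] at h0
          exact Nat.eq_zero_of_not_pos fun h6 => absurd (h0.mpr h6) (by omega)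
        rw [h5] at h4
        omega
      | succ i =>
        have h1 := ih' i
        have key : ∀ t, B ^ (i + 1) ≤ t ↔ B ^ i ≤ t / B := by
          intro t
          rw [Nat.le_div_iff_mul_le (by omega), pow_succ]
        simp only [digit_succ, key, hz2]
        exact h1

theorem merge_pos {B : ℕ} (hB : 1 < B) (x : ℕ) :
    ∀ y, (∀ i, B ^ i ≤ x → digit B x i + digit B y i < B) → 0 < merge B x y := by
  induction x using Nat.strong_induction_on with
  | _ x ih =>
    intro y h
    rcases Nat.eq_zero_or_pos x with rfl | hx
    · rw [merge_zero]
      exact Nat.one_pos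
    · rw [merge_of_pos hB hx, if_pos]
      · omega
      · have h0 := h 0 (by rw [pow_zero]; exact hx)
        rw [digit_zero_right, digit_zero_right] at h0
        refine ⟨h0, ih _ (Nat.div_lt_self hx hB) _ ?_⟩
        intro i hi
        rw [← digit_succ, ← digit_succ]
        apply h
        rwa [Nat.le_div_iff_mul_le (by omega), ← pow_succ] at hi

theorem merge_le {B x y j : ℕ} (hB : 1 < B) (h : x < B ^ j) : merge B x y ≤ B ^ j := by
  rcases Nat.eq_zero_or_pos (merge B x y) with h0 | h0
  · omega
  · obtain ⟨z, hz⟩ : ∃ z, merge B x y = z + 1 := ⟨_, (Nat.succ_pred_eq_of_pos h0).symm⟩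
    have := (merge_spec hB x y z hz j).2
    omega

/-- The capacities of the boxes: `n` for the boxes below `K`, and `1` for the last one. -/
def capacity (n K i : ℕ) : ℕ := if i < K then n else 1

theorem digit_le_capacity {n K x : ℕ} (hx : x < 2 * (n + 1) ^ K) (i : ℕ) :
    digit (n + 1) x i ≤ capacity n K i := by
  unfold capacity
  split_ifs with h
  · exact Nat.le_of_lt_succ (digit_lt (Nat.succ_pos n) x i)
  · have h1 : (n + 1) ^ K ≤ (n + 1) ^ i := Nat.pow_le_pow_right (by omega) (by omega)
    have h2 : x / (n + 1) ^ i < 2 := Nat.div_lt_of_lt_mul (by nlinarith)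
    exact (Nat.mod_le _ _).trans (by omega)

/-! ### Trees that grow by leaves -/

namespace WeightedTree

variable {n : ℕ} {T : WeightedTree n}

/-- The vertices that are present after `s` steps. -/
def reached (root : Fin n) (sv : ℕ → Fin n) (s : ℕ) : Finset (Fin n) :=
  insert root ((Finset.range s).image sv)

theorem reached_zero (root : Fin n) (sv : ℕ → Fin n) : reached root sv 0 = {root} := by
  simp [reached]

theorem reached_succ (root : Fin n) (sv : ℕ → Fin n) (s : ℕ) :
    reached root sv (s + 1) = insert (sv s) (reached root sv s) := by
  simp [reached, Finset.range_add_one, Finset.image_insert, Finset.insert_comm]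

theorem reached_mono (root : Fin n) (sv : ℕ → Fin n) : Monotone (reached root sv) :=
  monotone_nat_of_le_succ fun s => by
    rw [reached_succ]
    exact Finset.subset_insert _ _

/-- The tree grows from `root` by adding, in step `s`, the leaf `sv s` at the vertex `su s`. -/
structure Growth (T : WeightedTree n) (root : Fin n) (r : ℕ) (sv su : ℕ → Fin n) : Prop where
  adj : ∀ s < r, T.graph.Adj (su s) (sv s)
  mem : ∀ s < r, su s ∈ reached root sv s
  notMem : ∀ s < r, sv s ∉ reached root sv s
  reached_eq : reached root sv r = Finset.univ

namespace Growth

variable {root : Fin n} {r : ℕ} {sv su : ℕ → Fin n}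

theorem ne (h : T.Growth root r sv su) {s : ℕ} (hs : s < r) : sv s ≠ su s :=
  fun e => h.notMem s hs (e ▸ h.mem s hs)

/-- The vertices reached before the leaf `sv s` hang together without it, so they all lie on the
side of its only earlier neighbour `su s`. -/
theorem rep_eq (h : T.Growth root r sv su) {s : ℕ} (hs : s < r) {y : Fin n}
    (hy : y ∈ reached root sv s) : T.rep (sv s) y = su s := by
  have key : ∀ k ≤ s, ∀ y ∈ reached root sv k, T.rep (sv s) y = T.rep (sv s) root := by
    intro k
    induction k with
    | zero =>
      intro _ y hy
      rw [reached_zero, Finset.mem_singleton] at hy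
      rw [hy]
    | succ k ih =>
      intro hk y hy
      rw [reached_succ, Finset.mem_insert] at hy
      rcases hy with rfl | hy
      · rw [← ih (by omega) _ (h.mem k (by omega))]
        apply T.rep_eq_of_adj (h.adj k (by omega)).symm
        · intro e
          apply h.notMem s hs
          rw [e]
          exact reached_mono root sv hk (by rw [reached_succ]; exact Finset.mem_insert_self _ _)
        · intro e
          apply h.notMem s hs
          rw [e]
          exact reached_mono root sv (by omega) (h.mem k (by omega))
      · exact ih (by omega) y hy
  rw [key s le_rfl y hy, ← key s le_rfl _ (h.mem s hs)]
  exact T.rep_of_adj (h.adj s hs).symm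

/-- If `su s` were missing from `Y`, it would separate the leaf from every other vertex of `Y`.
Conversely, a leaf separates no two earlier vertices, so it can be erased. -/
theorem gathered_erase (h : T.Growth root r sv su) {s : ℕ} (hs : s < r) {Y : Finset (Fin n)}
    (hY : T.Gathered Y) (hsub : Y ⊆ reached root sv (s + 1)) (hne : (Y.erase (sv s)).Nonempty)
    (hv : sv s ∈ Y) : su s ∈ Y ∧ T.Gathered (Y.erase (sv s)) := by
  have hsub' : Y.erase (sv s) ⊆ reached root sv s := by
    intro y hy
    rw [Finset.mem_erase] at hy
    have := hsub hy.2
    rw [reached_succ, Finset.mem_insert] at this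
    tauto
  obtain ⟨y, hy⟩ := hne
  constructor
  · by_contra hu
    have h1 := hY _ hu y (Finset.mem_of_mem_erase hy) _ hv
    rw [T.rep_of_adj (h.adj s hs)] at h1
    have hne : su s ≠ y := fun e => hu (e ▸ Finset.mem_of_mem_erase hy)
    have h2 := T.dist_rep_lt hne
    rw [h1] at h2
    have hne' : sv s ≠ y := (Finset.ne_of_mem_erase hy).symm
    have h3 := T.dist_rep_lt hne'
    rw [h.rep_eq hs (hsub' hy)] at h3
    omega
  · intro w hw x hx y hy
    by_cases hwv : w = sv s
    · rw [hwv, h.rep_eq hs (hsub' hx), h.rep_eq hs (hsub' hy)]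
    · exact hY w (fun hwY => hw (Finset.mem_erase.mpr ⟨hwv, hwY⟩)) x (Finset.mem_of_mem_erase hx) y
        (Finset.mem_of_mem_erase hy)

/-- Every connected set of vertices whose numbers all have an `i`-th digit respects the capacity of
the `i`-th box. -/
def Balanced (T : WeightedTree n) (K : ℕ) (W : Finset (Fin n)) (x : Fin n → ℕ) : Prop :=
  ∀ Y ⊆ W, T.Gathered Y → ∀ i, (∀ v ∈ Y, (n + 1) ^ i ≤ x v) →
    ∑ v ∈ Y, digit (n + 1) (x v) i ≤ capacity n K i

/-- Soundness of the dynamic program. A connected set of more than one vertex that contains the new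
leaf also contains `su s`; the two digits then add up to the digit of the merged code, and erasing
the leaf leads back to the smaller tree. Without the leaf, the digits are at most those of the
merged state. -/
theorem balanced_of_merge (h : T.Growth root r sv su) {K : ℕ} (L : ℕ → Fin n → ℕ)
    (hlt : ∀ s ≤ r, ∀ v ∈ reached root sv s, L s v < 2 * (n + 1) ^ K)
    (hm : ∀ s < r, merge (n + 1) (L (s + 1) (su s)) (L (s + 1) (sv s)) = L s (su s) + 1)
    (hkeep : ∀ s < r, ∀ v ∈ reached root sv s, v ≠ su s → L (s + 1) v = L s v) :
    ∀ s ≤ r, Balanced T K (reached root sv s) (L s) := by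
  have hn : 1 < n + 1 := by
    have := root.pos
    omega
  intro s
  induction s with
  | zero =>
    intro hs Y hY hYg i hi
    rw [reached_zero, Finset.subset_singleton_iff] at hY
    rcases hY with rfl | rfl
    · simp
    · rw [Finset.sum_singleton]
      exact digit_le_capacity (hlt 0 hs root (by simp [reached])) i
  | succ s ih =>
    intro hs Y hY hYg i hi
    have hs' : s < r := hs
    have hspec := merge_spec hn _ _ _ (hm s hs') i
    have hkey : ∀ y ∈ reached root sv s, ((n + 1) ^ i ≤ L (s + 1) y ↔ (n + 1) ^ i ≤ L s y) := by
      intro y hy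
      by_cases hyu : y = su s
      · rw [hyu]
        exact hspec.2.symm
      · rw [hkeep s hs' y hy hyu]
    have hdig : ∀ y ∈ reached root sv s,
        digit (n + 1) (L (s + 1) y) i ≤ digit (n + 1) (L s y) i := by
      intro y hy
      by_cases hyu : y = su s
      · rw [hyu, hspec.1]
        exact Nat.le_add_right _ _
      · rw [hkeep s hs' y hy hyu]
    by_cases hv : sv s ∈ Y
    · rcases (Y.erase (sv s)).eq_empty_or_nonempty with hE | hE
      · rw [← Finset.add_sum_erase Y _ hv, hE, Finset.sum_empty, Nat.add_zero]
        exact digit_le_capacity (hlt _ hs _ (hY hv)) i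
      · obtain ⟨hu, hg⟩ := h.gathered_erase hs' hYg hY hE hv
        have hsub' : Y.erase (sv s) ⊆ reached root sv s := by
          intro y hy
          rw [Finset.mem_erase] at hy
          have := hY hy.2
          rw [reached_succ, Finset.mem_insert] at this
          tauto
        have hu' : su s ∈ Y.erase (sv s) := Finset.mem_erase.mpr ⟨(h.ne hs').symm, hu⟩
        have h1 := ih hs'.le _ hsub' hg i (fun y hy =>
          (hkey y (hsub' hy)).mp (hi y (Finset.mem_of_mem_erase hy)))
        refine le_trans (le_of_eq ?_) h1
        rw [← Finset.add_sum_erase Y _ hv, ← Finset.add_sum_erase _ _ hu',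
          ← Finset.add_sum_erase _ _ hu', hspec.1, if_pos (hi _ hu)]
        have h2 : ∑ y ∈ (Y.erase (sv s)).erase (su s), digit (n + 1) (L (s + 1) y) i =
            ∑ y ∈ (Y.erase (sv s)).erase (su s), digit (n + 1) (L s y) i := by
          apply Finset.sum_congr rfl
          intro y hy
          rw [hkeep s hs' y (hsub' (Finset.mem_of_mem_erase hy)) (Finset.ne_of_mem_erase hy)]
        rw [h2]
        omega
    · have hsub' : Y ⊆ reached root sv s := by
        intro y hy
        have := hY hy
        rw [reached_succ, Finset.mem_insert] at this
        rcases this with rfl | h0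
        · exact absurd hy hv
        · exact h0
      have h1 := ih hs'.le Y hsub' hYg i (fun y hy => (hkey y (hsub' hy)).mp (hi y hy))
      exact (Finset.sum_le_sum fun y hy => hdig y (hsub' hy)).trans h1

/-- The numbers at the vertices after the last `k` leaves have been merged into their neighbours. -/
def mergeState (r : ℕ) (sv su : ℕ → Fin n) (x : Fin n → ℕ) : ℕ → Fin n → ℕ
  | 0 => x
  | k + 1 => Function.update (mergeState r sv su x k) (su (r - 1 - k))
      (merge (n + 1) (mergeState r sv su x k (su (r - 1 - k)))
        (mergeState r sv su x k (sv (r - 1 - k))) - 1)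

/-- Completeness of the dynamic program: on balanced codes no merge fails. The pair `{su, sv}` is
connected, so its digits fit. For a connected set containing `su`, either the code of `sv` reaches
box `i` and `sv` may be added to the set, or its `i`-th digit is zero. -/
theorem merge_mergeState (h : T.Growth root r sv su) {K : ℕ} {x : Fin n → ℕ}
    (hx : ∀ v, x v < 2 * (n + 1) ^ K)
    (hb : Balanced T K Finset.univ x) :
    ∀ k ≤ r, (∀ v, mergeState r sv su x k v < 2 * (n + 1) ^ K) ∧
      Balanced T K (reached root sv (r - k)) (mergeState r sv su x k) ∧
      (k < r →
        0 < merge (n + 1) (mergeState r sv su x k (su (r - 1 - k)))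
          (mergeState r sv su x k (sv (r - 1 - k))) ∧
        merge (n + 1) (mergeState r sv su x k (su (r - 1 - k)))
          (mergeState r sv su x k (sv (r - 1 - k))) ≤ 2 * (n + 1) ^ K) := by
  have hn0 : 0 < n := root.pos
  have hn : 1 < n + 1 := by omega
  have hP : 0 < (n + 1) ^ K := by positivity
  have hPB : 2 * (n + 1) ^ K ≤ (n + 1) ^ (K + 1) := by
    rw [pow_succ']
    exact Nat.mul_le_mul_right _ (by omega)
  have step : ∀ k < r, (∀ v, mergeState r sv su x k v < 2 * (n + 1) ^ K) →
      Balanced T K (reached root sv (r - k)) (mergeState r sv su x k) →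
        0 < merge (n + 1) (mergeState r sv su x k (su (r - 1 - k)))
          (mergeState r sv su x k (sv (r - 1 - k))) ∧
        merge (n + 1) (mergeState r sv su x k (su (r - 1 - k)))
          (mergeState r sv su x k (sv (r - 1 - k))) ≤ 2 * (n + 1) ^ K := by
    intro k hk hL hB
    obtain ⟨s, hs⟩ : ∃ s, r - 1 - k = s := ⟨_, rfl⟩
    have hrk : r - k = s + 1 := by omega
    have hsr : s < r := by omega
    rw [hrk] at hB
    rw [hs]
    set L := mergeState r sv su x k with hLdef
    have hne := h.ne hsr
    have hpair : ∀ i, (n + 1) ^ i ≤ L (su s) →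
        digit (n + 1) (L (su s)) i + digit (n + 1) (L (sv s)) i ≤ capacity n K i := by
      intro i hi
      by_cases hiv : (n + 1) ^ i ≤ L (sv s)
      · have := hB (insert (sv s) {su s}) (by
          intro y hy
          rw [Finset.mem_insert, Finset.mem_singleton] at hy
          rw [reached_succ, Finset.mem_insert]
          rcases hy with rfl | rfl
          · exact Or.inl rfl
          · exact Or.inr (h.mem s hsr))
          ((T.gathered_singleton (su s)).insert (Finset.mem_singleton_self _) (h.adj s hsr)) i (by
            intro y hy
            rw [Finset.mem_insert, Finset.mem_singleton] at hy
            rcases hy with rfl | rfl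
            · exact hiv
            · exact hi)
        rw [Finset.sum_pair hne] at this
        omega
      · rw [digit_eq_zero_of_lt (not_le.mp hiv), Nat.add_zero]
        exact digit_le_capacity (hL _) i
    have hpos : 0 < merge (n + 1) (L (su s)) (L (sv s)) := by
      apply merge_pos hn
      intro i hi
      refine lt_of_le_of_lt (hpair i hi) ?_
      unfold capacity
      split_ifs <;> omega
    refine ⟨hpos, ?_⟩
    obtain ⟨z, hz⟩ : ∃ z, merge (n + 1) (L (su s)) (L (sv s)) = z + 1 :=
      ⟨_, (Nat.succ_pred_eq_of_pos hpos).symm⟩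
    rw [hz]
    have hspec := merge_spec hn _ _ _ hz
    have hzlt : z < (n + 1) ^ (K + 1) := by
      by_contra hcon
      have := (hspec (K + 1)).2.mp (by omega)
      have := hL (su s)
      omega
    -- Otherwise the `K`-th digit of `z` would be at least `2`, but the extra box has capacity `1`.
    by_contra hcon
    have hge : (n + 1) ^ K ≤ L (su s) := (hspec K).2.mp (by omega)
    have h1 := hpair K hge
    have h2 := (hspec K).1
    rw [if_pos hge] at h2
    rw [← h2] at h1
    simp only [capacity, lt_irrefl, if_false] at h1
    rw [digit, Nat.mod_eq_of_lt (Nat.div_lt_of_lt_mul (by rwa [← pow_succ]))] at h1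
    have h3 : 2 ≤ z / (n + 1) ^ K := by
      rw [Nat.le_div_iff_mul_le hP]
      omega
    omega
  intro k
  induction k with
  | zero =>
    intro _
    have hL : ∀ v, mergeState r sv su x 0 v < 2 * (n + 1) ^ K := hx
    have hB : Balanced T K (reached root sv (r - 0)) (mergeState r sv su x 0) := by
      rw [Nat.sub_zero, h.reached_eq]
      exact hb
    exact ⟨hL, hB, fun hr => step 0 hr hL hB⟩
  | succ k ih =>
    intro hk
    obtain ⟨hL, hB, hM⟩ := ih (by omega)
    obtain ⟨hM1, hM2⟩ := hM hk
    have hnew : (∀ v, mergeState r sv su x (k + 1) v < 2 * (n + 1) ^ K) ∧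
        Balanced T K (reached root sv (r - (k + 1))) (mergeState r sv su x (k + 1)) := by
      obtain ⟨s, hs⟩ : ∃ s, r - 1 - k = s := ⟨_, rfl⟩
      have hrk : r - k = s + 1 := by omega
      have hrk' : r - (k + 1) = s := by omega
      have hsr : s < r := by omega
      rw [hrk] at hB
      rw [hs] at hM1 hM2
      rw [hrk']
      simp only [mergeState]
      rw [hs]
      set L := mergeState r sv su x k with hLdef
      obtain ⟨z, hz⟩ : ∃ z, merge (n + 1) (L (su s)) (L (sv s)) = z + 1 :=
        ⟨_, (Nat.succ_pred_eq_of_pos hM1).symm⟩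
      rw [hz, Nat.add_sub_cancel]
      have hspec := merge_spec hn _ _ _ hz
      constructor
      · intro v
        by_cases hv : v = su s
        · rw [hv, Function.update_self]
          omega
        · rw [Function.update_of_ne hv]
          exact hL v
      · intro Y hY hYg i hi
        have hsub : Y ⊆ reached root sv (s + 1) :=
          hY.trans (reached_mono root sv (Nat.le_succ s))
        have hvY : sv s ∉ Y := fun hv => h.notMem s hsr (hY hv)
        have hup : ∀ v ∈ Y, (n + 1) ^ i ≤ L v := by
          intro v hv
          have := hi v hv
          by_cases hvu : v = su s
          · rw [hvu, Function.update_self] at this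
            rw [hvu]
            exact (hspec i).2.mp this
          · rwa [Function.update_of_ne hvu] at this
        by_cases hu : su s ∈ Y
        · have hrest : ∑ v ∈ Y.erase (su s), digit (n + 1) (Function.update L (su s) z v) i =
              ∑ v ∈ Y.erase (su s), digit (n + 1) (L v) i := by
            apply Finset.sum_congr rfl
            intro v hv
            rw [Function.update_of_ne (Finset.ne_of_mem_erase hv)]
          rw [← Finset.add_sum_erase Y _ hu, hrest, Function.update_self, (hspec i).1,
            if_pos (hup _ hu)]
          have hsumY := Finset.add_sum_erase Y (fun v => digit (n + 1) (L v) i) hu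
          by_cases hiv : (n + 1) ^ i ≤ L (sv s)
          · have h1 := hB (insert (sv s) Y) (by
              intro y hy
              rw [Finset.mem_insert] at hy
              rcases hy with rfl | hy
              · rw [reached_succ]
                exact Finset.mem_insert_self _ _
              · exact hsub hy) (hYg.insert hu (h.adj s hsr)) i (by
              intro y hy
              rw [Finset.mem_insert] at hy
              rcases hy with rfl | hy
              · exact hiv
              · exact hup y hy)
            rw [Finset.sum_insert hvY] at h1
            omega
          · rw [digit_eq_zero_of_lt (not_le.mp hiv)]
            have h1 := hB Y hsub hYg i hup
            omega
        · have h1 := hB Y hsub hYg i hup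
          refine le_trans (le_of_eq ?_) h1
          apply Finset.sum_congr rfl
          intro v hv
          rw [Function.update_of_ne fun e : v = su s => hu (e ▸ hv)]
    exact ⟨hnew.1, hnew.2, fun hr => step (k + 1) hr hnew.1 hnew.2⟩

end Growth

end WeightedTree

/-! ### From schedules to balanced codes -/

namespace WeightedTree

variable {n : ℕ} {T : WeightedTree n}

theorem sum_boxLoad {M s e : ℕ} (h : s ≤ e) (K : ℕ) :
    ∑ i ∈ Finset.range K, boxLoad M s e i = min e (K * M) - min s (K * M) := by
  induction K with
  | zero => simp
  | succ K ih =>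
    rw [Finset.sum_range_succ, ih, boxLoad]
    have : (K + 1) * M = K * M + M := by ring
    omega

theorem boxLoad_lt (M s e i : ℕ) : boxLoad M s e i < M + 1 := by
  have : (i + 1) * M = i * M + M := by ring
  unfold boxLoad
  omega

/-- The code of a processed vertex lists its loads, so its digit sum is the length of its interval.
The code `(n + 1) ^ K` of an idle vertex has its only nonzero digit in the extra box, whose capacity
`1` expresses that a connected set of idle vertices has at most one element. -/
theorem exists_balanced {K G : ℕ} (hG : Nat.log 2 n + 1 ≤ G) {η : ℝ} (hη : 0 < η)
    (S : T.DecisionTree) (hS : S.IsStrategy) (hn : 0 < n)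
    (hc : S.cost ≤ η * n * ((K : ℝ) - G)) :
    ∃ x : Fin n → ℕ, (∀ v, 0 < x v ∧ x v < 2 * (n + 1) ^ K) ∧
      Growth.Balanced T K Finset.univ x ∧
      ∀ v, x v < (n + 1) ^ K → T.weight v ≤ η * digitSum (n + 1) (x v) := by
  classical
  -- The box length is `n`, so that the rounding of at most `n` queries amounts to one box; this is
  -- the `+ 1` in the bound for `G`.
  obtain ⟨st, en, idle, h⟩ := exists_isSchedule hη hn S Finset.univ T.gathered_univ
    (fun x _ => hS x) S.cost (fun x _ => S.costAt_le_cost x) 0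
  have hB : 1 < n + 1 := by omega
  have hP : 0 < (n + 1) ^ K := by positivity
  have hen : ∀ v, ¬ idle v → en v ≤ K * n := by
    intro v hv
    have h1 := h.end_le v (Finset.mem_univ v) hv
    rw [Finset.card_univ, Fintype.card_fin] at h1
    have h2 : ((Nat.log 2 n : ℕ) : ℝ) + 1 ≤ G := by exact_mod_cast hG
    have h3 : η * n * (((Nat.log 2 n : ℕ) : ℝ) + 1) ≤ η * n * G :=
      mul_le_mul_of_nonneg_left h2 (by positivity)
    have h4 : η * (en v : ℝ) ≤ η * (K * n) := by
      push_cast at h1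
      nlinarith
    have h5 := le_of_mul_le_mul_left h4 hη
    exact_mod_cast h5
  set d : Fin n → ℕ → ℕ := fun v i => boxLoad n (st v) (en v) i with hd
  set x : Fin n → ℕ := fun v => if idle v then (n + 1) ^ K else
    ∑ i ∈ Finset.range K, d v i * (n + 1) ^ i with hx
  have hxi : ∀ v, idle v → x v = (n + 1) ^ K := fun v hv => by simp [hx, hv]
  have hxn : ∀ v, ¬ idle v → x v = ∑ i ∈ Finset.range K, d v i * (n + 1) ^ i :=
    fun v hv => by simp [hx, hv]
  have hdlt : ∀ v i, d v i < n + 1 := fun v i => boxLoad_lt _ _ _ _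
  have hxlt : ∀ v, ¬ idle v → x v < (n + 1) ^ K := by
    intro v hv
    rw [hxn v hv]
    exact sum_mul_pow_lt (d v) (hdlt v) K
  have hdig : ∀ v, ∀ i < K, digit (n + 1) (x v) i = d v i := by
    intro v i hi
    by_cases hv : idle v
    · rw [hxi v hv, hd]
      simp only
      rw [h.eq_of_idle v (Finset.mem_univ v) hv, boxLoad_self, digit]
      obtain ⟨j, rfl⟩ := Nat.exists_eq_add_of_lt hi
      rw [show i + j + 1 = i + (j + 1) by ring, pow_add, Nat.mul_div_cancel_left _ (by positivity),
        pow_succ, Nat.mul_mod_left]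
    · rw [hxn v hv]
      exact digit_sum_mul_pow K (d v) (hdlt v) i hi
  have hsum : ∀ v, ¬ idle v → digitSum (n + 1) (x v) = en v - st v := by
    intro v hv
    rw [digitSum_eq_sum hB K _ (hxlt v hv), Finset.sum_congr rfl fun i hi =>
      hdig v i (Finset.mem_range.mp hi)]
    have h1 := h.lt_end v (Finset.mem_univ v) hv
    have h2 := hen v hv
    rw [sum_boxLoad h1.le]
    omega
  have hlt2 : ∀ v, x v < 2 * (n + 1) ^ K := by
    intro v
    by_cases hv : idle v
    · rw [hxi v hv]
      omega
    · have := hxlt v hv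
      omega
  refine ⟨x, ?_, ?_, ?_⟩
  · intro v
    refine ⟨?_, hlt2 v⟩
    by_cases hv : idle v
    · rw [hxi v hv]
      exact hP
    · by_contra h0
      have h1 := hsum v hv
      have h2 := h.lt_end v (Finset.mem_univ v) hv
      rw [Nat.eq_zero_of_not_pos h0] at h1
      simp only [digitSum, Nat.digits_zero, List.sum_nil] at h1
      omega
  · intro Y hY hYg i hi
    by_cases hiK : i < K
    · rw [Finset.sum_congr rfl fun v _ => hdig v i hiK]
      rw [capacity, if_pos hiK]
      apply h.load_le Y hY hYg i
      intro v hv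
      -- An interval that ends by the beginning of box `i` has no load from there on, so its code is
      -- below `(n + 1) ^ i`.
      by_contra hcon
      rw [not_or, not_lt] at hcon
      have h1 := hi v hv
      rw [hxn v hcon.1, ← Finset.sum_subset (Finset.range_mono hiK.le)] at h1
      · exact absurd (sum_mul_pow_lt (d v) (hdlt v) i) (by omega)
      · intro j _ hj
        rw [Finset.mem_range, not_lt] at hj
        have h2 : d v j = 0 := by
          have : i * n ≤ j * n := Nat.mul_le_mul_right _ hj
          simp only [hd, boxLoad]
          omega
        rw [h2, Nat.zero_mul]
    · have hidle : ∀ v ∈ Y, idle v := by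
        intro v hv
        by_contra hcon
        have h1 := hi v hv
        have h2 := hxlt v hcon
        have h3 : (n + 1) ^ K ≤ (n + 1) ^ i := Nat.pow_le_pow_right (by omega) (by omega)
        omega
      have hcard := h.card_le_of_idle Y hY hYg hidle
      have h1 : ∑ v ∈ Y, digit (n + 1) (x v) i ≤ Y.card • capacity n K i :=
        Finset.sum_le_card_nsmul _ _ _ fun v _ => digit_le_capacity (hlt2 v) i
      rw [smul_eq_mul] at h1
      exact h1.trans (by nlinarith)
  · intro v hv
    have hvi : ¬ idle v := fun hvi => by
      rw [hxi v hvi] at hv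
      exact lt_irrefl _ hv
    rw [hsum v hvi]
    exact h.weight_le v (Finset.mem_univ v) hvi

end WeightedTree

/-! ### Reasoning about programs -/

namespace Memory

@[simp]
theorem setNat_nat_self (m : Memory) (a i k : ℕ) :
    (m.setNat a i k).nat a = Function.update (m.nat a) i k := by
  simp [setNat]

@[simp]
theorem setNat_nat_of_ne (m : Memory) {a b : ℕ} (h : b ≠ a) (i k : ℕ) :
    (m.setNat a i k).nat b = m.nat b := by
  simp [setNat, h]

@[simp]
theorem setNat_real (m : Memory) (a i k : ℕ) : (m.setNat a i k).real = m.real := rfl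

@[simp]
theorem setReal_real_self (m : Memory) (a i : ℕ) (r : ℝ) :
    (m.setReal a i r).real a = Function.update (m.real a) i r := by
  simp [setReal]

@[simp]
theorem setReal_real_of_ne (m : Memory) {a b : ℕ} (h : b ≠ a) (i : ℕ) (r : ℝ) :
    (m.setReal a i r).real b = m.real b := by
  simp [setReal, h]

@[simp]
theorem setReal_nat (m : Memory) (a i : ℕ) (r : ℝ) : (m.setReal a i r).nat = m.nat := rfl

end Memory

namespace Program

/-- A bound for the running time if each loop is left after at most `X` rounds. -/
def timeBound (X : ℕ) : Program → ℕ
  | skip => 1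
  | setNat _ i e => i.time + e.time + 1
  | setReal _ i e => i.time + e.time + 1
  | seq p q => timeBound X p + timeBound X q
  | branch b p q => b.time + (timeBound X p + timeBound X q)
  | loop b p => (X + 1) * (b.time + timeBound X p)

/-- For a fixed program the time bound is a polynomial in `X`. Because `2 ≤ X`, constants and sums
are absorbed into the exponent. -/
theorem exists_timeBound_le_pow (P : Program) : ∃ d : ℕ, ∀ X, 2 ≤ X → P.timeBound X ≤ X ^ d := by
  have const : ∀ t : ℕ, ∀ X, 2 ≤ X → t ≤ X ^ t := fun t X hX =>
    (Nat.lt_two_pow_self).le.trans (Nat.pow_le_pow_left hX t)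
  have add : ∀ {X a b d e : ℕ}, 2 ≤ X → a ≤ X ^ d → b ≤ X ^ e → a + b ≤ X ^ (d + e + 1) := by
    intro X a b d e hX ha hb
    have h1 : a ≤ X ^ (d + e) := ha.trans (Nat.pow_le_pow_right (by omega) (by omega))
    have h2 : b ≤ X ^ (d + e) := hb.trans (Nat.pow_le_pow_right (by omega) (by omega))
    rw [pow_succ]
    nlinarith
  induction P with
  | skip => exact ⟨1, fun X hX => const 1 X hX⟩
  | setNat a i e => exact ⟨_, fun X hX => const _ X hX⟩
  | setReal a i e => exact ⟨_, fun X hX => const _ X hX⟩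
  | seq p q hp hq =>
    obtain ⟨d, hd⟩ := hp
    obtain ⟨e, he⟩ := hq
    exact ⟨_, fun X hX => add hX (hd X hX) (he X hX)⟩
  | branch b p q hp hq =>
    obtain ⟨d, hd⟩ := hp
    obtain ⟨e, he⟩ := hq
    exact ⟨_, fun X hX => add hX (const _ X hX) (add hX (hd X hX) (he X hX))⟩
  | loop b p hp =>
    obtain ⟨d, hd⟩ := hp
    refine ⟨2 + (b.time + d + 1), fun X hX => ?_⟩
    rw [timeBound, pow_add]
    apply Nat.mul_le_mul
    · nlinarith
    · exact add hX (const _ X hX) (hd X hX)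

/-- Whether a program has an assignment to the natural array `a`. -/
def writesNat (a : ℕ) : Program → Bool
  | skip => false
  | setNat b _ _ => a == b
  | setReal _ _ _ => false
  | seq p q => writesNat a p || writesNat a q
  | branch _ p q => writesNat a p || writesNat a q
  | loop _ p => writesNat a p

/-- Whether a program has an assignment to the real array `a`. -/
def writesReal (a : ℕ) : Program → Bool
  | skip => false
  | setNat _ _ _ => false
  | setReal b _ _ => a == b
  | seq p q => writesReal a p || writesReal a q
  | branch _ p q => writesReal a p || writesReal a q
  | loop _ p => writesReal a p

/-- The memories `m` and `m'` agree on all arrays without assignments in `P`. -/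
structure Frame (P : Program) (m m' : Memory) : Prop where
  nat : ∀ a, P.writesNat a = false → m'.nat a = m.nat a
  real : ∀ a, P.writesReal a = false → m'.real a = m.real a

theorem Frame.refl (P : Program) (m : Memory) : Frame P m m := ⟨fun _ _ => rfl, fun _ _ => rfl⟩

theorem Frame.trans {P : Program} {m m₁ m₂ : Memory} (h : Frame P m m₁) (h' : Frame P m₁ m₂) :
    Frame P m m₂ :=
  ⟨fun a ha => (h'.nat a ha).trans (h.nat a ha), fun a ha => (h'.real a ha).trans (h.real a ha)⟩

theorem Frame.mono {P Q : Program} {m m' : Memory} (h : Frame P m m')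
    (hn : ∀ a, Q.writesNat a = false → P.writesNat a = false)
    (hr : ∀ a, Q.writesReal a = false → P.writesReal a = false) : Frame Q m m' :=
  ⟨fun a ha => h.nat a (hn a ha), fun a ha => h.real a (hr a ha)⟩

theorem frame_of_runs {P : Program} {m m' : Memory} {t : ℕ} (h : Runs P m t m') :
    Frame P m m' := by
  induction h with
  | skip m => exact Frame.refl _ _
  | setNat m a i e =>
    refine ⟨fun b hb => Memory.setNat_nat_of_ne m ?_ _ _, fun b _ => rfl⟩
    simpa [writesNat] using hb
  | setReal m a i e =>
    refine ⟨fun b _ => rfl, fun b hb => Memory.setReal_real_of_ne m ?_ _ _⟩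
    simpa [writesReal] using hb
  | seq _ _ hp hq =>
    refine (hp.mono ?_ ?_).trans (hq.mono ?_ ?_) <;> intro a ha <;>
      simp only [writesNat, writesReal, Bool.or_eq_false_iff] at ha
    exacts [ha.1, ha.1, ha.2, ha.2]
  | branch_true _ _ hp =>
    refine hp.mono ?_ ?_ <;> intro a ha <;>
      simp only [writesNat, writesReal, Bool.or_eq_false_iff] at ha
    exacts [ha.1, ha.1]
  | branch_false _ _ hp =>
    refine hp.mono ?_ ?_ <;> intro a ha <;>
      simp only [writesNat, writesReal, Bool.or_eq_false_iff] at ha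
    exacts [ha.2, ha.2]
  | loop_true _ _ _ hp hl => exact Frame.trans (hp.mono (fun _ h => h) (fun _ h => h)) hl
  | loop_false _ => exact Frame.refl _ _

/-- Started in `m`, the program halts within its time bound, in a memory with the property `Q`. -/
def Wp (X : ℕ) (P : Program) (Q : Memory → Prop) (m : Memory) : Prop :=
  ∃ t m', Runs P m t m' ∧ t ≤ P.timeBound X ∧ Q m'

variable {X : ℕ} {Q : Memory → Prop} {m : Memory}

theorem Wp.mono {P : Program} {R : Memory → Prop} (h : Wp X P R m)
    (hQ : ∀ m', Frame P m m' → R m' → Q m') : Wp X P Q m := by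
  obtain ⟨t, m', h1, h2, h3⟩ := h
  exact ⟨t, m', h1, h2, hQ m' (frame_of_runs h1) h3⟩

theorem Wp.skip (h : Q m) : Wp X skip Q m := ⟨1, m, Runs.skip m, le_rfl, h⟩

theorem Wp.setNat {a : ℕ} {i e : NatExp} (h : Q (m.setNat a (i.eval m) (e.eval m))) :
    Wp X (setNat a i e) Q m := ⟨_, _, Runs.setNat m a i e, le_rfl, h⟩

theorem Wp.setReal {a : ℕ} {i : NatExp} {e : RealExp}
    (h : Q (m.setReal a (i.eval m) (e.eval m))) :
    Wp X (setReal a i e) Q m := ⟨_, _, Runs.setReal m a i e, le_rfl, h⟩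

theorem Wp.seq {p q : Program} (h : Wp X p (fun m₁ => Wp X q Q m₁) m) : Wp X (seq p q) Q m := by
  obtain ⟨s, m₁, h1, h2, t, m₂, h3, h4, h5⟩ := h
  exact ⟨_, m₂, Runs.seq h1 h3, Nat.add_le_add h2 h4, h5⟩

theorem Wp.branch {b : Test} {p q : Program} (hp : b.Holds m → Wp X p Q m)
    (hq : ¬ b.Holds m → Wp X q Q m) : Wp X (branch b p q) Q m := by
  by_cases hb : b.Holds m
  · obtain ⟨t, m', h1, h2, h3⟩ := hp hb
    refine ⟨_, m', Runs.branch_true hb h1, ?_, h3⟩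
    simp only [timeBound]
    omega
  · obtain ⟨t, m', h1, h2, h3⟩ := hq hb
    refine ⟨_, m', Runs.branch_false hb h1, ?_, h3⟩
    simp only [timeBound]
    omega

/-- The invariant is indexed by the number of rounds and must itself force this number below `N`.
The `Frame` hypotheses spare it any mention of arrays that the body does not write. -/
theorem Wp.loop {b : Test} {p : Program} (N : ℕ) (hN : N ≤ X) (Inv : ℕ → Memory → Prop)
    (h0 : Inv 0 m)
    (hstep : ∀ k m', Frame p m m' → Inv k m' → b.Holds m' → k < N ∧ Wp X p (Inv (k + 1)) m')
    (hQ : ∀ k m', Frame p m m' → Inv k m' → ¬ b.Holds m' → Q m') : Wp X (loop b p) Q m := by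
  have key : ∀ j k m', k + j = N → Frame p m m' → Inv k m' →
      ∃ t m'', Runs (Program.loop b p) m' t m'' ∧ t ≤ (j + 1) * (b.time + timeBound X p) ∧
        Q m'' := by
    intro j
    induction j with
    | zero =>
      intro k m' hk hf hi
      have hb : ¬ b.Holds m' := fun hb => by
        have := (hstep k m' hf hi hb).1
        omega
      exact ⟨_, _, Runs.loop_false hb, by omega, hQ k m' hf hi hb⟩
    | succ j ih =>
      intro k m' hk hf hi
      by_cases hb : b.Holds m'
      · obtain ⟨s, m₁, h1, h2, h3⟩ := (hstep k m' hf hi hb).2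
        obtain ⟨t, m₂, h4, h5, h6⟩ := ih (k + 1) m₁ (by omega) (hf.trans (frame_of_runs h1)) h3
        refine ⟨_, m₂, Runs.loop_true hb h1 h4, ?_, h6⟩
        nlinarith
      · exact ⟨_, _, Runs.loop_false hb, by nlinarith, hQ k m' hf hi hb⟩
  obtain ⟨t, m'', h1, h2, h3⟩ := key N 0 m (by omega) (Frame.refl _ _) h0
  refine ⟨t, m'', h1, h2.trans ?_, h3⟩
  exact Nat.mul_le_mul_right _ (by omega)

end Program

/-- The entry at position `0`, used as a variable. -/
def NatExp.var (a : ℕ) : NatExp := NatExp.get a (NatExp.const 0)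

/-- The entry at position `0`, used as a variable. -/
def RealExp.var (a : ℕ) : RealExp := RealExp.get a (NatExp.const 0)

attribute [simp] NatExp.eval RealExp.eval Test.Holds NatExp.var RealExp.var

namespace Program

/-- Assignment to a natural variable. -/
def letNat (a : ℕ) (e : NatExp) : Program := setNat a (NatExp.const 0) e

/-- Assignment to a real variable. -/
def letReal (a : ℕ) (e : RealExp) : Program := setReal a (NatExp.const 0) e

/-- A loop in which the variable `i` runs from `0` to `e - 1`. -/
def forLoop (i : ℕ) (e : NatExp) (p : Program) : Program :=
  seq (letNat i (NatExp.const 0))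
    (loop (Test.natLt (NatExp.var i) e)
      (seq p (letNat i (NatExp.add (NatExp.var i) (NatExp.const 1)))))

variable {X : ℕ} {Q : Memory → Prop} {m : Memory}

/-- The invariant must survive any change of the counter, and the body must not write the counter;
both hold by mere inspection of the arrays involved. -/
theorem Wp.forLoop {i : ℕ} {e : NatExp} {p : Program} (N : ℕ) (hN : N ≤ X)
    (Inv : ℕ → Memory → Prop) (hi : p.writesNat i = false)
    (hInv : ∀ k m' j, Inv k m' → Inv k (m'.setNat i 0 j))
    (he : ∀ m', Frame (forLoop i e p) m m' → e.eval m' = N)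
    (h0 : Inv 0 m)
    (hstep : ∀ k m', k < N → Frame (Program.forLoop i e p) m m' → m'.nat i 0 = k → Inv k m' →
      Wp X p (Inv (k + 1)) m')
    (hQ : ∀ m', Frame (Program.forLoop i e p) m m' → Inv N m' → Q m') :
    Wp X (Program.forLoop i e p) Q m := by
  have hset : ∀ m' j, Frame (Program.forLoop i e p) m' (m'.setNat i 0 j) := by
    intro m' j
    refine ⟨fun a ha => Memory.setNat_nat_of_ne _ ?_ _ _, fun _ _ => rfl⟩
    simp only [Program.forLoop, letNat, writesNat, Bool.or_eq_false_iff] at ha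
    simpa using ha.1
  have hbody : ∀ {m₁ m₂}, Frame (Program.seq p
      (letNat i (NatExp.add (NatExp.var i) (NatExp.const 1)))) m₁ m₂ →
      Frame (Program.forLoop i e p) m₁ m₂ := by
    intro m₁ m₂ h
    refine h.mono (fun a ha => ?_) (fun a ha => ?_)
    · simp only [Program.forLoop, writesNat, Bool.or_eq_false_iff] at ha
      simp only [writesNat, ha.2.1, ha.2.2, Bool.or_self]
    · simp only [Program.forLoop, writesReal, Bool.or_eq_false_iff] at ha
      simp only [writesReal, ha.2.1, ha.2.2, Bool.or_self]
  apply Wp.seq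
  apply Wp.setNat
  apply Wp.loop N hN (fun k m' => k ≤ N ∧ m'.nat i 0 = k ∧ Inv k m')
  · refine ⟨Nat.zero_le _, ?_, hInv _ _ _ h0⟩
    simp [NatExp.eval, Memory.setNat_nat_self]
  · rintro k m' hf ⟨hkN, hk, hI⟩ hb
    have hf' := (hset m 0).trans (hbody hf)
    have hkN' : k < N := by
      simp only [Test.Holds, NatExp.var, NatExp.eval, he m' hf', hk] at hb
      exact hb
    refine ⟨hkN', ?_⟩
    apply Wp.seq
    apply (hstep k m' hkN' hf' hk hI).mono
    intro m₁ hf₁ hI₁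
    apply Wp.setNat
    have h1 : m₁.nat i 0 = k := by rw [hf₁.nat i hi, hk]
    simp only [NatExp.var, NatExp.eval, h1]
    refine ⟨hkN', ?_, hInv _ _ _ hI₁⟩
    simp [Memory.setNat_nat_self]
  · rintro k m' hf ⟨hkN, hk, hI⟩ hb
    have hf' := (hset m 0).trans (hbody hf)
    simp only [Test.Holds, NatExp.var, NatExp.eval, he m' hf', hk] at hb
    have : k = N := by omega
    subst this
    exact hQ m' hf' hI

end Program

/-- The number of boxes: `⌈2 / ε⌉` times a bound for the depth of nested halvings, plus one. -/
noncomputable def boxCount (n : ℕ) (ε : ℝ) : ℕ := ⌈2 / ε⌉₊ * (Nat.clog 2 n + 1)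

/-! ### Computing the parameters -/

namespace Program

open NatExp

/-- Multiplication of the variables `a` and `b`, with result in `c` and loop variable `i`. -/
def mulVar (c i a b : ℕ) : Program :=
  seq (letNat c (const 0)) (forLoop i (var a) (letNat c (add (var c) (var b))))

theorem wp_mulVar {X : ℕ} {Q : Memory → Prop} {m : Memory} {c i a b : ℕ} (hX : m.nat a 0 ≤ X)
    (hci : c ≠ i) (hca : c ≠ a) (hcb : c ≠ b) (hia : i ≠ a) (hib : i ≠ b)
    (hQ : ∀ m', Frame (mulVar c i a b) m m' → m'.nat c 0 = m.nat a 0 * m.nat b 0 → Q m') :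
    Wp X (mulVar c i a b) Q m := by
  have hframe : ∀ x, x ≠ c → x ≠ i → ∀ m₁ m₂,
      Frame (forLoop i (var a) (letNat c (add (var c) (var b)))) m₁ m₂ → m₂.nat x = m₁.nat x := by
    intro x hxc hxi m₁ m₂ h
    apply h.nat
    simp [forLoop, letNat, writesNat, hxc, hxi]
  have key : Wp X (mulVar c i a b) (fun m' => m'.nat c 0 = m.nat a 0 * m.nat b 0) m := by
    apply Wp.seq
    apply Wp.setNat
    apply Wp.forLoop (m.nat a 0) hX (fun k m' => m'.nat c 0 = k * m.nat b 0)
    · simp [letNat, writesNat, hci.symm]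
    · intro k m' j h
      simpa [hci] using h
    · intro m' hf
      simp [hframe a hca.symm hia.symm _ _ hf, hca.symm]
    · simp
    · intro k m' _ hf _ hI
      apply Wp.setNat
      simp [hI, hframe b hcb.symm hib.symm _ _ hf, hcb.symm]
      ring
    · intro m' _ hI
      exact hI
  exact key.mono hQ

/-- Computes `⌈2 / ε⌉` in `5`, one more than the binary logarithm of `n` in `7`, the number of boxes
in `8`, `n + 1` in `10`, its power to the number of boxes in `11`, and twice this power in `14`. -/
def parameters : Program :=
  seq (loop (Test.realLt (RealExp.var 2) (RealExp.ofNat (const 2)))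
      (seq (letReal 2 (RealExp.add (RealExp.var 2) (RealExp.var 1)))
        (letNat 5 (add (var 5) (const 1)))))
  (seq (letNat 6 (const 1))
  (seq (loop (Test.natLt (var 6) (var 0))
      (seq (letNat 6 (add (var 6) (var 6))) (letNat 7 (add (var 7) (const 1)))))
  (seq (letNat 7 (add (var 7) (const 1)))
  (seq (mulVar 8 9 5 7)
  (seq (letNat 10 (add (var 0) (const 1)))
  (seq (letNat 11 (const 1))
  (seq (forLoop 9 (var 8) (seq (mulVar 12 13 10 11) (letNat 11 (var 12))))
    (letNat 14 (add (var 11) (var 11))))))))))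

/-- The values of the parameters. -/
structure HasParameters (m : Memory) (n K : ℕ) : Prop where
  size : m.nat 0 0 = n
  boxes : m.nat 8 0 = K
  base : m.nat 10 0 = n + 1
  power : m.nat 11 0 = (n + 1) ^ K
  codes : m.nat 14 0 = 2 * (n + 1) ^ K

/-- Without division and logarithms, `⌈2 / ε⌉₊` is found as the first `k` with `2 ≤ k * ε`, and
`Nat.clog 2 n` as the first `k` with `n ≤ 2 ^ k`. -/
theorem wp_parameters {X n : ℕ} {ε : ℝ} (hε : 0 < ε) {m : Memory} (hn : 0 < n)
    (hX : 2 * (n + 1) ^ boxCount n ε ≤ X) (h0 : m.nat 0 0 = n) (h2 : m.real 2 0 = 0)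
    (h1 : m.real 1 0 = ε) (h5 : m.nat 5 0 = 0) (h7 : m.nat 7 0 = 0) :
    Wp X parameters (fun m' => HasParameters m' n (boxCount n ε)) m := by
  have hNK : ⌈2 / ε⌉₊ ≤ boxCount n ε := Nat.le_mul_of_pos_right _ (Nat.succ_pos _)
  have hNpos : 0 < ⌈2 / ε⌉₊ := Nat.ceil_pos.mpr (by positivity)
  have hlogK : Nat.clog 2 n ≤ boxCount n ε :=
    (Nat.le_succ _).trans (Nat.le_mul_of_pos_left _ hNpos)
  have hKpos : 0 < boxCount n ε := hNpos.trans_le hNK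
  have hKX : boxCount n ε ≤ X := by
    have : boxCount n ε < (n + 1) ^ boxCount n ε := Nat.lt_pow_self (by omega)
    omega
  have hnX : n + 1 ≤ X := by
    have : (n + 1) ^ 1 ≤ (n + 1) ^ boxCount n ε := Nat.pow_le_pow_right (by omega) hKpos
    rw [pow_one] at this
    omega
  apply Wp.seq
  apply Wp.loop (⌈2 / ε⌉₊) (by omega)
    (fun k m' => k ≤ ⌈2 / ε⌉₊ ∧ m'.real 2 0 = k * ε ∧ m'.nat 5 0 = k)
  · simp [h2, h5]
  · rintro k m' hf ⟨hk, hr, hN⟩ hb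
    simp only [Test.Holds, RealExp.var, RealExp.eval, NatExp.eval, hr] at hb
    have hlt : k < ⌈2 / ε⌉₊ := by
      rw [Nat.lt_ceil, lt_div_iff₀ hε]
      exact_mod_cast hb
    refine ⟨hlt, ?_⟩
    apply Wp.seq
    apply Wp.setReal
    apply Wp.setNat
    have h1' : m'.real 1 0 = ε := by rw [hf.real 1 rfl, h1]
    refine ⟨hlt, ?_, ?_⟩
    · simp [hr, h1']
      ring
    · simp [hN]
  rintro k m1 hf1 ⟨hk, hr, hN⟩ hb
  simp only [Test.Holds, RealExp.var, RealExp.eval, NatExp.eval, hr] at hb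
  have hkN : k = ⌈2 / ε⌉₊ := by
    apply le_antisymm hk
    rw [Nat.ceil_le, div_le_iff₀ hε]
    exact_mod_cast not_lt.mp hb
  rw [hkN] at hN
  have h0' : m1.nat 0 0 = n := by rw [hf1.nat 0 rfl, h0]
  have h7' : m1.nat 7 0 = 0 := by rw [hf1.nat 7 rfl, h7]
  clear hr hb hk hkN
  apply Wp.seq
  apply Wp.setNat
  apply Wp.seq
  apply Wp.loop (Nat.clog 2 n) (by omega)
    (fun k m' => k ≤ Nat.clog 2 n ∧ m'.nat 6 0 = 2 ^ k ∧ m'.nat 7 0 = k)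
  · simp [h7']
  · rintro k m' hf ⟨hk, hp, hG⟩ hb
    have hn' : m'.nat 0 0 = n := by rw [hf.nat 0 rfl]; simpa using h0'
    simp only [Test.Holds, NatExp.var, NatExp.eval, hp, hn'] at hb
    have hlt : k < Nat.clog 2 n := (Nat.lt_clog_iff_pow_lt (by norm_num)).mpr hb
    refine ⟨hlt, ?_⟩
    apply Wp.seq
    apply Wp.setNat
    apply Wp.setNat
    refine ⟨hlt, ?_, ?_⟩
    · simp [hp]
      ring
    · simp [hG]
  rintro k m2 hf2 ⟨hk, hp, hG⟩ hb
  have hn2 : m2.nat 0 0 = n := by rw [hf2.nat 0 rfl]; simpa using h0'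
  have hN2 : m2.nat 5 0 = ⌈2 / ε⌉₊ := by rw [hf2.nat 5 rfl]; simpa using hN
  simp only [Test.Holds, NatExp.var, NatExp.eval, hp, hn2] at hb
  have hkG : k = Nat.clog 2 n := by
    apply le_antisymm hk
    exact (Nat.clog_le_iff_le_pow (by norm_num)).mpr (not_lt.mp hb)
  rw [hkG] at hG
  clear hk hp hkG hb
  apply Wp.seq
  apply Wp.setNat
  apply Wp.seq
  apply wp_mulVar (by simpa [hN2] using hNK.trans hKX) (by norm_num) (by norm_num) (by norm_num) (by norm_num)
    (by norm_num)
  intro m3 hf3 hK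
  have hK3 : m3.nat 8 0 = boxCount n ε := by
    rw [hK]
    simp [hN2, hG, boxCount]
  have hn3 : m3.nat 0 0 = n := by rw [hf3.nat 0 rfl]; simpa using hn2
  apply Wp.seq
  apply Wp.setNat
  apply Wp.seq
  apply Wp.setNat
  apply Wp.seq
  apply Wp.forLoop (boxCount n ε) hKX (fun k m' => m'.nat 11 0 = (n + 1) ^ k) rfl
    (by intro _ _ _ h; simpa using h)
  · intro m' hf
    simp [hf.nat 8 rfl, hK3]
  · simp
  · intro k m' hk hf _ hI
    have h10 : m'.nat 10 0 = n + 1 := by rw [hf.nat 10 rfl]; simp [hn3]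
    apply Wp.seq
    apply wp_mulVar (by rw [h10]; exact hnX) (by norm_num) (by norm_num) (by norm_num)
      (by norm_num) (by norm_num)
    intro m'' hf'' hm
    apply Wp.setNat
    simp [hm, h10, hI]
    ring
  · intro m4 hf4 hI
    apply Wp.setNat
    constructor
    · simp [hf4.nat 0 rfl, hn3]
    · simp [hf4.nat 8 rfl, hK3]
    · simp [hf4.nat 10 rfl, hn3]
    · simp [hI]
    · simp [hI]
      ring

end Program

/-! ### Tables of products, digits, logarithms and merged codes -/

namespace Program

open NatExp

/-- Stores the multiples of the variable `c` in the array `a`, with loop variable `9`. -/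
def multiples (a c : ℕ) : Program :=
  seq (setNat a (const 0) (const 0))
    (forLoop 9 (var 14) (setNat a (add (var 9) (const 1)) (add (get a (var 9)) (var c))))

theorem wp_multiples {X S : ℕ} {Q : Memory → Prop} {m : Memory} {a c : ℕ} (hX : S ≤ X)
    (h14 : m.nat 14 0 = S) (ha9 : a ≠ 9) (ha14 : a ≠ 14) (hca : c ≠ a) (hc9 : c ≠ 9)
    (hQ : ∀ m', Frame (multiples a c) m m' →
      (∀ x ≤ S, m'.nat a x = x * m.nat c 0) → Q m') :
    Wp X (multiples a c) Q m := by
  have hframe : ∀ x, x ≠ a → x ≠ 9 → ∀ m₁ m₂,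
      Frame (forLoop 9 (var 14) (setNat a (add (var 9) (const 1)) (add (get a (var 9)) (var c))))
        m₁ m₂ → m₂.nat x = m₁.nat x := by
    intro x hxc hxi m₁ m₂ h
    apply h.nat
    simp [forLoop, letNat, writesNat, hxc, hxi]
  have key : Wp X (multiples a c) (fun m' => ∀ x ≤ S, m'.nat a x = x * m.nat c 0) m := by
    apply Wp.seq
    apply Wp.setNat
    apply Wp.forLoop S hX (fun k m' => ∀ x ≤ k, m'.nat a x = x * m.nat c 0)
    · simp [writesNat, ha9.symm]
    · intro k m' j h
      simpa [ha9] using h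
    · intro m' hf
      simp [hframe 14 ha14.symm (by norm_num) _ _ hf, ha14.symm, h14]
    · simp
    · intro k m' hk hf h9 hI
      apply Wp.setNat
      intro x hx
      simp only [NatExp.var, NatExp.eval, h9, hframe c hca hc9 _ _ hf, hI k le_rfl]
      rw [Memory.setNat_nat_self, Function.update_apply, Memory.setNat_nat_of_ne _ hca]
      split_ifs with hxk
      · rw [hxk]
        ring
      · exact hI x (by omega)
    · intro m' _ hI
      exact hI
  exact key.mono hQ

/-- Stores the quotients and the remainders of division by the variable `10`. -/
def quotients : Program :=
  seq (setNat 18 (const 0) (const 0))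
  (seq (setNat 19 (const 0) (const 0))
    (forLoop 9 (var 14)
      (branch (Test.natLt (add (get 19 (var 9)) (const 1)) (var 10))
        (seq (setNat 19 (add (var 9) (const 1)) (add (get 19 (var 9)) (const 1)))
          (setNat 18 (add (var 9) (const 1)) (get 18 (var 9))))
        (seq (setNat 19 (add (var 9) (const 1)) (const 0))
          (setNat 18 (add (var 9) (const 1)) (add (get 18 (var 9)) (const 1)))))))

theorem wp_quotients {X S B : ℕ} {Q : Memory → Prop} {m : Memory} (hX : S ≤ X)
    (hB : 0 < B) (h14 : m.nat 14 0 = S) (h10 : m.nat 10 0 = B)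
    (hQ : ∀ m', Frame quotients m m' →
      (∀ x ≤ S, m'.nat 18 x = x / B ∧ m'.nat 19 x = x % B) → Q m') :
    Wp X quotients Q m := by
  refine Wp.mono ?_ hQ
  apply Wp.seq
  apply Wp.setNat
  apply Wp.seq
  apply Wp.setNat
  apply Wp.forLoop S hX (fun k m' => ∀ x ≤ k, m'.nat 18 x = x / B ∧ m'.nat 19 x = x % B) rfl
    (by intro _ _ _ h; simpa using h)
  · intro m' hf
    simp [hf.nat 14 rfl, h14]
  · simp
  · intro k m' hk hf h9 hI
    have h10' : m'.nat 10 0 = B := by simp [hf.nat 10 rfl, h10]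
    obtain ⟨hq, hr⟩ := hI k le_rfl
    have hdm := Nat.div_add_mod k B
    have hlt := Nat.mod_lt k hB
    apply Wp.branch
    · intro hb
      simp [h9, h10', hr] at hb
      have hnew : (k + 1) / B = k / B ∧ (k + 1) % B = k % B + 1 := by
        rw [Nat.div_mod_unique hB]
        omega
      apply Wp.seq
      apply Wp.setNat
      apply Wp.setNat
      intro x hx
      by_cases hxk : x = k + 1
      · simp [h9, hq, hr, hxk, hnew]
      · have := hI x (by omega)
        simp [h9, hxk, this]
    · intro hb
      simp [h9, h10', hr] at hb
      have hnew : (k + 1) / B = k / B + 1 ∧ (k + 1) % B = 0 := by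
        rw [Nat.div_mod_unique hB]
        refine ⟨?_, hB⟩
        rw [Nat.mul_add]
        omega
      apply Wp.seq
      apply Wp.setNat
      apply Wp.setNat
      intro x hx
      by_cases hxk : x = k + 1
      · simp [h9, hq, hxk, hnew]
      · have := hI x (by omega)
        simp [h9, hxk, this]
  · intro m' _ hI
    exact hI

/-- Stores the sums of the digits in the array `20`. -/
def digitSums : Program :=
  seq (setNat 20 (const 0) (const 0))
    (forLoop 9 (var 14) (setNat 20 (add (var 9) (const 1))
      (add (get 19 (add (var 9) (const 1))) (get 20 (get 18 (add (var 9) (const 1)))))))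

theorem wp_digitSums {X S B : ℕ} {Q : Memory → Prop} {m : Memory} (hX : S ≤ X)
    (hB : 1 < B) (h14 : m.nat 14 0 = S)
    (hqr : ∀ x ≤ S, m.nat 18 x = x / B ∧ m.nat 19 x = x % B)
    (hQ : ∀ m', Frame digitSums m m' → (∀ x ≤ S, m'.nat 20 x = digitSum B x) → Q m') :
    Wp X digitSums Q m := by
  refine Wp.mono ?_ hQ
  apply Wp.seq
  apply Wp.setNat
  apply Wp.forLoop S hX (fun k m' => ∀ x ≤ k, m'.nat 20 x = digitSum B x) rfl
    (by intro _ _ _ h; simpa using h)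
  · intro m' hf
    simp [hf.nat 14 rfl, h14]
  · simp [digitSum]
  · intro k m' hk hf h9 hI
    have hqr' : m'.nat 18 (k + 1) = (k + 1) / B ∧ m'.nat 19 (k + 1) = (k + 1) % B := by
      simpa [hf.nat 18 rfl, hf.nat 19 rfl] using hqr (k + 1) hk
    have hlt : (k + 1) / B < k + 1 := Nat.div_lt_self (Nat.succ_pos k) hB
    apply Wp.setNat
    intro x hx
    by_cases hxk : x = k + 1
    · simp [h9, hqr', hxk, hI _ (Nat.le_of_lt_succ hlt)]
      rw [digitSum_eq hB (k + 1), if_neg (Nat.succ_ne_zero k)]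
    · have := hI x (by omega)
      simp [h9, hxk, this]
  · intro m' _ hI
    exact hI

/-- Stores the logarithms in the array `21`. -/
def logarithms : Program :=
  forLoop 9 (var 14)
    (branch (Test.natLt (var 9) (var 10))
      (setNat 21 (var 9) (const 0))
      (setNat 21 (var 9) (add (get 21 (get 18 (var 9))) (const 1))))

theorem wp_logarithms {X S B : ℕ} {Q : Memory → Prop} {m : Memory} (hX : S ≤ X)
    (hB : 1 < B) (h14 : m.nat 14 0 = S) (h10 : m.nat 10 0 = B)
    (hqr : ∀ x ≤ S, m.nat 18 x = x / B ∧ m.nat 19 x = x % B)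
    (hQ : ∀ m', Frame logarithms m m' → (∀ x < S, m'.nat 21 x = Nat.log B x) → Q m') :
    Wp X logarithms Q m := by
  refine Wp.mono ?_ hQ
  apply Wp.forLoop S hX (fun k m' => ∀ x < k, m'.nat 21 x = Nat.log B x) rfl
    (by intro _ _ _ h; simpa using h)
  · intro m' hf
    simp [hf.nat 14 rfl, h14]
  · simp
  · intro k m' hk hf h9 hI
    have h10' : m'.nat 10 0 = B := by simp [hf.nat 10 rfl, h10]
    have hq : m'.nat 18 k = k / B := by
      simpa [hf.nat 18 rfl] using (hqr k hk.le).1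
    apply Wp.branch
    · intro hb
      simp [h9, h10'] at hb
      apply Wp.setNat
      intro x hx
      by_cases hxk : x = k
      · simp [h9, hxk, Nat.log_of_lt hb]
      · have := hI x (by omega)
        simp [h9, hxk, this]
    · intro hb
      simp [h9, h10'] at hb
      apply Wp.setNat
      intro x hx
      by_cases hxk : x = k
      · simp only [NatExp.var, NatExp.eval, h9, hxk, hq, Memory.setNat_nat_self,
          Function.update_self, hI _ (Nat.div_lt_self (by omega) hB)]
        rw [Nat.log_of_one_lt_of_le hB hb]
      · have := hI x (by omega)
        simp [h9, hxk, this]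
  · intro m' _ hI
    exact hI

/-- Stores the table of `merge` in the array `22`. -/
def mergeTable : Program :=
  forLoop 9 (var 14) (forLoop 13 (var 14)
    (branch (Test.natLt (var 9) (const 1))
      (setNat 22 (add (get 15 (var 9)) (var 13)) (const 1))
      (seq (letNat 23 (get 22 (add (get 15 (get 18 (var 9))) (get 18 (var 13)))))
      (seq (letNat 24 (add (get 19 (var 9)) (get 19 (var 13))))
        (branch (Test.both (Test.natLt (var 24) (var 10)) (Test.natLt (const 0) (var 23)))
          (setNat 22 (add (get 15 (var 9)) (var 13))
            (add (add (var 24) (get 17 (sub (var 23) (const 1)))) (const 1)))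
          (setNat 22 (add (get 15 (var 9)) (var 13)) (const 0)))))))

end Program

theorem mul_add_inj {S a b c d : ℕ} (hb : b < S) (hd : d < S) :
    a * S + b = c * S + d ↔ a = c ∧ b = d := by
  constructor
  · intro h
    have h1 := congrArg (· / S) h
    have hS : 0 < S := by omega
    simp only [Nat.add_comm (_ * S), Nat.add_mul_div_right _ _ hS, Nat.div_eq_of_lt hb,
      Nat.div_eq_of_lt hd, Nat.zero_add] at h1
    subst h1
    omega
  · rintro ⟨rfl, rfl⟩
    rfl

namespace Program

open NatExp

/-- The recursion for `merge` at row `k` only looks at row `k / (n + 1)`, which is smaller for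
positive `k`; so the table can be filled row by row. -/
theorem wp_mergeTable {X S n K : ℕ} {Q : Memory → Prop} {m : Memory} (hn : 0 < n) (hX : S ≤ X)
    (hS : S = 2 * (n + 1) ^ K) (h14 : m.nat 14 0 = S) (h10 : m.nat 10 0 = n + 1)
    (hqr : ∀ x ≤ S, m.nat 18 x = x / (n + 1) ∧ m.nat 19 x = x % (n + 1))
    (h15 : ∀ x ≤ S, m.nat 15 x = x * S) (h17 : ∀ x ≤ S, m.nat 17 x = x * (n + 1))
    (hQ : ∀ m', Frame mergeTable m m' →
      (∀ x < S, ∀ y < S, m'.nat 22 (x * S + y) = merge (n + 1) x y) → Q m') :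
    Wp X mergeTable Q m := by
  have hB : 1 < n + 1 := by omega
  refine Wp.mono ?_ hQ
  apply Wp.forLoop S hX
    (fun k m' => ∀ x < k, ∀ y < S, m'.nat 22 (x * S + y) = merge (n + 1) x y) rfl
    (by intro _ _ _ h; simpa using h)
  · intro m' hf
    simp [hf.nat 14 rfl, h14]
  · simp
  · intro k m' hk hf h9 hI
    have g14 : m'.nat 14 0 = S := by simp [hf.nat 14 rfl, h14]
    apply Wp.forLoop S hX
      (fun j m'' => ∀ x y, (x < k ∧ y < S) ∨ (x = k ∧ y < j) →
        m''.nat 22 (x * S + y) = merge (n + 1) x y) rfl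
      (by intro _ _ _ h; simpa using h)
    · intro m'' hf'
      simp [hf'.nat 14 rfl, g14]
    · intro x y hxy
      exact hI x (by omega) y (by omega)
    · intro j m'' hj hf' h13 hJ
      have h9' : m''.nat 9 0 = k := by simp [hf'.nat 9 rfl, h9]
      have g10 : m''.nat 10 0 = n + 1 := by simp [hf'.nat 10 rfl, hf.nat 10 rfl, h10]
      have g15 : ∀ x ≤ S, m''.nat 15 x = x * S := by
        simpa [hf'.nat 15 rfl, hf.nat 15 rfl] using h15
      have g17 : ∀ x ≤ S, m''.nat 17 x = x * (n + 1) := by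
        simpa [hf'.nat 17 rfl, hf.nat 17 rfl] using h17
      have gqr : ∀ x ≤ S, m''.nat 18 x = x / (n + 1) ∧ m''.nat 19 x = x % (n + 1) := by
        simpa [hf'.nat 18 rfl, hf'.nat 19 rfl, hf.nat 18 rfl, hf.nat 19 rfl] using hqr
      have hstore : ∀ (m₁ : Memory) (r : ℕ), m₁.nat 22 = m''.nat 22 → r = merge (n + 1) k j →
          ∀ x y, (x < k ∧ y < S) ∨ (x = k ∧ y < j + 1) →
          Function.update (m₁.nat 22) (k * S + j) r (x * S + y) = merge (n + 1) x y := by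
        intro m₁ r h1 h2 x y hxy
        rw [Function.update_apply]
        split_ifs with hc
        · rw [mul_add_inj (by omega) hj] at hc
          rw [hc.1, hc.2, h2]
        · rw [h1]
          apply hJ
          rcases hxy with h3 | h3
          · exact Or.inl h3
          · refine Or.inr ⟨h3.1, ?_⟩
            have : y ≠ j := fun e => hc (by rw [h3.1, e])
            omega
      apply Wp.branch
      · intro hb
        simp [h9'] at hb
        apply Wp.setNat
        intro x y hxy
        simp only [NatExp.var, NatExp.eval, h9', h13, g15 k hk.le, Memory.setNat_nat_self]
        exact hstore m'' 1 rfl (by rw [hb, merge_zero]) x y hxy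
      · intro hb
        simp [h9'] at hb
        have hkpos : 0 < k := Nat.pos_of_ne_zero hb
        have hkdiv : k / (n + 1) < k := Nat.div_lt_self hkpos hB
        have hjdiv : j / (n + 1) < S := (Nat.div_le_self _ _).trans_lt hj
        -- The multiple of `n + 1` is itself looked up in a table, whose range must not be exceeded.
        have hsub : merge (n + 1) (k / (n + 1)) (j / (n + 1)) ≤ S := by
          have h1 : k / (n + 1) < (n + 1) ^ K := by
            apply Nat.div_lt_of_lt_mul
            have : 2 * (n + 1) ^ K ≤ (n + 1) * (n + 1) ^ K := Nat.mul_le_mul_right _ (by omega)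
            omega
          have := merge_le (y := j / (n + 1)) hB h1
          omega
        apply Wp.seq
        apply Wp.setNat
        apply Wp.seq
        apply Wp.setNat
        set M := merge (n + 1) (k / (n + 1)) (j / (n + 1)) with hM
        have e22 : m''.nat 22 (k / (n + 1) * S + j / (n + 1)) = M :=
          hJ _ _ (Or.inl ⟨hkdiv, hjdiv⟩)
        have e18 := (gqr k hk.le).1
        have e19 := (gqr k hk.le).2
        have f18 := (gqr j hj.le).1
        have f19 := (gqr j hj.le).2
        have e15 := g15 (k / (n + 1)) (by omega)
        apply Wp.branch
        · intro hb2
          simp [h9', h13, g10, e18, e19, f18, f19, e15, e22] at hb2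
          apply Wp.setNat
          intro x y hxy
          simp [h9', h13, e18, e19, f18, f19, e15, e22, g15 k hk.le, g17 (M - 1) (by omega)]
          refine hstore m'' _ rfl ?_ x y hxy
          rw [merge_of_pos hB hkpos, if_pos ⟨Nat.lt_succ_of_le hb2.1, hb2.2⟩, ← hM, Nat.mul_comm (n + 1)]
        · intro hb2
          simp [h9', h13, g10, e18, e19, f18, f19, e15, e22] at hb2
          apply Wp.setNat
          intro x y hxy
          simp [h9', h13, g15 k hk.le]
          refine hstore m'' _ rfl ?_ x y hxy
          rw [merge_of_pos hB hkpos, if_neg]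
          rintro ⟨h1, h2⟩
          have := hb2 (Nat.le_of_lt_succ h1)
          omega
    · intro m'' _ hJ x hx y hy
      exact hJ x y (by omega)
  · intro m' _ hI
    exact hI

/-- Stores the multiples of the number of codes and of `n`, the sums of digits, the logarithms and the
table of `merge`. -/
def tables : Program :=
  seq (multiples 15 14) (seq (multiples 16 0) (seq (multiples 17 10)
    (seq quotients (seq digitSums (seq logarithms mergeTable)))))

/-- The values of the parameters and of the tables. -/
structure HasTables (m : Memory) (n K S : ℕ) : Prop extends HasParameters m n K where
  codes_eq : S = 2 * (n + 1) ^ K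
  mulCodes : ∀ x ≤ S, m.nat 15 x = x * S
  mulSize : ∀ x ≤ S, m.nat 16 x = x * n
  digitSum : ∀ x ≤ S, m.nat 20 x = digitSum (n + 1) x
  log : ∀ x < S, m.nat 21 x = Nat.log (n + 1) x
  merge : ∀ x < S, ∀ y < S, m.nat 22 (x * S + y) = merge (n + 1) x y

theorem HasTables.frame {m m' : Memory} {n K S : ℕ} (h : HasTables m n K S)
    (h0 : m'.nat 0 = m.nat 0) (h8 : m'.nat 8 = m.nat 8) (h10 : m'.nat 10 = m.nat 10)
    (h11 : m'.nat 11 = m.nat 11) (h14 : m'.nat 14 = m.nat 14) (h15 : m'.nat 15 = m.nat 15)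
    (h16 : m'.nat 16 = m.nat 16) (h20 : m'.nat 20 = m.nat 20) (h21 : m'.nat 21 = m.nat 21)
    (h22 : m'.nat 22 = m.nat 22) : HasTables m' n K S := by
  obtain ⟨⟨a1, a2, a3, a4, a5⟩, a6, a7, a8, a9, a10, a11⟩ := h
  exact ⟨⟨by rw [h0, a1], by rw [h8, a2], by rw [h10, a3], by rw [h11, a4], by rw [h14, a5]⟩, a6,
    by rwa [h15], by rwa [h16], by rwa [h20], by rwa [h21], by rwa [h22]⟩

theorem wp_tables {X S n K : ℕ} {m : Memory} (hn : 0 < n)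
    (hX : S ≤ X) (hS : S = 2 * (n + 1) ^ K) (hm : HasParameters m n K) :
    Wp X tables (fun m' => HasTables m' n K S) m := by
  obtain ⟨h0, h8, h10, h11, h14⟩ := hm
  rw [← hS] at h14
  apply Wp.seq
  apply wp_multiples hX h14 (by norm_num) (by norm_num) (by norm_num) (by norm_num)
  intro m1 hf1 r15
  apply Wp.seq
  apply wp_multiples hX (by rw [hf1.nat 14 rfl, h14]) (by norm_num) (by norm_num) (by norm_num)
    (by norm_num)
  intro m2 hf2 r16
  apply Wp.seq
  apply wp_multiples hX (by rw [hf2.nat 14 rfl, hf1.nat 14 rfl, h14]) (by norm_num) (by norm_num)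
    (by norm_num) (by norm_num)
  intro m3 hf3 r17
  apply Wp.seq
  apply wp_quotients hX (Nat.succ_pos n)
    (by rw [hf3.nat 14 rfl, hf2.nat 14 rfl, hf1.nat 14 rfl, h14])
    (by rw [hf3.nat 10 rfl, hf2.nat 10 rfl, hf1.nat 10 rfl, h10])
  intro m4 hf4 rqr
  apply Wp.seq
  apply wp_digitSums hX (Nat.succ_lt_succ hn)
    (by rw [hf4.nat 14 rfl, hf3.nat 14 rfl, hf2.nat 14 rfl, hf1.nat 14 rfl, h14]) rqr
  intro m5 hf5 r20
  apply Wp.seq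
  apply wp_logarithms hX (Nat.succ_lt_succ hn)
    (by rw [hf5.nat 14 rfl, hf4.nat 14 rfl, hf3.nat 14 rfl, hf2.nat 14 rfl, hf1.nat 14 rfl, h14])
    (by rw [hf5.nat 10 rfl, hf4.nat 10 rfl, hf3.nat 10 rfl, hf2.nat 10 rfl, hf1.nat 10 rfl, h10])
    (by rw [hf5.nat 18 rfl, hf5.nat 19 rfl]; exact rqr)
  intro m6 hf6 r21
  have back : ∀ a, writesNat a tables = false → m6.nat a = m.nat a := by
    intro a ha
    simp only [tables, writesNat, Bool.or_eq_false_iff] at ha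
    rw [hf6.nat a ha.2.2.2.2.2.1, hf5.nat a ha.2.2.2.2.1, hf4.nat a ha.2.2.2.1,
      hf3.nat a ha.2.2.1, hf2.nat a ha.2.1, hf1.nat a ha.1]
  have e15 : m6.nat 15 = m1.nat 15 := by
    rw [hf6.nat 15 rfl, hf5.nat 15 rfl, hf4.nat 15 rfl, hf3.nat 15 rfl, hf2.nat 15 rfl]
  have e16 : m6.nat 16 = m2.nat 16 := by
    rw [hf6.nat 16 rfl, hf5.nat 16 rfl, hf4.nat 16 rfl, hf3.nat 16 rfl]
  have e17 : m6.nat 17 = m3.nat 17 := by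
    rw [hf6.nat 17 rfl, hf5.nat 17 rfl, hf4.nat 17 rfl]
  have e18 : m6.nat 18 = m4.nat 18 := by rw [hf6.nat 18 rfl, hf5.nat 18 rfl]
  have e19 : m6.nat 19 = m4.nat 19 := by rw [hf6.nat 19 rfl, hf5.nat 19 rfl]
  have e20 : m6.nat 20 = m5.nat 20 := by rw [hf6.nat 20 rfl]
  rw [h14] at r15
  rw [hf1.nat 0 rfl, h0] at r16
  rw [hf2.nat 10 rfl, hf1.nat 10 rfl, h10] at r17
  apply wp_mergeTable hn hX hS
    (by rw [back 14 rfl, h14]) (by rw [back 10 rfl, h10])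
    (by rw [e18, e19]; exact rqr) (by rw [e15]; exact r15) (by rw [e17]; exact r17)
  intro m7 hf7 r22
  refine ⟨⟨?_, ?_, ?_, ?_, ?_⟩, hS, ?_, ?_, ?_, ?_, r22⟩
  · rw [hf7.nat 0 rfl, back 0 rfl, h0]
  · rw [hf7.nat 8 rfl, back 8 rfl, h8]
  · rw [hf7.nat 10 rfl, back 10 rfl, h10]
  · rw [hf7.nat 11 rfl, back 11 rfl, h11]
  · rw [hf7.nat 14 rfl, back 14 rfl, h14, hS]
  · rw [hf7.nat 15 rfl, e15]
    exact r15
  · rw [hf7.nat 16 rfl, e16]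
    exact r16
  · rw [hf7.nat 20 rfl, e20]
    exact r20
  · rw [hf7.nat 21 rfl]
    exact r21

end Program

/-- Equality of natural numbers as a test. -/
def Test.natEq (e f : NatExp) : Test := Test.both (Test.neg (Test.natLt e f)) (Test.neg (Test.natLt f e))

@[simp]
theorem Test.holds_natEq {m : Memory} {e f : NatExp} :
    (Test.natEq e f).Holds m ↔ e.eval m = f.eval m := by
  simp only [Test.natEq, Test.Holds]
  omega

/-! ### Costs of the codes at single vertices -/

/-- The product of the positive natural numbers below `S` other than `d`. -/
noncomputable def cofactor (S d : ℕ) : ℝ :=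
  ∏ j ∈ Finset.range S, if j = 0 ∨ j = d then (1 : ℝ) else j

/-- Multiplying a weight by `cofactor S d` divides it by `d`, up to the factor `cofactor S 0` that
is common to all `d`. Quotients can thus be compared without division. -/
theorem cofactor_mul {S d : ℕ} (hd : 0 < d) (hdS : d < S) : cofactor S d * d = cofactor S 0 := by
  have hm : d ∈ Finset.range S := Finset.mem_range.mpr hdS
  rw [cofactor, cofactor, ← Finset.mul_prod_erase _ _ hm, ← Finset.mul_prod_erase _ _ hm]
  have : ∏ j ∈ (Finset.range S).erase d, (if j = 0 ∨ j = d then (1 : ℝ) else j) =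
      ∏ j ∈ (Finset.range S).erase d, (if j = 0 ∨ j = 0 then (1 : ℝ) else j) := by
    apply Finset.prod_congr rfl
    intro j hj
    simp [Finset.ne_of_mem_erase hj]
  rw [this]
  simp [hd.ne']
  ring

theorem cofactor_pos (S d : ℕ) : 0 < cofactor S d := by
  apply Finset.prod_pos
  intro j _
  split_ifs with h
  · exact one_pos
  · have : 0 < j := by omega
    exact_mod_cast this

namespace WeightedTree

/-- A multiple of the quotient of the weight of `v` by the number of time units that the code `x`
reserves for its query; zero if the query is not reserved any time at all. -/
noncomputable def unitCost {n : ℕ} (T : WeightedTree n) (K S : ℕ) (v : Fin n) (x : ℕ) : ℝ :=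
  if x < (n + 1) ^ K then T.weight v * cofactor S (digitSum (n + 1) x) else 0

end WeightedTree

namespace Program

open NatExp

/-- Multiplies the real variable `4` by the positive numbers below `14` other than the
variable `24`. -/
def scale : Program :=
  forLoop 13 (var 14)
    (branch (Test.both (Test.natLt (const 0) (var 13)) (Test.neg (Test.natEq (var 13) (var 24))))
      (seq (letReal 5 (RealExp.ofNat (const 0)))
      (seq (forLoop 23 (var 13) (letReal 5 (RealExp.add (RealExp.var 5) (RealExp.var 4))))
        (letReal 4 (RealExp.var 5))))
      skip)

theorem wp_scale {X S : ℕ} {Q : Memory → Prop} {m : Memory} (hX : S ≤ X) (h14 : m.nat 14 0 = S)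
    (hQ : ∀ m', Frame scale m m' → m'.real 4 0 = m.real 4 0 * cofactor S (m.nat 24 0) → Q m') :
    Wp X scale Q m := by
  refine Wp.mono ?_ hQ
  apply Wp.forLoop S hX
    (fun k m' => m'.real 4 0 = m.real 4 0 * cofactor k (m.nat 24 0)) rfl
    (by intro _ _ _ h; simpa using h)
  · intro m' hf
    simp [hf.nat 14 rfl, h14]
  · simp [cofactor]
  · intro k m' hk hf h13 hI
    have h24 : m'.nat 24 = m.nat 24 := hf.nat 24 rfl
    rw [cofactor, Finset.prod_range_succ, ← cofactor]
    apply Wp.branch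
    · intro hb
      simp [h13, h24] at hb
      apply Wp.seq
      apply Wp.setReal
      apply Wp.seq
      apply Wp.forLoop k (by omega) (fun j m'' => m''.real 5 0 = j * m'.real 4 0) rfl
        (by intro _ _ _ h; simpa using h)
      · intro m'' hf'
        simp [hf'.nat 13 rfl, h13]
      · simp
      · intro j m'' hj hf' _ hJ
        apply Wp.setReal
        simp [hJ, hf'.real 4 rfl]
        ring
      · intro m'' hf' hJ
        apply Wp.setReal
        simp [hJ, hI, hb.2, hb.1.ne']
        ring
    · intro hb
      simp [h13, h24] at hb
      apply Wp.skip
      rw [hI, if_pos (by omega), mul_one]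
  · intro m' _ hI
    exact hI

/-- Stores the costs of the codes at the single vertices in the real array `3`, and in the natural
array `25`, which codes are admissible. -/
def baseCosts : Program :=
  forLoop 26 (var 0) (forLoop 9 (var 14)
    (branch (Test.natLt (var 9) (const 1))
      (setNat 25 (add (get 15 (var 26)) (var 9)) (const 0))
      (seq (setNat 25 (add (get 15 (var 26)) (var 9)) (const 1))
        (branch (Test.natLt (var 9) (var 11))
          (seq (letReal 4 (RealExp.get 0 (var 26)))
          (seq (letNat 24 (get 20 (var 9)))
          (seq scale
            (setReal 3 (add (get 15 (var 26)) (var 9)) (RealExp.var 4)))))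
          (setReal 3 (add (get 15 (var 26)) (var 9)) (RealExp.ofNat (const 0)))))))

/-- The code `0` is excluded: a processed vertex has at least one unit, and an idle one has its
digit in the extra box. A positive digit sum is also what `cofactor_mul` needs. -/
theorem wp_baseCosts {X S n K : ℕ} {Q : Memory → Prop} {m : Memory} {T : WeightedTree n}
    (hX : S ≤ X) (hm : HasTables m n K S) (hnS : n ≤ S)
    (hw : ∀ v : Fin n, m.real 0 v = T.weight v)
    (hQ : ∀ m', Frame baseCosts m m' →
      (∀ v : Fin n, ∀ x < S, m'.nat 25 (v * S + x) = if x = 0 then 0 else 1) →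
      (∀ v : Fin n, ∀ x < S, x ≠ 0 → m'.real 3 (v * S + x) = T.unitCost K S v x) → Q m') :
    Wp X baseCosts Q m := by
  have h14 : m.nat 14 0 = S := by rw [hm.codes, ← hm.codes_eq]
  have key : Wp X baseCosts (fun m' =>
      ∀ v : Fin n, ∀ x < S, m'.nat 25 (v * S + x) = (if x = 0 then 0 else 1) ∧
        (x ≠ 0 → m'.real 3 (v * S + x) = T.unitCost K S v x)) m := by
    apply Wp.forLoop n (hnS.trans hX) (fun k m' =>
      ∀ v : Fin n, (v : ℕ) < k → ∀ x < S, m'.nat 25 (v * S + x) = (if x = 0 then 0 else 1) ∧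
        (x ≠ 0 → m'.real 3 (v * S + x) = T.unitCost K S v x)) rfl
      (by intro _ _ _ h; simpa using h)
    · intro m' hf
      simp [hf.nat 0 rfl, hm.size]
    · simp
    · intro k m' hk hf h26 hI
      apply Wp.forLoop S hX (fun j m'' =>
        ∀ v : Fin n, ∀ x, ((v : ℕ) < k ∧ x < S) ∨ ((v : ℕ) = k ∧ x < j) →
          m''.nat 25 (v * S + x) = (if x = 0 then 0 else 1) ∧
          (x ≠ 0 → m''.real 3 (v * S + x) = T.unitCost K S v x)) rfl
        (by intro _ _ _ h; simpa using h)
      · intro m'' hf'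
        simp [hf'.nat 14 rfl, hf.nat 14 rfl, h14]
      · intro v x hvx
        exact hI v (by omega) x (by omega)
      · intro j m'' hj hf' h9 hJ
        have e26 : m''.nat 26 0 = k := by rw [hf'.nat 26 rfl, h26]
        have e14 : m''.nat 14 0 = S := by rw [hf'.nat 14 rfl, hf.nat 14 rfl, h14]
        have e15 : m''.nat 15 k = k * S := by
          rw [hf'.nat 15 rfl, hf.nat 15 rfl, hm.mulCodes k (by omega)]
        have e11 : m''.nat 11 0 = (n + 1) ^ K := by
          rw [hf'.nat 11 rfl, hf.nat 11 rfl, hm.power]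
        have e20 : m''.nat 20 j = digitSum (n + 1) j := by
          rw [hf'.nat 20 rfl, hf.nat 20 rfl, hm.digitSum j hj.le]
        have ew : m''.real 0 k = T.weight ⟨k, hk⟩ := by
          rw [hf'.real 0 rfl, hf.real 0 rfl, ← hw ⟨k, hk⟩]
        have hstore : ∀ (f : ℕ → ℕ) (g : ℕ → ℝ),
            f = Function.update (m''.nat 25) (k * S + j) (if j = 0 then 0 else 1) →
            (∀ i, i ≠ k * S + j → g i = m''.real 3 i) →
            (j ≠ 0 → g (k * S + j) = T.unitCost K S ⟨k, hk⟩ j) →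
            ∀ v : Fin n, ∀ x, ((v : ℕ) < k ∧ x < S) ∨ ((v : ℕ) = k ∧ x < j + 1) →
              f (v * S + x) = (if x = 0 then 0 else 1) ∧
              (x ≠ 0 → g (v * S + x) = T.unitCost K S v x) := by
          intro f g hfe hge hg v x hvx
          rw [hfe]
          by_cases hc : (v : ℕ) * S + x = k * S + j
          · rw [hc, Function.update_self]
            rw [mul_add_inj (by omega) hj] at hc
            obtain ⟨rfl, rfl⟩ := hc
            exact ⟨rfl, hg⟩
          · rw [Function.update_of_ne hc, hge _ hc]
            apply hJ
            rcases hvx with h3 | h3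
            · exact Or.inl h3
            · refine Or.inr ⟨h3.1, ?_⟩
              have : x ≠ j := fun e => hc (by rw [h3.1, e])
              omega
        apply Wp.branch
        · intro hb
          simp [h9] at hb
          apply Wp.setNat
          apply hstore
          · simp [h9, e26, e15, hb]
          · simp
          · exact fun h => absurd hb h
        · intro hb
          simp [h9] at hb
          apply Wp.seq
          apply Wp.setNat
          apply Wp.branch
          · intro hb2
            simp [h9, e11] at hb2
            apply Wp.seq
            apply Wp.setReal
            apply Wp.seq
            apply Wp.setNat
            apply Wp.seq
            apply wp_scale hX (by simpa using e14)
            intro m3 hf3 h4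
            apply Wp.setReal
            apply hstore
            · simp [hf3.nat 25 rfl, h9, e26, e15, hb]
            · intro i hi
              simp [hf3.real 3 rfl, hf3.nat 9 rfl, hf3.nat 26 rfl, hf3.nat 15 rfl, h9, e26, e15, hi]
            · intro _
              simp [hf3.nat 9 rfl, hf3.nat 26 rfl, hf3.nat 15 rfl, h9, e26, e15, h4, e20, ew,
                WeightedTree.unitCost, hb2]
          · intro hb2
            simp [h9, e11] at hb2
            apply Wp.setReal
            apply hstore
            · simp [h9, e26, e15, hb]
            · intro i hi
              simp [h9, e26, e15, hi]
            · intro _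
              simp [h9, e26, e15, WeightedTree.unitCost, not_lt.mpr hb2]
      · intro m'' _ hJ v hv x hx
        exact hJ v x (by omega)
    · intro m' _ hI v x hx
      exact hI v v.2 x hx
  apply key.mono
  intro m' hf h
  exact hQ m' hf (fun v x hx => (h v x hx).1) (fun v x hx => (h v x hx).2)

/-! ### Finding an order of growth by leaves -/

/-- Finds an order in which the tree grows by leaves from the vertex `0`: array `27` marks the
vertices that have been reached, `28` counts the steps, `29` holds the leaves and `30` the vertices
that they are attached to. -/
def growthOrder : Program :=
  seq (forLoop 9 (var 0) (setNat 27 (var 9) (const 0)))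
  (seq (setNat 27 (const 0) (const 1))
  (seq (letNat 28 (const 0))
    (forLoop 26 (var 0) (forLoop 9 (var 0) (forLoop 13 (var 0)
      (branch (Test.both (Test.natEq (get 27 (var 9)) (const 1))
          (Test.both (Test.natEq (get 27 (var 13)) (const 0))
            (Test.natEq (get 1 (add (get 16 (var 9)) (var 13))) (const 1))))
        (seq (setNat 27 (var 13) (const 1))
        (seq (setNat 29 (var 28) (var 13))
        (seq (setNat 30 (var 28) (var 9))
          (letNat 28 (add (var 28) (const 1))))))
        skip))))))

open WeightedTree in
/-- The order found so far. -/
structure HasOrder {n : ℕ} (T : WeightedTree n) (root : Fin n) (m : Memory) (c : ℕ)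
    (sv su : ℕ → Fin n) : Prop where
  count : m.nat 28 0 = c
  leaf : ∀ s < c, m.nat 29 s = sv s
  anchor : ∀ s < c, m.nat 30 s = su s
  mark : ∀ v : Fin n, m.nat 27 v = if v ∈ reached root sv c then 1 else 0
  adj : ∀ s < c, T.graph.Adj (su s) (sv s)
  mem : ∀ s < c, su s ∈ reached root sv s
  notMem : ∀ s < c, sv s ∉ reached root sv s

end Program

namespace WeightedTree

variable {n : ℕ}

theorem reached_congr {root : Fin n} {sv sv' : ℕ → Fin n} {c : ℕ} (h : ∀ s < c, sv s = sv' s) :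
    reached root sv c = reached root sv' c := by
  rw [reached, reached]
  congr 1
  apply Finset.image_congr
  intro s hs
  exact h s (by simpa using hs)

theorem card_reached {root : Fin n} {sv : ℕ → Fin n} :
    ∀ c, (∀ s < c, sv s ∉ reached root sv s) → (reached root sv c).card = c + 1 := by
  intro c
  induction c with
  | zero => intro _; simp [reached]
  | succ c ih =>
    intro h
    rw [reached_succ, Finset.card_insert_of_notMem (h c (Nat.lt_succ_self c)),
      ih fun s hs => h s (by omega)]

theorem dist_lt (T : WeightedTree n) (u v : Fin n) : T.graph.dist u v < n := by
  obtain ⟨p, hp⟩ := T.isTree.connected.exists_walk_length_eq_dist u v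
  have := (SimpleGraph.Walk.isPath_of_length_eq_dist p hp).length_lt
  rw [Fintype.card_fin] at this
  omega

end WeightedTree

namespace Program

open WeightedTree

theorem HasOrder.push {n : ℕ} {T : WeightedTree n} {root : Fin n} {m m' : Memory} {c : ℕ}
    {sv su : ℕ → Fin n} (h : HasOrder T root m c sv su) {u v : Fin n} (hadj : T.graph.Adj u v)
    (hu : u ∈ reached root sv c) (hv : v ∉ reached root sv c)
    (h27 : m'.nat 27 = Function.update (m.nat 27) v 1)
    (h28 : m'.nat 28 0 = c + 1) (h29 : m'.nat 29 = Function.update (m.nat 29) c v)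
    (h30 : m'.nat 30 = Function.update (m.nat 30) c u) :
    HasOrder T root m' (c + 1) (Function.update sv c v) (Function.update su c u) ∧
      reached root (Function.update sv c v) (c + 1) = insert v (reached root sv c) := by
  have hr : ∀ s ≤ c, reached root (Function.update sv c v) s = reached root sv s := by
    intro s hs
    apply reached_congr
    intro j hj
    rw [Function.update_of_ne (by omega)]
  have hr' : reached root (Function.update sv c v) (c + 1) = insert v (reached root sv c) := by
    rw [reached_succ, hr c le_rfl, Function.update_self]
  refine ⟨⟨h28, ?_, ?_, ?_, ?_, ?_, ?_⟩, hr'⟩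
  · intro s hs
    rw [h29]
    by_cases hsc : s = c
    · simp [hsc]
    · simp [hsc, h.leaf s (by omega)]
  · intro s hs
    rw [h30]
    by_cases hsc : s = c
    · simp [hsc]
    · simp [hsc, h.anchor s (by omega)]
  · intro w
    rw [h27, hr']
    by_cases hw : w = v
    · simp [hw]
    · have : (w : ℕ) ≠ v := fun e => hw (Fin.ext e)
      simp [hw, this, h.mark w]
  · intro s hs
    by_cases hsc : s = c
    · simp [hsc, hadj]
    · simp [hsc, h.adj s (by omega)]
  · intro s hs
    rw [hr s (by omega)]
    by_cases hsc : s = c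
    · simp [hsc, hu]
    · simp [hsc, h.mem s (by omega)]
  · intro s hs
    rw [hr s (by omega)]
    by_cases hsc : s = c
    · simp [hsc, hv]
    · simp [hsc, h.notMem s (by omega)]

open NatExp

/-- After `k` sweeps over all pairs of vertices, everything within distance `k` of the root has been
reached, since a vertex at positive distance has a neighbour that is closer to the root. All
distances are below `n`, so `n` sweeps suffice. -/
theorem wp_growthOrder {X S n K : ℕ} {Q : Memory → Prop} {m : Memory} {T : WeightedTree n}
    (root : Fin n) (hroot : (root : ℕ) = 0) (hX : S ≤ X) (hm : HasTables m n K S) (hnS : n ≤ S)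
    (hadj : ∀ u v : Fin n, m.nat 1 (u * n + v) = 1 ↔ T.graph.Adj u v)
    (hQ : ∀ m', Frame growthOrder m m' → ∀ sv su, T.Growth root (n - 1) sv su →
      (∀ s < n - 1, m'.nat 29 s = sv s) → (∀ s < n - 1, m'.nat 30 s = su s) → Q m') :
    Wp X growthOrder Q m := by
  have key : Wp X growthOrder (fun m' => ∃ c sv su, HasOrder T root m' c sv su ∧
      ∀ v, T.graph.dist root v ≤ n → v ∈ reached root sv c) m := by
    apply Wp.seq
    apply Wp.forLoop n (hnS.trans hX) (fun k m' => ∀ v < k, m'.nat 27 v = 0) rfl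
      (by intro _ _ _ h; simpa using h)
    · intro m' hf
      simp [hf.nat 0 rfl, hm.size]
    · simp
    · intro k m' hk hf h9 hI
      apply Wp.setNat
      intro v hv
      by_cases hvk : v = k
      · simp [h9, hvk]
      · simp [h9, hvk, hI v (by omega)]
    intro m1 hf1 hI1
    have a0 : m1.nat 0 0 = n := by rw [hf1.nat 0 rfl, hm.size]
    have a1 : m1.nat 1 = m.nat 1 := hf1.nat 1 rfl
    have a16 : m1.nat 16 = m.nat 16 := hf1.nat 16 rfl
    apply Wp.seq
    apply Wp.setNat
    apply Wp.seq
    apply Wp.setNat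
    apply Wp.forLoop n (hnS.trans hX) (fun k m' => ∃ c sv su, HasOrder T root m' c sv su ∧
      ∀ v, T.graph.dist root v ≤ k → v ∈ reached root sv c) rfl
      (by
        rintro k m' j ⟨c, sv, su, h, h'⟩
        exact ⟨c, sv, su, ⟨h.1, h.2, h.3, h.4, h.5, h.6, h.7⟩, h'⟩)
    · intro m' hf
      simp [hf.nat 0 rfl, a0]
    · refine ⟨0, fun _ => root, fun _ => root, ⟨?_, ?_, ?_, ?_, ?_, ?_, ?_⟩, ?_⟩
      · simp
      · simp
      · simp
      · intro v
        rw [reached_zero]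
        by_cases hv : v = root
        · simp [hv, hroot]
        · have : (v : ℕ) ≠ 0 := fun e => hv (Fin.ext (e.trans hroot.symm))
          simp [hv, this, hI1 v v.2]
      · simp
      · simp
      · simp
      · intro v hv
        have : root = v := (T.isTree.connected.dist_eq_zero_iff).mp (by omega)
        simp [reached, this]
    · rintro k m2 hk hf2 - hI2
      apply Wp.forLoop n (hnS.trans hX) (fun j m' => ∃ c sv su, HasOrder T root m' c sv su ∧
        (∀ v, T.graph.dist root v ≤ k → v ∈ reached root sv c) ∧
        (∀ a v : Fin n, (a : ℕ) < j → T.graph.dist root a ≤ k → T.graph.Adj a v →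
          v ∈ reached root sv c)) rfl
        (by
          rintro k m' j ⟨c, sv, su, h, h'⟩
          exact ⟨c, sv, su, ⟨h.1, h.2, h.3, h.4, h.5, h.6, h.7⟩, h'⟩)
      · intro m' hf
        simp [hf.nat 0 rfl, hf2.nat 0 rfl, a0]
      · obtain ⟨c, sv, su, h, h'⟩ := hI2
        exact ⟨c, sv, su, h, h', by simp⟩
      · intro j m3 hj hf3 h9 hI3
        apply Wp.forLoop n (hnS.trans hX) (fun l m' => ∃ c sv su, HasOrder T root m' c sv su ∧
          (∀ v, T.graph.dist root v ≤ k → v ∈ reached root sv c) ∧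
          (∀ a v : Fin n, (a : ℕ) < j ∨ (a : ℕ) = j ∧ (v : ℕ) < l → T.graph.dist root a ≤ k →
            T.graph.Adj a v → v ∈ reached root sv c)) rfl
          (by
            rintro k m' j ⟨c, sv, su, h, h'⟩
            exact ⟨c, sv, su, ⟨h.1, h.2, h.3, h.4, h.5, h.6, h.7⟩, h'⟩)
        · intro m' hf
          simp [hf.nat 0 rfl, hf3.nat 0 rfl, hf2.nat 0 rfl, a0]
        · obtain ⟨c, sv, su, h, h', h''⟩ := hI3
          exact ⟨c, sv, su, h, h', fun a v hav => h'' a v (by omega)⟩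
        · rintro l m4 hl hf4 h13 ⟨c, sv, su, h, h', h''⟩
          have e9 : m4.nat 9 0 = j := by rw [hf4.nat 9 rfl, h9]
          have e16 : m4.nat 16 j = j * n := by
            rw [hf4.nat 16 rfl, hf3.nat 16 rfl, hf2.nat 16 rfl]
            simp [a16, hm.mulSize j (by omega)]
          have e1 : m4.nat 1 (j * n + l) = 1 ↔ T.graph.Adj ⟨j, hj⟩ ⟨l, hl⟩ := by
            rw [hf4.nat 1 rfl, hf3.nat 1 rfl, hf2.nat 1 rfl]
            simpa [a1] using hadj ⟨j, hj⟩ ⟨l, hl⟩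
          have mj := h.mark ⟨j, hj⟩
          have ml := h.mark ⟨l, hl⟩
          simp only at mj ml
          apply Wp.branch
          · intro hb
            simp [e9, h13, e16, e1, mj, ml] at hb
            apply Wp.seq
            apply Wp.setNat
            apply Wp.seq
            apply Wp.setNat
            apply Wp.seq
            apply Wp.setNat
            apply Wp.setNat
            obtain ⟨g1, g2⟩ := h.push (m' := (((m4.setNat 27 l 1).setNat 29 c l).setNat 30 c
              j).setNat 28 0 (c + 1)) hb.2.2 hb.1 hb.2.1 (by simp) (by simp) (by simp) (by simp)
            refine ⟨c + 1, Function.update sv c ⟨l, hl⟩, Function.update su c ⟨j, hj⟩, ?_, ?_, ?_⟩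
            · simpa [e9, h13, h.count] using g1
            · intro v hv
              rw [g2]
              exact Finset.mem_insert_of_mem (h' v hv)
            · intro a v hav hd ha
              rw [g2, Finset.mem_insert]
              by_cases hvl : (v : ℕ) = l
              · exact Or.inl (Fin.ext hvl)
              · exact Or.inr (h'' a v (by omega) hd ha)
          · intro hb
            simp [e9, h13, e16, e1, mj, ml] at hb
            apply Wp.skip
            refine ⟨c, sv, su, h, h', ?_⟩
            intro a v hav hd ha
            by_cases hvl : (a : ℕ) = j ∧ (v : ℕ) = l
            · obtain ⟨rfl, rfl⟩ := hvl
              by_contra hv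
              exact hb (h' a hd) hv ha
            · exact h'' a v (by omega) hd ha
        · rintro m' - ⟨c, sv, su, h, h', h''⟩
          exact ⟨c, sv, su, h, h', fun a v hav => h'' a v (by omega)⟩
      · rintro m' - ⟨c, sv, su, h, h', h''⟩
        refine ⟨c, sv, su, h, ?_⟩
        intro v hv
        by_cases hvr : v = root
        · apply h'
          simp [hvr]
        · have h1 := T.dist_rep_lt hvr
          rw [SimpleGraph.dist_comm, SimpleGraph.dist_comm (u := v)] at h1
          exact h'' _ v (T.rep v root).2 (by omega) (T.adj_rep hvr).symm
    · intro m' _ h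
      exact h
  apply key.mono
  rintro m' hf ⟨c, sv, su, h, h'⟩
  have huniv : reached root sv c = Finset.univ := by
    ext v
    simp [h' v (T.dist_lt root v).le]
  have hc := card_reached c h.notMem
  -- Each step adds one new vertex to the root, so there are exactly `n - 1` steps.
  rw [huniv, Finset.card_univ, Fintype.card_fin] at hc
  have hc' : n - 1 = c := by omega
  apply hQ m' hf sv su
  · rw [hc']
    exact ⟨h.adj, h.mem, h.notMem, huniv⟩
  · rw [hc']
    exact h.leaf
  · rw [hc']
    exact h.anchor

end Program

/-! ### The dynamic program: merging the table of a leaf into that of its neighbour -/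

namespace Program

open NatExp

/-- The code `x` is admissible at the vertex `v`. -/
def Adm (m : Memory) (S v x : ℕ) : Prop := m.nat 25 (v * S + x) = 1

/-- The cost of the code `x` at the vertex `v`. -/
def val (m : Memory) (S v x : ℕ) : ℝ := m.real 3 (v * S + x)

/-- The effect of merging the table of `v` into the table of `u` in step `s`. -/
structure MergeStep (S B : ℕ) (m m' : Memory) (s u v : ℕ) : Prop where
  adm_of_ne : ∀ w ≠ u, ∀ x < S, (Adm m' S w x ↔ Adm m S w x)
  val_of_ne : ∀ w ≠ u, ∀ x < S, val m' S w x = val m S w x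
  complete : ∀ x < S, ∀ y < S, Adm m S u x → Adm m S v y → 0 < merge B x y → merge B x y ≤ S →
    Adm m' S u (merge B x y - 1) ∧ val m' S u (merge B x y - 1) ≤ max (val m S u x) (val m S v y)
  sound : ∀ z < S, Adm m' S u z → ∃ x < S, ∃ y < S, m'.nat 35 (s * S + z) = x ∧
    m'.nat 36 (s * S + z) = y ∧ Adm m S u x ∧ Adm m S v y ∧ merge B x y = z + 1 ∧
    val m S u x ≤ val m' S u z ∧ val m S v y ≤ val m' S u z
  left_of_ne : ∀ s' ≠ s, ∀ z < S, m'.nat 35 (s' * S + z) = m.nat 35 (s' * S + z)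
  right_of_ne : ∀ s' ≠ s, ∀ z < S, m'.nat 36 (s' * S + z) = m.nat 36 (s' * S + z)

/-- Takes account of the codes `9` and `13` at the vertices `31` and `32`, in step `39`. -/
def combineEntry : Program :=
  branch (Test.both (Test.natEq (get 25 (add (get 15 (var 31)) (var 9))) (const 1))
      (Test.both (Test.natEq (get 25 (add (get 15 (var 32)) (var 13))) (const 1))
        (Test.both (Test.natLt (const 0) (get 22 (add (get 15 (var 9)) (var 13))))
          (Test.natLt (get 22 (add (get 15 (var 9)) (var 13))) (add (var 14) (const 1))))))
    (seq (letNat 34 (sub (get 22 (add (get 15 (var 9)) (var 13))) (const 1)))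
    (seq (branch (Test.realLt (RealExp.get 3 (add (get 15 (var 31)) (var 9)))
          (RealExp.get 3 (add (get 15 (var 32)) (var 13))))
        (letReal 6 (RealExp.get 3 (add (get 15 (var 32)) (var 13))))
        (letReal 6 (RealExp.get 3 (add (get 15 (var 31)) (var 9)))))
      (branch (Test.both (Test.natEq (get 33 (var 34)) (const 1))
          (Test.neg (Test.realLt (RealExp.var 6) (RealExp.get 7 (var 34)))))
        skip
        (seq (setNat 33 (var 34) (const 1))
        (seq (setReal 7 (var 34) (RealExp.var 6))
        (seq (setNat 35 (add (get 15 (var 39)) (var 34)) (var 9))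
          (setNat 36 (add (get 15 (var 39)) (var 34)) (var 13))))))))
    skip

/-- The part of the new table that comes from the pairs of codes in `D`. -/
structure Partial (S B : ℕ) (m m' : Memory) (s u v : ℕ) (D : ℕ → ℕ → Prop) : Prop where
  complete : ∀ x < S, ∀ y < S, D x y → Adm m S u x → Adm m S v y → 0 < merge B x y →
    merge B x y ≤ S → m'.nat 33 (merge B x y - 1) = 1 ∧
      m'.real 7 (merge B x y - 1) ≤ max (val m S u x) (val m S v y)
  sound : ∀ z < S, m'.nat 33 z = 1 → ∃ x < S, ∃ y < S, m'.nat 35 (s * S + z) = x ∧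
    m'.nat 36 (s * S + z) = y ∧ Adm m S u x ∧ Adm m S v y ∧ merge B x y = z + 1 ∧
    val m S u x ≤ m'.real 7 z ∧ val m S v y ≤ m'.real 7 z
  left_of_ne : ∀ s' ≠ s, ∀ z < S, m'.nat 35 (s' * S + z) = m.nat 35 (s' * S + z)
  right_of_ne : ∀ s' ≠ s, ∀ z < S, m'.nat 36 (s' * S + z) = m.nat 36 (s' * S + z)

/-- `D` is the set of pairs treated so far, and `D'` contains at most one pair more. The maximum of
the two costs competes with the entry stored so far at the merged code. -/
theorem wp_combineEntry {X S B s u v x y : ℕ} {m m' : Memory} {D D' : ℕ → ℕ → Prop}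
    (hx : x < S) (hy : y < S) (h25 : m'.nat 25 = m.nat 25) (h3 : m'.real 3 = m.real 3)
    (h9 : m'.nat 9 0 = x) (h13 : m'.nat 13 0 = y) (h14 : m'.nat 14 0 = S)
    (h15u : m'.nat 15 u = u * S) (h15v : m'.nat 15 v = v * S) (h15x : m'.nat 15 x = x * S)
    (h15s : m'.nat 15 s = s * S) (h22 : m'.nat 22 (x * S + y) = merge B x y)
    (h31 : m'.nat 31 0 = u) (h32 : m'.nat 32 0 = v) (h39 : m'.nat 39 0 = s)
    (hI : Partial S B m m' s u v D) (hD : ∀ a b, D' a b → D a b ∨ a = x ∧ b = y) :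
    Wp X combineEntry (fun m'' => Partial S B m m'' s u v D') m' := by
  have e1 : m'.nat 25 (u * S + x) = 1 ↔ Adm m S u x := by rw [h25]; rfl
  have e2 : m'.nat 25 (v * S + y) = 1 ↔ Adm m S v y := by rw [h25]; rfl
  have e3 : m'.real 3 (u * S + x) = val m S u x := by rw [h3]; rfl
  have e4 : m'.real 3 (v * S + y) = val m S v y := by rw [h3]; rfl
  apply Wp.branch
  · intro hb
    simp [h9, h13, h14, h15u, h15v, h15x, h22, h31, h32, e1, e2] at hb
    obtain ⟨a1, a2, a3, a4⟩ := hb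
    obtain ⟨z, hz⟩ : ∃ z, merge B x y = z + 1 := ⟨_, (Nat.succ_pred_eq_of_pos a3).symm⟩
    have hzS : z < S := by omega
    apply Wp.seq
    apply Wp.setNat
    apply Wp.seq
    have hfin : ∀ m₂ : Memory, m₂ = (m'.setNat 34 0 z).setReal 6 0 (max (val m S u x) (val m S v y)) →
        Wp X (branch (Test.both (Test.natEq (get 33 (var 34)) (const 1))
          (Test.neg (Test.realLt (RealExp.var 6) (RealExp.get 7 (var 34)))))
        skip
        (seq (setNat 33 (var 34) (const 1))
        (seq (setReal 7 (var 34) (RealExp.var 6))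
        (seq (setNat 35 (add (get 15 (var 39)) (var 34)) (var 9))
          (setNat 36 (add (get 15 (var 39)) (var 34)) (var 13))))))
        (fun m'' => Partial S B m m'' s u v D') m₂ := by
      rintro m₂ rfl
      apply Wp.branch
      · intro hb
        simp at hb
        apply Wp.skip
        constructor
        · intro a ha b hb' hab g1 g2 g3 g4
          rcases hD a b hab with hd | ⟨rfl, rfl⟩
          · simpa using hI.complete a ha b hb' hd g1 g2 g3 g4
          · rw [hz, Nat.add_sub_cancel]
            refine ⟨by simpa using hb.1, ?_⟩
            rcases le_or_gt (m'.real 7 z) (val m S u a) with h | h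
            · exact le_max_of_le_left (by simpa using h)
            · exact le_max_of_le_right (by simpa using hb.2 h)
        · simpa using hI.sound
        · simpa using hI.left_of_ne
        · simpa using hI.right_of_ne
      · intro hb
        -- An existing entry is replaced only by a strictly smaller one, so the upper bounds due to
        -- earlier pairs remain true.
        have hb' : m'.nat 33 z = 1 → max (val m S u x) (val m S v y) < m'.real 7 z := by
          intro h
          by_contra hcon
          apply hb
          simpa [h] using hcon
        apply Wp.seq
        apply Wp.setNat
        apply Wp.seq
        apply Wp.setReal
        apply Wp.seq
        apply Wp.setNat
        apply Wp.setNat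
        simp only [NatExp.var, RealExp.var, NatExp.eval, RealExp.eval, Memory.setNat_nat_self,
          Memory.setReal_nat, Memory.setReal_real_self, Memory.setNat_real, Function.update_self,
          Memory.setNat_nat_of_ne _ (show (15 : ℕ) ≠ 33 by norm_num),
          Memory.setNat_nat_of_ne _ (show (15 : ℕ) ≠ 34 by norm_num),
          Memory.setNat_nat_of_ne _ (show (15 : ℕ) ≠ 35 by norm_num),
          Memory.setNat_nat_of_ne _ (show (39 : ℕ) ≠ 33 by norm_num),
          Memory.setNat_nat_of_ne _ (show (39 : ℕ) ≠ 34 by norm_num),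
          Memory.setNat_nat_of_ne _ (show (39 : ℕ) ≠ 35 by norm_num),
          Memory.setNat_nat_of_ne _ (show (34 : ℕ) ≠ 33 by norm_num),
          Memory.setNat_nat_of_ne _ (show (34 : ℕ) ≠ 35 by norm_num),
          Memory.setNat_nat_of_ne _ (show (9 : ℕ) ≠ 33 by norm_num),
          Memory.setNat_nat_of_ne _ (show (9 : ℕ) ≠ 34 by norm_num),
          Memory.setNat_nat_of_ne _ (show (13 : ℕ) ≠ 33 by norm_num),
          Memory.setNat_nat_of_ne _ (show (13 : ℕ) ≠ 34 by norm_num),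
          Memory.setNat_nat_of_ne _ (show (13 : ℕ) ≠ 35 by norm_num), h9, h13, h15s, h39]
        have inj : ∀ w, s * S + w = s * S + z ↔ w = z := fun w => by omega
        constructor
        · intro a ha b hb'' hab g1 g2 g3 g4
          rcases hD a b hab with hd | ⟨rfl, rfl⟩
          · obtain ⟨k1, k2⟩ := hI.complete a ha b hb'' hd g1 g2 g3 g4
            by_cases hzz : merge B a b - 1 = z
            · rw [hzz] at k1 k2 ⊢
              simpa using (hb' k1).le.trans k2
            · simpa [hzz] using ⟨k1, le_max_iff.mp k2⟩
          · rw [hz, Nat.add_sub_cancel]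
            simp
        · intro w hw h33
          by_cases hwz : w = z
          · refine ⟨x, hx, y, hy, ?_, ?_, a1, a2, by rw [hz, hwz], ?_, ?_⟩
            · simp [hwz]
            · simp [hwz]
            · simp [hwz]
            · simp [hwz]
          · have h33' : m'.nat 33 w = 1 := by simpa [hwz] using h33
            simpa [hwz, inj] using hI.sound w hw h33'
        · intro s' hs' w hw
          have : s' * S + w ≠ s * S + z := fun e => hs' ((mul_add_inj hw hzS).mp e).1
          simpa [this] using hI.left_of_ne s' hs' w hw
        · intro s' hs' w hw
          have : s' * S + w ≠ s * S + z := fun e => hs' ((mul_add_inj hw hzS).mp e).1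
          simpa [this] using hI.right_of_ne s' hs' w hw
    apply Wp.branch
    · intro hb
      simp [h9, h13, h15u, h15v, h31, h32, e3, e4] at hb
      apply Wp.setReal
      apply hfin
      simp [h9, h13, h15v, h15x, h22, h32, e4, hz, max_eq_right hb.le]
    · intro hb
      simp [h9, h13, h15u, h15v, h31, h32, e3, e4] at hb
      apply Wp.setReal
      apply hfin
      simp [h9, h13, h15u, h15x, h22, h31, e3, hz, max_eq_left hb]
  · intro hb
    simp [h9, h13, h14, h15u, h15v, h15x, h22, h31, h32, e1, e2] at hb
    apply Wp.skip
    refine ⟨?_, hI.2, hI.3, hI.4⟩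
    intro a ha b hb' hab g1 g2 g3 g4
    rcases hD a b hab with hd | ⟨rfl, rfl⟩
    · exact hI.complete a ha b hb' hd g1 g2 g3 g4
    · have := hb g1 g2 g3
      omega

/-- Merges the table of the vertex `32` into the table of the vertex `31`, in step `39`. -/
def combine : Program :=
  seq (forLoop 9 (var 14) (setNat 33 (var 9) (const 0)))
  (seq (forLoop 9 (var 14) (forLoop 13 (var 14) combineEntry))
    (forLoop 9 (var 14)
      (seq (setNat 25 (add (get 15 (var 31)) (var 9)) (get 33 (var 9)))
        (setReal 3 (add (get 15 (var 31)) (var 9)) (RealExp.get 7 (var 9))))))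

/-- The new table of `u` is collected in the arrays `33` and `7` and copied back only at the end,
because the old table is read throughout. -/
theorem wp_combine {X S B s u v : ℕ} {m : Memory} (hX : S ≤ X) (hu : u ≤ S) (hv : v ≤ S)
    (hs : s ≤ S) (huv : v ≠ u) (h14 : m.nat 14 0 = S) (h15 : ∀ x ≤ S, m.nat 15 x = x * S)
    (h22 : ∀ x < S, ∀ y < S, m.nat 22 (x * S + y) = merge B x y)
    (h31 : m.nat 31 0 = u) (h32 : m.nat 32 0 = v) (h39 : m.nat 39 0 = s) :
    Wp X combine (fun m' => MergeStep S B m m' s u v) m := by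
  apply Wp.seq
  apply Wp.forLoop S hX (fun k m' => ∀ z < k, m'.nat 33 z = 0) rfl
    (by intro _ _ _ h; simpa using h)
  · intro m' hf
    simp [hf.nat 14 rfl, h14]
  · simp
  · intro k m' hk hf h9 hI
    apply Wp.setNat
    intro z hz
    by_cases hzk : z = k
    · simp [h9, hzk]
    · simp [h9, hzk, hI z (by omega)]
  intro m1 hf1 hI1
  apply Wp.seq
  apply Wp.forLoop S hX (fun k m' => Partial S B m m' s u v (fun x _ => x < k)) rfl
    (by
      rintro k m' j ⟨q1, q2, q3, q4⟩
      exact ⟨by simpa using q1, by simpa using q2, by simpa using q3, by simpa using q4⟩)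
  · intro m' hf
    simp [hf.nat 14 rfl, hf1.nat 14 rfl, h14]
  · refine ⟨?_, ?_, ?_, ?_⟩
    · simp
    · intro z hz h
      rw [hI1 z hz] at h
      exact absurd h (by norm_num)
    · intro s' _ z _
      rw [hf1.nat 35 rfl]
    · intro s' _ z _
      rw [hf1.nat 36 rfl]
  · intro k m2 hk hf2 h9 hI2
    apply Wp.forLoop S hX
      (fun j m' => Partial S B m m' s u v (fun x y => x < k ∨ x = k ∧ y < j)) rfl
      (by
        rintro k m' j ⟨q1, q2, q3, q4⟩
        exact ⟨by simpa using q1, by simpa using q2, by simpa using q3, by simpa using q4⟩)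
    · intro m' hf
      simp [hf.nat 14 rfl, hf2.nat 14 rfl, hf1.nat 14 rfl, h14]
    · simpa using hI2
    · intro j m3 hj hf3 h13 hI3
      have e15 : m3.nat 15 = m.nat 15 := by rw [hf3.nat 15 rfl, hf2.nat 15 rfl, hf1.nat 15 rfl]
      apply wp_combineEntry hk hj
      · rw [hf3.nat 25 rfl, hf2.nat 25 rfl, hf1.nat 25 rfl]
      · rw [hf3.real 3 rfl, hf2.real 3 rfl, hf1.real 3 rfl]
      · rw [hf3.nat 9 rfl, h9]
      · exact h13
      · rw [hf3.nat 14 rfl, hf2.nat 14 rfl, hf1.nat 14 rfl, h14]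
      · rw [e15, h15 u hu]
      · rw [e15, h15 v hv]
      · rw [e15, h15 k hk.le]
      · rw [e15, h15 s hs]
      · rw [hf3.nat 22 rfl, hf2.nat 22 rfl, hf1.nat 22 rfl, h22 k hk j hj]
      · rw [hf3.nat 31 rfl, hf2.nat 31 rfl, hf1.nat 31 rfl, h31]
      · rw [hf3.nat 32 rfl, hf2.nat 32 rfl, hf1.nat 32 rfl, h32]
      · rw [hf3.nat 39 rfl, hf2.nat 39 rfl, hf1.nat 39 rfl, h39]
      · exact hI3
      · intro a b hab
        omega
    · rintro m' - ⟨q1, q2, q3, q4⟩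
      refine ⟨?_, q2, q3, q4⟩
      intro x hx y hy hxy
      exact q1 x hx y hy (by omega)
  intro m4 hf4 hI4
  have e25 : m4.nat 25 = m.nat 25 := by rw [hf4.nat 25 rfl, hf1.nat 25 rfl]
  have e3 : m4.real 3 = m.real 3 := by rw [hf4.real 3 rfl, hf1.real 3 rfl]
  have e15 : m4.nat 15 u = u * S := by rw [hf4.nat 15 rfl, hf1.nat 15 rfl, h15 u hu]
  -- The invariant covers all rows `w`, since the tables of the vertices other than `u` must be
  -- known to survive.
  apply Wp.forLoop S hX (fun k m' => ∀ w, ∀ x < S,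
    m'.nat 25 (w * S + x) = (if w = u ∧ x < k then m4.nat 33 x else m.nat 25 (w * S + x)) ∧
    m'.real 3 (w * S + x) = (if w = u ∧ x < k then m4.real 7 x else m.real 3 (w * S + x))) rfl
    (by intro _ _ _ h; simpa using h)
  · intro m' hf
    simp [hf.nat 14 rfl, hf4.nat 14 rfl, hf1.nat 14 rfl, h14]
  · intro w x _
    simp [e25, e3]
  · intro k m' hk hf h9 hI
    apply Wp.seq
    apply Wp.setNat
    apply Wp.setReal
    intro w x hx
    have f31 : m'.nat 31 0 = u := by rw [hf.nat 31 rfl, hf4.nat 31 rfl, hf1.nat 31 rfl, h31]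
    have f15 : m'.nat 15 u = u * S := by rw [hf.nat 15 rfl, e15]
    have f33 : m'.nat 33 = m4.nat 33 := hf.nat 33 rfl
    have f7 : m'.real 7 = m4.real 7 := hf.real 7 rfl
    by_cases hc : w = u ∧ x = k
    · obtain ⟨rfl, rfl⟩ := hc
      simp [h9, f31, f15, f33, f7]
    · have hne : w * S + x ≠ u * S + k := fun e => hc ((mul_add_inj hx hk).mp e)
      have hiff : (w = u ∧ x < k + 1) ↔ (w = u ∧ x < k) := by
        constructor
        · rintro ⟨h1, h2⟩
          have : x ≠ k := fun e => hc ⟨h1, e⟩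
          exact ⟨h1, by omega⟩
        · rintro ⟨h1, h2⟩
          exact ⟨h1, by omega⟩
      simp only [hiff]
      simpa [h9, f31, f15, hne] using hI w x hx
  · intro m' hf hI
    have f35 : m'.nat 35 = m4.nat 35 := hf.nat 35 rfl
    have f36 : m'.nat 36 = m4.nat 36 := hf.nat 36 rfl
    have hadm : ∀ x < S, (Adm m' S u x ↔ m4.nat 33 x = 1) := by
      intro x hx
      rw [Adm, (hI u x hx).1, if_pos ⟨rfl, hx⟩]
    have hval : ∀ x < S, val m' S u x = m4.real 7 x := by
      intro x hx
      rw [val, (hI u x hx).2, if_pos ⟨rfl, hx⟩]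
    constructor
    · intro w hw x hx
      rw [Adm, (hI w x hx).1, if_neg (fun h => hw h.1), Adm]
    · intro w hw x hx
      rw [val, (hI w x hx).2, if_neg (fun h => hw h.1), val]
    · intro x hx y hy g1 g2 g3 g4
      rw [hadm _ (by omega), hval _ (by omega)]
      exact hI4.complete x hx y hy hx g1 g2 g3 g4
    · intro z hz hz'
      rw [hadm z hz] at hz'
      rw [f35, f36, hval z hz]
      exact hI4.sound z hz hz'
    · rw [f35]
      exact hI4.left_of_ne
    · rw [f36]
      exact hI4.right_of_ne

/-- The dynamic program: merges the tables, starting with the last leaf. -/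
def mergeTables : Program :=
  forLoop 26 (sub (var 0) (const 1))
    (seq (letNat 39 (sub (sub (sub (var 0) (const 1)) (const 1)) (var 26)))
    (seq (letNat 31 (get 30 (var 39)))
    (seq (letNat 32 (get 29 (var 39)))
      combine)))

open WeightedTree

/-- The tables `A s` and `V s` that are obtained by merging the leaves from step `s` on, for
`lo ≤ s`, and the origin of their entries. -/
structure History {n : ℕ} (m : Memory) (S r lo : ℕ) (sv su : ℕ → Fin n)
    (A : ℕ → ℕ → ℕ → Prop) (V : ℕ → ℕ → ℕ → ℝ) : Prop where
  adm_of_ne : ∀ s, lo ≤ s → s < r → ∀ w ≠ (su s : ℕ), ∀ x < S, (A s w x ↔ A (s + 1) w x)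
  val_of_ne : ∀ s, lo ≤ s → s < r → ∀ w ≠ (su s : ℕ), ∀ x < S, V s w x = V (s + 1) w x
  sound : ∀ s, lo ≤ s → s < r → ∀ z < S, A s (su s) z → ∃ x < S, ∃ y < S,
    m.nat 35 (s * S + z) = x ∧ m.nat 36 (s * S + z) = y ∧ A (s + 1) (su s) x ∧
    A (s + 1) (sv s) y ∧ merge (n + 1) x y = z + 1 ∧ V (s + 1) (su s) x ≤ V s (su s) z ∧
    V (s + 1) (sv s) y ≤ V s (su s) z

theorem History.step {n : ℕ} {m m' : Memory} {S r lo : ℕ} {sv su : ℕ → Fin n}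
    {A : ℕ → ℕ → ℕ → Prop} {V : ℕ → ℕ → ℕ → ℝ} (h : History m S r (lo + 1) sv su A V)
    (hA : A (lo + 1) = Adm m S) (hV : V (lo + 1) = val m S)
    (hstep : MergeStep S (n + 1) m m' lo (su lo) (sv lo)) :
    History m' S r lo sv su (Function.update A lo (Adm m' S)) (Function.update V lo (val m' S)) := by
  have h1 : ∀ s, lo ≤ s → Function.update A lo (Adm m' S) (s + 1) = A (s + 1) :=
    fun s hs => Function.update_of_ne (by omega) _ _
  have h2 : ∀ s, lo ≤ s → Function.update V lo (val m' S) (s + 1) = V (s + 1) :=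
    fun s hs => Function.update_of_ne (by omega) _ _
  constructor
  · intro s hs hsr w hw x hx
    rw [h1 s hs]
    by_cases hsl : s = lo
    · subst hsl
      rw [Function.update_self, hA]
      exact hstep.adm_of_ne w hw x hx
    · rw [Function.update_of_ne hsl]
      exact h.adm_of_ne s (by omega) hsr w hw x hx
  · intro s hs hsr w hw x hx
    rw [h2 s hs]
    by_cases hsl : s = lo
    · subst hsl
      rw [Function.update_self, hV]
      exact hstep.val_of_ne w hw x hx
    · rw [Function.update_of_ne hsl]
      exact h.val_of_ne s (by omega) hsr w hw x hx
  · intro s hs hsr z hz hz'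
    rw [h1 s hs, h2 s hs]
    by_cases hsl : s = lo
    · subst hsl
      rw [Function.update_self] at hz' ⊢
      rw [hA, hV]
      exact hstep.sound z hz hz'
    · rw [Function.update_of_ne hsl] at hz' ⊢
      rw [hstep.left_of_ne s hsl z hz, hstep.right_of_ne s hsl z hz]
      exact h.sound s (by omega) hsr z hz hz'

/-- Each balanced assignment of codes leads to an admissible code at each vertex. -/
def Complete {n : ℕ} (T : WeightedTree n) (m m' : Memory) (S K r k : ℕ) (sv su : ℕ → Fin n) :
    Prop :=
  ∀ x : Fin n → ℕ, (∀ v, x v < S) → Growth.Balanced T K Finset.univ x →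
    ∀ η : ℝ, (∀ v : Fin n, Adm m S v (x v) ∧ val m S v (x v) ≤ η) →
    ∀ v : Fin n, Adm m' S v (Growth.mergeState r sv su x k v) ∧
      val m' S v (Growth.mergeState r sv su x k v) ≤ η

/-- Two facts are carried along: balanced codes survive every merge without exceeding their largest
cost, and each surviving entry has stored origins from which it can be unfolded. -/
theorem wp_mergeTables {X S n K : ℕ} {Q : Memory → Prop} {m : Memory} {T : WeightedTree n}
    {root : Fin n} {sv su : ℕ → Fin n} (hX : S ≤ X) (hm : HasTables m n K S) (hnS : n ≤ S)
    (hG : T.Growth root (n - 1) sv su) (h29 : ∀ s < n - 1, m.nat 29 s = sv s)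
    (h30 : ∀ s < n - 1, m.nat 30 s = su s)
    (hQ : ∀ m', Frame mergeTables m m' → Complete T m m' S K (n - 1) (n - 1) sv su →
      (∃ A V, History m' S (n - 1) 0 sv su A V ∧ A (n - 1) = Adm m S ∧ V (n - 1) = val m S ∧
        A 0 = Adm m' S ∧ V 0 = val m' S) → Q m') :
    Wp X mergeTables Q m := by
  have key : Wp X mergeTables (fun m' => Complete T m m' S K (n - 1) (n - 1) sv su ∧
      (∃ A V, History m' S (n - 1) (n - 1 - (n - 1)) sv su A V ∧ A (n - 1) = Adm m S ∧
        V (n - 1) = val m S ∧ A (n - 1 - (n - 1)) = Adm m' S ∧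
        V (n - 1 - (n - 1)) = val m' S)) m := by
    apply Wp.forLoop (n - 1) (by omega) (fun k m' => Complete T m m' S K (n - 1) k sv su ∧
      (∃ A V, History m' S (n - 1) (n - 1 - k) sv su A V ∧ A (n - 1) = Adm m S ∧
        V (n - 1) = val m S ∧ A (n - 1 - k) = Adm m' S ∧ V (n - 1 - k) = val m' S)) rfl
      (by
        rintro k m' j ⟨h1, A, V, ⟨q1, q2, q3⟩, h3, h4, h5, h6⟩
        exact ⟨h1, A, V, ⟨q1, q2, by simpa using q3⟩, h3, h4, h5, h6⟩)
    · intro m' hf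
      simp [hf.nat 0 rfl, hm.size]
    · refine ⟨?_, fun _ => Adm m S, fun _ => val m S, ⟨?_, ?_, ?_⟩, rfl, rfl, rfl, rfl⟩
      · intro x _ _ η hη
        exact hη
      · intro s h1 h2
        omega
      · intro s h1 h2
        omega
      · intro s h1 h2
        omega
    · rintro k m1 hk hf1 h26 ⟨hC, A, V, hH, hA, hV, hA', hV'⟩
      -- The growth steps are numbered up to `n - 2`, and the leaf added last is merged first.
      obtain ⟨s, hs⟩ : ∃ s, n - 1 - 1 - k = s := ⟨_, rfl⟩
      have hsr : s < n - 1 := by omega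
      have hk1 : n - 1 - k = s + 1 := by omega
      have hk2 : n - 1 - (k + 1) = s := by omega
      rw [hk1] at hH hA' hV'
      rw [hk2]
      apply Wp.seq
      apply Wp.setNat
      apply Wp.seq
      apply Wp.setNat
      apply Wp.seq
      apply Wp.setNat
      have e39 : n - 1 - 1 - k = s := hs
      have e0 : m1.nat 0 0 = n := by rw [hf1.nat 0 rfl, hm.size]
      have e29 : m1.nat 29 s = sv s := by rw [hf1.nat 29 rfl, h29 s hsr]
      have e30 : m1.nat 30 s = su s := by rw [hf1.nat 30 rfl, h30 s hsr]
      have husv : (sv s : ℕ) ≠ su s := fun e => hG.ne hsr (Fin.ext e)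
      have h1 := (su s).2
      have h2 := (sv s).2
      set m2 : Memory := ((m1.setNat 39 0 s).setNat 31 0 (su s)).setNat 32 0 (sv s) with hm2
      have hm2' : (((m1.setNat 39 (eval m1 (const 0))
          (eval m1 (sub (sub (sub (var 0) (const 1)) (const 1)) (var 26)))).setNat 31
            (eval (m1.setNat 39 (eval m1 (const 0))
              (eval m1 (sub (sub (sub (var 0) (const 1)) (const 1)) (var 26)))) (const 0))
            (eval (m1.setNat 39 (eval m1 (const 0))
              (eval m1 (sub (sub (sub (var 0) (const 1)) (const 1)) (var 26))))
              (get 30 (var 39)))).setNat 32 0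
            (eval ((m1.setNat 39 (eval m1 (const 0))
              (eval m1 (sub (sub (sub (var 0) (const 1)) (const 1)) (var 26)))).setNat 31
              (eval (m1.setNat 39 (eval m1 (const 0))
                (eval m1 (sub (sub (sub (var 0) (const 1)) (const 1)) (var 26)))) (const 0))
              (eval (m1.setNat 39 (eval m1 (const 0))
                (eval m1 (sub (sub (sub (var 0) (const 1)) (const 1)) (var 26))))
                (get 30 (var 39)))) (get 29 (var 39)))) = m2 := by
        simp [hm2, e0, h26, e39, e29, e30]
      simp only [NatExp.eval] at hm2' ⊢
      rw [hm2']
      have hadm : Adm m2 S = Adm m1 S := by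
        funext w x
        simp [Adm, hm2]
      have hval : val m2 S = val m1 S := by
        funext w x
        simp [val, hm2]
      have hH2 : History m2 S (n - 1) (s + 1) sv su A V := by
        obtain ⟨q1, q2, q3⟩ := hH
        exact ⟨q1, q2, by simpa [hm2] using q3⟩
      have hcomb : Wp X combine (fun m' => MergeStep S (n + 1) m2 m' s (su s) (sv s)) m2 := by
        apply wp_combine hX (by omega) (by omega) (by omega) husv
        · simp [hm2, hf1.nat 14 rfl, hm.codes, hm.codes_eq]
        · simpa [hm2, hf1.nat 15 rfl] using hm.mulCodes
        · simpa [hm2, hf1.nat 22 rfl] using hm.merge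
        · simp [hm2]
        · simp [hm2]
        · simp [hm2]
      apply hcomb.mono
      intro m3 hf3 hstep
      refine ⟨?_, _, _, hH2.step (hA'.trans hadm.symm) (hV'.trans hval.symm) hstep, ?_, ?_, ?_, ?_⟩
      · intro x hx hB η hη
        have hC' := hC x hx hB η hη
        rw [← hadm, ← hval] at hC'
        obtain ⟨hlt, hbal, hmer⟩ := hG.merge_mergeState (by rw [← hm.codes_eq]; exact hx) hB k hk.le
        obtain ⟨hm1, hm2⟩ := hmer hk
        rw [← hm.codes_eq] at hlt hm2
        rw [hs] at hm1 hm2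
        intro v
        simp only [Growth.mergeState, hs]
        by_cases hv : v = su s
        · rw [hv, Function.update_self]
          obtain ⟨g1, g2⟩ := hstep.complete _ (hlt (su s)) _ (hlt (sv s)) (hC' (su s)).1
            (hC' (sv s)).1 hm1 hm2
          exact ⟨g1, g2.trans (max_le (hC' (su s)).2 (hC' (sv s)).2)⟩
        · rw [Function.update_of_ne hv]
          have hv' : (v : ℕ) ≠ su s := fun e => hv (Fin.ext e)
          rw [hstep.adm_of_ne v hv' _ (hlt v), hstep.val_of_ne v hv' _ (hlt v)]
          exact hC' v
      · rw [Function.update_of_ne (by omega), hA]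
      · rw [Function.update_of_ne (by omega), hV]
      · rw [Function.update_self]
      · rw [Function.update_self]
    · intro m' _ h
      exact h
  apply key.mono
  rintro m' hf ⟨h1, h2⟩
  rw [Nat.sub_self] at h2
  exact hQ m' hf h1 h2

end Program

/-! ### Reading off an optimal assignment of codes -/

namespace Program

open NatExp WeightedTree

/-- Finds the cheapest admissible code of the vertex `0`. -/
def argmin : Program :=
  seq (letNat 40 (const 0))
    (forLoop 9 (var 14)
      (branch (Test.both (Test.natEq (get 25 (var 9)) (const 1))
          (Test.neg (Test.both (Test.natEq (var 40) (const 1))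
            (Test.neg (Test.realLt (RealExp.get 3 (var 9)) (RealExp.get 3 (var 37)))))))
        (seq (letNat 40 (const 1)) (letNat 37 (var 9)))
        skip))

/-- The flag `40` tells whether a candidate has been found; it stands in for an initial value of
infinity. -/
theorem wp_argmin {X S z : ℕ} {m : Memory} (hX : S ≤ X) (h14 : m.nat 14 0 = S) (hz : z < S)
    (hzA : Adm m S 0 z) :
    Wp X argmin (fun m' => m'.nat 37 0 < S ∧ Adm m S 0 (m'.nat 37 0) ∧
      ∀ y < S, Adm m S 0 y → val m S 0 (m'.nat 37 0) ≤ val m S 0 y) m := by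
  simp only [Adm, val, Nat.zero_mul, Nat.zero_add] at hzA ⊢
  apply Wp.seq
  apply Wp.setNat
  apply Wp.forLoop S hX (fun k m' =>
    (m'.nat 40 0 = 1 → m'.nat 37 0 < S ∧ m.nat 25 (m'.nat 37 0) = 1) ∧
    ∀ y < k, m.nat 25 y = 1 → m'.nat 40 0 = 1 ∧ m.real 3 (m'.nat 37 0) ≤ m.real 3 y) rfl
    (by intro _ _ _ h; simpa using h)
  · intro m' hf
    simp [hf.nat 14 rfl, h14]
  · simp
  · rintro k m' hk hf h9 ⟨h1, h2⟩
    have e25 : m'.nat 25 = m.nat 25 := hf.nat 25 rfl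
    have e3 : m'.real 3 = m.real 3 := hf.real 3 rfl
    apply Wp.branch
    · intro hb
      simp only [Test.Holds, Test.holds_natEq, var, RealExp.eval, eval, h9, e25, e3, not_and,
        not_not] at hb
      obtain ⟨b1, b2⟩ := hb
      apply Wp.seq
      apply Wp.setNat
      apply Wp.setNat
      refine ⟨fun _ => by simpa [h9] using ⟨hk, b1⟩, ?_⟩
      intro y hy hyA
      refine ⟨by simp, ?_⟩
      simp only [var, eval, Memory.setNat_nat_self, Function.update_self,
        Memory.setNat_nat_of_ne _ (show (9 : ℕ) ≠ 40 by norm_num), h9]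
      rcases Nat.lt_succ_iff_lt_or_eq.mp hy with hy | rfl
      · obtain ⟨g1, g2⟩ := h2 y hy hyA
        exact (b2 g1).le.trans g2
      · exact le_rfl
    · intro hb
      simp only [Test.Holds, Test.holds_natEq, var, RealExp.eval, eval, h9, e25, e3, not_and,
        not_not] at hb
      apply Wp.skip
      refine ⟨h1, ?_⟩
      intro y hy hyA
      rcases Nat.lt_succ_iff_lt_or_eq.mp hy with hy | rfl
      · exact h2 y hy hyA
      · have := hb hyA
        push Not at this
        exact this
  · rintro m' hf ⟨h1, h2⟩
    obtain ⟨g1, g2⟩ := h1 (h2 z hz hzA).1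
    exact ⟨g1, g2, fun y hy hyA => (h2 y hy hyA).2⟩

/-- Finds the codes of all vertices that lead to the cheapest code of the vertex `0`. -/
def reconstruct : Program :=
  seq argmin
  (seq (setNat 38 (const 0) (var 37))
    (forLoop 26 (sub (var 0) (const 1))
      (seq (letNat 34 (get 38 (get 30 (var 26))))
      (seq (setNat 38 (get 30 (var 26)) (get 35 (add (get 15 (var 26)) (var 34))))
        (setNat 38 (get 29 (var 26)) (get 36 (add (get 15 (var 26)) (var 34))))))))

/-- The codes `L j` of the vertices reached before step `j`, for `j ≤ s`. -/
structure Trace {n : ℕ} (root : Fin n) (S s : ℕ) (sv su : ℕ → Fin n)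
    (A : ℕ → ℕ → ℕ → Prop) (V : ℕ → ℕ → ℕ → ℝ) (η : ℝ) (L : ℕ → Fin n → ℕ) : Prop where
  bound : ∀ j ≤ s, ∀ v ∈ reached root sv j, L j v < S ∧ A j v (L j v) ∧ V j v (L j v) ≤ η
  merge_eq : ∀ j < s, merge (n + 1) (L (j + 1) (su j)) (L (j + 1) (sv j)) = L j (su j) + 1
  keep : ∀ j < s, ∀ v ∈ reached root sv j, v ≠ su j → L (j + 1) v = L j v

/-- Undoing the merge of step `s`: the stored origins merge to the current code of `su s`, and
neither costs more than it. -/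
theorem Trace.step {n S r s a b : ℕ} {m : Memory} {T : WeightedTree n} {root : Fin n}
    {sv su : ℕ → Fin n} {A : ℕ → ℕ → ℕ → Prop} {V : ℕ → ℕ → ℕ → ℝ} {η : ℝ} {L : ℕ → Fin n → ℕ}
    (h : Trace root S s sv su A V η L) (hs : s < r) (hG : T.Growth root r sv su)
    (hH : History m S r 0 sv su A V) (ha : m.nat 35 (s * S + L s (su s)) = a)
    (hb : m.nat 36 (s * S + L s (su s)) = b) :
    Trace root S (s + 1) sv su A V η
      (Function.update L (s + 1) (Function.update (Function.update (L s) (su s) a) (sv s) b)) := by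
  have hne := hG.ne hs
  obtain ⟨u1, u2, u3⟩ := h.bound s le_rfl (su s) (hG.mem s hs)
  obtain ⟨a', ha', b', hb', e1, e2, A1, A2, hm, V1, V2⟩ := hH.sound s (Nat.zero_le _) hs _ u1 u2
  obtain rfl : a' = a := e1.symm.trans ha
  obtain rfl : b' = b := e2.symm.trans hb
  constructor
  · intro j hj v hv
    by_cases hjs : j = s + 1
    · subst hjs
      rw [Function.update_self]
      rw [reached_succ, Finset.mem_insert] at hv
      by_cases hvs : v = sv s
      · subst hvs
        rw [Function.update_self]
        exact ⟨hb', A2, V2.trans u3⟩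
      · rw [Function.update_of_ne hvs]
        by_cases hvu : v = su s
        · subst hvu
          rw [Function.update_self]
          exact ⟨ha', A1, V1.trans u3⟩
        · rw [Function.update_of_ne hvu]
          have hvu' : (v : ℕ) ≠ su s := fun e => hvu (Fin.ext e)
          obtain ⟨g1, g2, g3⟩ := h.bound s le_rfl v (hv.resolve_left hvs)
          rw [← hH.adm_of_ne s (Nat.zero_le _) hs v hvu' _ g1,
            ← hH.val_of_ne s (Nat.zero_le _) hs v hvu' _ g1]
          exact ⟨g1, g2, g3⟩
    · rw [Function.update_of_ne hjs]
      exact h.bound j (by omega) v hv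
  · intro j hj
    by_cases hjs : j = s
    · subst hjs
      rw [Function.update_self, Function.update_of_ne (show j ≠ j + 1 by omega),
        Function.update_self, Function.update_of_ne hne.symm, Function.update_self]
      exact hm
    · rw [Function.update_of_ne (by omega), Function.update_of_ne (by omega)]
      exact h.merge_eq j (by omega)
  · intro j hj v hv hvu
    by_cases hjs : j = s
    · subst hjs
      rw [Function.update_self, Function.update_of_ne (show j ≠ j + 1 by omega),
        Function.update_of_ne, Function.update_of_ne hvu]
      rintro rfl
      exact hG.notMem j hs hv
    · rw [Function.update_of_ne (by omega), Function.update_of_ne (by omega)]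
      exact h.keep j (by omega) v hv hvu

/-- The codes unfold in the order of growth, starting from the cheapest entry at the root. Each
unfolding respects the bound by the root entry, and the result is balanced by
`Growth.balanced_of_merge`. -/
theorem wp_reconstruct {X S n K z : ℕ} {Q : Memory → Prop} {m m₀ : Memory} {T : WeightedTree n}
    {root : Fin n} {sv su : ℕ → Fin n} (hX : S ≤ X) (hm : HasTables m n K S) (hnS : n ≤ S)
    (hroot : (root : ℕ) = 0) (hG : T.Growth root (n - 1) sv su) (h29 : ∀ s < n - 1, m.nat 29 s = sv s)
    (h30 : ∀ s < n - 1, m.nat 30 s = su s)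
    (hH : ∃ A V, History m S (n - 1) 0 sv su A V ∧ A (n - 1) = Adm m₀ S ∧ V (n - 1) = val m₀ S ∧
        A 0 = Adm m S ∧ V 0 = val m S)
    (hz : z < S) (hzA : Adm m S 0 z)
    (hQ : ∀ m', Frame reconstruct m m' → ∀ x : Fin n → ℕ, (∀ v : Fin n, m'.nat 38 v = x v) →
      (∀ v : Fin n, x v < S ∧ Adm m₀ S v (x v)) →
      (∀ v : Fin n, ∀ y < S, Adm m S 0 y → val m₀ S v (x v) ≤ val m S 0 y) →
      Growth.Balanced T K Finset.univ x → Q m') :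
    Wp X reconstruct Q m := by
  obtain ⟨A, V, hH, hA, hV, hA0, hV0⟩ := hH
  have key : Wp X reconstruct (fun m' => ∃ L : ℕ → Fin n → ℕ, ∃ η : ℝ,
      (∀ v ∈ reached root sv (n - 1), m'.nat 38 v = L (n - 1) v) ∧
      (∀ y < S, Adm m S 0 y → η ≤ val m S 0 y) ∧ Trace root S (n - 1) sv su A V η L) m := by
    apply Wp.seq
    apply (wp_argmin hX (by rw [hm.codes, hm.codes_eq]) hz hzA).mono
    rintro m1 hf1 ⟨g1, g2, g3⟩
    apply Wp.seq
    apply Wp.setNat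
    apply Wp.forLoop (n - 1) (by omega) (fun k m' => ∃ L : ℕ → Fin n → ℕ, ∃ η : ℝ,
      (∀ v ∈ reached root sv k, m'.nat 38 v = L k v) ∧
      (∀ y < S, Adm m S 0 y → η ≤ val m S 0 y) ∧ Trace root S k sv su A V η L) rfl
      (by intro _ _ _ h; simpa using h)
    · intro m' hf
      simp [hf.nat 0 rfl, hf1.nat 0 rfl, hm.size]
    · refine ⟨fun _ _ => m1.nat 37 0, val m S 0 (m1.nat 37 0), ?_, g3, ?_, ?_, ?_⟩
      · intro v hv
        rw [reached_zero, Finset.mem_singleton] at hv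
        simp [hv, hroot]
      · intro j hj v hv
        obtain rfl : j = 0 := by omega
        rw [reached_zero, Finset.mem_singleton] at hv
        rw [hv, hroot, hA0, hV0]
        exact ⟨g1, g2, le_rfl⟩
      · intro j hj
        omega
      · intro j hj
        omega
    · rintro k m2 hk hf2 h26 ⟨L, η, q1, q2, q3⟩
      have hf : ∀ a, argmin.writesNat a = false → (38 == a) = false → (26 == a) = false →
          (34 == a) = false → m2.nat a = m.nat a := by
        intro a ha h1 h2 h3
        simp only [beq_eq_false_iff_ne] at h1 h2 h3
        rw [hf2.nat a (by simp [forLoop, letNat, writesNat, h1.symm, h2.symm, h3.symm]),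
          Memory.setNat_nat_of_ne _ h1.symm, hf1.nat a ha]
      have e15 : m2.nat 15 k = k * S := by rw [hf 15 rfl rfl rfl rfl, hm.mulCodes k (by omega)]
      have e29 : m2.nat 29 k = sv k := by rw [hf 29 rfl rfl rfl rfl, h29 k hk]
      have e30 : m2.nat 30 k = su k := by rw [hf 30 rfl rfl rfl rfl, h30 k hk]
      have e35 : m2.nat 35 = m.nat 35 := hf 35 rfl rfl rfl rfl
      have e36 : m2.nat 36 = m.nat 36 := hf 36 rfl rfl rfl rfl
      have e38 : m2.nat 38 (su k) = L k (su k) := q1 _ (hG.mem k hk)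
      apply Wp.seq
      apply Wp.setNat
      apply Wp.seq
      apply Wp.setNat
      apply Wp.setNat
      refine ⟨_, η, ?_, q2, q3.step hk hG hH rfl rfl⟩
      intro v hv
      rw [Function.update_self]
      rw [reached_succ, Finset.mem_insert] at hv
      by_cases hvs : v = sv k
      · simp [hvs, h26, e15, e29, e30, e35, e36, e38]
      · have hvs' : (v : ℕ) ≠ sv k := fun e => hvs (Fin.ext e)
        by_cases hvu : v = su k
        · rw [hvu] at hvs hvs' ⊢
          simp [hvs, hvs', h26, e15, e29, e30, e35, e38]
        · have hvu' : (v : ℕ) ≠ su k := fun e => hvu (Fin.ext e)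
          simp [hvs, hvs', hvu, hvu', h26, e29, e30, q1 v (hv.resolve_left hvs)]
    · intro m' _ h
      exact h
  apply key.mono
  rintro m' hf ⟨L, η, q1, q2, q3⟩
  rw [hG.reached_eq] at q1
  refine hQ m' hf (L (n - 1)) (fun v => q1 v (Finset.mem_univ v)) ?_ ?_ ?_
  · intro v
    obtain ⟨h1, h2, -⟩ := q3.bound (n - 1) le_rfl v (by rw [hG.reached_eq]; exact Finset.mem_univ v)
    rw [hA] at h2
    exact ⟨h1, h2⟩
  · intro v y hy hyA
    obtain ⟨-, -, h3⟩ := q3.bound (n - 1) le_rfl v (by rw [hG.reached_eq]; exact Finset.mem_univ v)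
    rw [hV] at h3
    exact h3.trans (q2 y hy hyA)
  · have := hG.balanced_of_merge L (fun s hs v hv => by
      rw [← hm.codes_eq]
      exact (q3.bound s hs v hv).1) q3.merge_eq q3.keep (n - 1) le_rfl
    rwa [hG.reached_eq] at this

end Program

/-! ### From balanced codes to a decision tree -/

namespace WeightedTree

variable {n : ℕ} {T : WeightedTree n}

/-- The decision tree locates all targets in `Z`, with queries in `Z` that respect the capacities of
the boxes. -/
def DecisionTree.Feasible (K : ℕ) (x : Fin n → ℕ) (Z : Finset (Fin n)) (D : T.DecisionTree) : Prop :=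
  ∀ y ∈ Z, D.located y = y ∧ (D.queries y).Nodup ∧
    (∀ q ∈ D.queries y, q ∈ Z ∧ x q < (n + 1) ^ K) ∧
    ∀ i < K, ((D.queries y).map fun q => digit (n + 1) (x q) i).sum ≤ n

theorem sum_map_le_sum {L : List (Fin n)} (hL : L.Nodup) {Z : Finset (Fin n)} (hZ : ∀ q ∈ L, q ∈ Z)
    (f : Fin n → ℕ) : (L.map f).sum ≤ ∑ q ∈ Z, f q := by
  rw [← List.sum_toFinset f hL]
  apply Finset.sum_le_sum_of_subset
  intro q hq
  exact hZ q (List.mem_toFinset.mp hq)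

/-- If all codes in `Z` reach the extra box, each has digit `1` there, and capacity `1` leaves only
one vertex: no query is needed. -/
theorem feasible_answer {K : ℕ} {x : Fin n → ℕ} {Z : Finset (Fin n)} {v : Fin n}
    (hB : Growth.Balanced T K Finset.univ x) (hx : ∀ v, x v < 2 * (n + 1) ^ K) (hZ : T.Gathered Z)
    (hv : v ∈ Z) (hK : ∀ y ∈ Z, (n + 1) ^ K ≤ x y) :
    (DecisionTree.answer v : T.DecisionTree).Feasible K x Z := by
  intro y hy
  have hP : 0 < (n + 1) ^ K := by positivity
  have h1 := hB Z (Finset.subset_univ _) hZ K hK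
  have h2 : ∀ z ∈ Z, digit (n + 1) (x z) K = 1 := by
    intro z hz
    have h3 := hx z
    have h4 := hK z hz
    have : x z / (n + 1) ^ K = 1 := by
      apply Nat.div_eq_of_lt_le <;> omega
    rw [digit, this, Nat.mod_eq_of_lt]
    have := v.pos
    omega
  rw [Finset.sum_congr rfl h2, Finset.sum_const, smul_eq_mul, mul_one] at h1
  simp only [capacity, lt_irrefl, if_false] at h1
  have : v = y := Finset.card_le_one.mp h1 v hv y hy
  simp [DecisionTree.located, DecisionTree.queries, this]

/-- The heart of the converse. Up to the leading position of `x v`, all of `Z` reaches box `i`, so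
balance bounds any duplicate-free list of queries in `Z`. Beyond it, `v` has no load and the bound
is inherited from the subtree. -/
theorem feasible_query {K : ℕ} {x : Fin n → ℕ} {Z : Finset (Fin n)} {v : Fin n}
    {next : T.graph.neighborSet v → T.DecisionTree}
    (hB : Growth.Balanced T K Finset.univ x) (hx : 0 < x v) (hxK : x v < (n + 1) ^ K)
    (hZ : T.Gathered Z) (hv : v ∈ Z)
    (hkey : ∀ y ∈ Z, Nat.log (n + 1) (x v) ≤ Nat.log (n + 1) (x y)) (hpos : ∀ y ∈ Z, 0 < x y)
    (hnext : ∀ y ∈ Z, ∀ h : v ≠ y, ∃ Y ⊆ Z, v ∉ Y ∧ y ∈ Y ∧ (next (T.reply v y h)).Feasible K x Y) :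
    (DecisionTree.query v next).Feasible K x Z := by
  have hn : 1 < n + 1 := by
    have := v.pos
    omega
  have hlow : ∀ L : List (Fin n), L.Nodup → (∀ q ∈ L, q ∈ Z) → ∀ i ≤ Nat.log (n + 1) (x v), i < K →
      (L.map fun q => digit (n + 1) (x q) i).sum ≤ n := by
    intro L hL hLZ i hi hiK
    refine (sum_map_le_sum hL hLZ _).trans ?_
    have := hB Z (Finset.subset_univ _) hZ i (fun y hy =>
      (Nat.le_log_iff_pow_le hn (hpos y hy).ne').mp (hi.trans (hkey y hy)))
    rwa [capacity, if_pos hiK] at this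
  have hhigh : ∀ i, Nat.log (n + 1) (x v) < i → digit (n + 1) (x v) i = 0 := by
    intro i hi
    exact digit_eq_zero_of_lt (Nat.lt_pow_of_log_lt hn hi)
  intro y hy
  by_cases h : v = y
  · subst h
    rw [DecisionTree.queries_query_self]
    refine ⟨by simp [DecisionTree.located], by simp, by simpa using ⟨hv, hxK⟩, ?_⟩
    intro i hi
    have := digit_le_capacity (n := n) (K := K) (x := x v) (by omega) i
    rw [capacity, if_pos hi] at this
    simpa using this
  · obtain ⟨Y, hYZ, hvY, hyY, hF⟩ := hnext y hy h
    obtain ⟨f1, f2, f3, f4⟩ := hF y hyY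
    rw [DecisionTree.queries_query_of_ne h, DecisionTree.located_query_of_ne h]
    have hnd : (v :: (next (T.reply v y h)).queries y).Nodup :=
      List.nodup_cons.mpr ⟨fun hm => hvY (f3 v hm).1, f2⟩
    have hmem : ∀ q ∈ v :: (next (T.reply v y h)).queries y, q ∈ Z ∧ x q < (n + 1) ^ K := by
      intro q hq
      rcases List.mem_cons.mp hq with rfl | hq
      · exact ⟨hv, hxK⟩
      · exact ⟨hYZ (f3 q hq).1, (f3 q hq).2⟩
    refine ⟨f1, hnd, hmem, ?_⟩
    intro i hi
    by_cases hiv : i ≤ Nat.log (n + 1) (x v)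
    · exact hlow _ hnd (fun q hq => (hmem q hq).1) i hiv hi
    · rw [List.map_cons, List.sum_cons, hhigh i (by omega), Nat.zero_add]
      exact f4 i hi

/-- The memories agree on the node number `k`. -/
def AgreeAt (n : ℕ) (m m' : Memory) (k : ℕ) : Prop :=
  m'.nat 2 k = m.nat 2 k ∧ m'.nat 3 k = m.nat 3 k ∧ ∀ u < n, m'.nat 4 (k * n + u) = m.nat 4 (k * n + u)

/-- The node `k` belongs to one of the vertices with a label, or is the default leaf. -/
def Settled (c : Fin n → ℕ) (k : ℕ) : Prop := k = n + 1 ∨ ∃ w : Fin n, k = w + 1 ∧ c w ≠ 0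

/-- The decision trees of the components of the set of vertices with labels `c v ≠ 0`: equal labels
belong to vertices of the same component, and are the numbers of the roots. -/
structure Forest (T : WeightedTree n) (K : ℕ) (x : Fin n → ℕ) (m : Memory) (c : Fin n → ℕ) :
    Prop where
  label : ∀ y, c y ≠ 0 → ∃ w : Fin n, c y = w + 1 ∧ c w ≠ 0
  adj : ∀ a b, T.graph.Adj a b → c a ≠ 0 → c b ≠ 0 → c a = c b
  gathered : ∀ y, c y ≠ 0 → T.Gathered (Finset.univ.filter fun z => c z = c y)
  leaf : m.nat 2 (n + 1) = 0 ∧ m.nat 3 (n + 1) = 0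
  stored : ∀ y, c y ≠ 0 → ∃ D : T.DecisionTree,
    D.Feasible K x (Finset.univ.filter fun z => c z = c y) ∧
    ∀ m', (∀ k, Settled c k → AgreeAt n m m' k) → StoredAt m' D (c y)

open Classical in
/-- The labels after joining `v` with the components of its first `k` possible neighbours. -/
noncomputable def join (T : WeightedTree n) (c : Fin n → ℕ) (v : Fin n) (k : ℕ) (z : Fin n) : ℕ :=
  if z = v ∨ ∃ u : Fin n, (u : ℕ) < k ∧ T.graph.Adj v u ∧ c u ≠ 0 ∧ c z = c u then v + 1 else c z

namespace Forest

variable {K : ℕ} {x : Fin n → ℕ} {m m' : Memory} {c : Fin n → ℕ} {v : Fin n}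

theorem label_ne (h : Forest T K x m c) (hv : c v = 0) (y : Fin n) : c y ≠ v + 1 := by
  intro e
  obtain ⟨w, hw, hw0⟩ := h.label y (by omega)
  have : w = v := Fin.ext (by omega)
  exact hw0 (this ▸ hv)

/-- A component that does not contain `v` lies on one side of `v`, so it contains at most one
neighbour of `v`. -/
theorem eq_of_adj (h : Forest T K x m c) (hv : c v = 0) {u u' : Fin n} (hu : T.graph.Adj v u)
    (hu' : T.graph.Adj v u') (h0 : c u ≠ 0) (e : c u' = c u) : u' = u := by
  have := h.gathered u h0 v (by simp [hv, h0.symm]) u' (by simp [e]) u (by simp)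
  rwa [T.rep_of_adj hu', T.rep_of_adj hu] at this

/-- Components joined earlier contain no further neighbour of `v`, so the label read at `u` is still
the number of the subtree's root. -/
theorem join_label (h : Forest T K x m c) (hv : c v = 0) {u : Fin n} (hu : T.graph.Adj v u)
    (h0 : c u ≠ 0) : T.join c v u u = c u := by
  rw [join, if_neg]
  rintro (e | ⟨u', hlt, hu', h0', e⟩)
  · exact hu.ne e.symm
  · have := h.eq_of_adj hv hu hu' h0 e.symm
    rw [this] at hlt
    exact lt_irrefl _ hlt

/-- Only the node `v + 1` is written, and no tree of the forest uses it while `v` has no label, so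
the stored subtrees stay intact. Since `v` has the lowest leading position so far, it may be queried
first in the joined component. -/
theorem step (h : Forest T K x m c) (hv : c v = 0) (hB : Growth.Balanced T K Finset.univ x)
    (hx : ∀ v, 0 < x v ∧ x v < 2 * (n + 1) ^ K)
    (hkey : ∀ y, c y ≠ 0 → Nat.log (n + 1) (x v) ≤ Nat.log (n + 1) (x y))
    (hother : ∀ k : ℕ, k ≠ v + 1 → AgreeAt n m m' k)
    (h2 : m'.nat 2 (v + 1) = if x v < (n + 1) ^ K then 1 else 0) (h3 : m'.nat 3 (v + 1) = v)
    (h4 : ∀ u, T.graph.Adj v u → m'.nat 4 ((v + 1) * n + u) = if c u = 0 then n + 1 else c u) :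
    Forest T K x m' (T.join c v n) := by
  have hjv : T.join c v n v = v + 1 := by simp [join]
  have hj0 : ∀ z, T.join c v n z ≠ 0 ↔ z = v ∨ c z ≠ 0 := by
    intro z
    unfold join
    split_ifs with hc
    · rcases hc with rfl | ⟨u, -, -, hu, e⟩
      · simp
      · simp [e, hu]
    · push Not at hc
      simp [hc.1]
  have hjmem : ∀ z, T.join c v n z = v + 1 ↔
      z = v ∨ ∃ u, T.graph.Adj v u ∧ c u ≠ 0 ∧ c z = c u := by
    intro z
    unfold join
    split_ifs with hc
    · simpa using hc
    · simpa [h.label_ne hv z] using hc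
  have hjne : ∀ z y, T.join c v n y ≠ v + 1 → T.join c v n y ≠ 0 →
      (T.join c v n z = T.join c v n y ↔ c z = c y) := by
    intro z y hy hy0
    have hyc : T.join c v n y = c y := by
      have := (hjmem y).not.mp hy
      rw [join, if_neg (by simpa using this)]
    have hy' := (hjmem y).not.mp hy
    push Not at hy'
    rw [hyc] at hy0 ⊢
    constructor
    · intro e
      have hz : T.join c v n z ≠ v + 1 := by
        rw [e]
        exact h.label_ne hv y
      have := (hjmem z).not.mp hz
      rw [join, if_neg (by simpa using this)] at e
      exact e
    · intro e
      have hz : T.join c v n z ≠ v + 1 := by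
        rw [Ne, hjmem]
        rintro (rfl | ⟨u, a1, a2, a3⟩)
        · exact hy0 (e ▸ hv)
        · exact hy'.2 u a1 a2 (e ▸ a3)
      have := (hjmem z).not.mp hz
      rw [join, if_neg (by simpa using this), e]
  -- The default leaf `n + 1` differs from all nodes `v + 1`.
  have hset : ∀ k : ℕ, Settled c k → k ≠ v + 1 := by
    rintro k (rfl | ⟨w, rfl, hw⟩) e
    · have := v.2
      omega
    · have : w = v := Fin.ext (by omega)
      exact hw (this ▸ hv)
  have hmono : ∀ k, Settled c k → Settled (T.join c v n) k := by
    rintro k (rfl | ⟨w, rfl, hw⟩)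
    · exact Or.inl rfl
    · exact Or.inr ⟨w, rfl, (hj0 w).mpr (Or.inr hw)⟩
  have hold : ∀ m'', (∀ k, Settled (T.join c v n) k → AgreeAt n m' m'' k) →
      ∀ k, Settled c k → AgreeAt n m m'' k := by
    intro m'' hm k hk
    obtain ⟨a1, a2, a3⟩ := hm k (hmono k hk)
    obtain ⟨b1, b2, b3⟩ := hother k (hset k hk)
    exact ⟨a1.trans b1, a2.trans b2, fun u hu => (a3 u hu).trans (b3 u hu)⟩
  set Z := Finset.univ.filter fun z => T.join c v n z = v + 1 with hZdef
  have hvZ : v ∈ Z := by simp [hZdef, hjv]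
  have hZ : T.Gathered Z := by
    have key : ∀ w ∉ Z, ∀ y ∈ Z, T.rep w y = T.rep w v := by
      intro w hw y hy
      simp only [hZdef, Finset.mem_filter, Finset.mem_univ, true_and] at hw hy
      rw [hjmem] at hw hy
      push Not at hw
      rcases hy with rfl | ⟨u, hu, hu0, e⟩
      · rfl
      · rw [h.gathered u hu0 w (by simpa using hw.2 u hu hu0) y (by simpa using e) u (by simp)]
        refine (T.rep_eq_of_adj hu hw.1 ?_).symm
        rintro rfl
        exact hw.2 w hu hu0 rfl
    intro w hw y hy z hz
    rw [key w hw y hy, key w hw z hz]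
  have hZkey : ∀ y ∈ Z, Nat.log (n + 1) (x v) ≤ Nat.log (n + 1) (x y) := by
    intro y hy
    simp only [hZdef, Finset.mem_filter, Finset.mem_univ, true_and] at hy
    rcases (hj0 y).mp (by omega) with rfl | hy
    · exact le_rfl
    · exact hkey y hy
  constructor
  · intro y hy
    by_cases hyv : T.join c v n y = v + 1
    · exact ⟨v, hyv, by omega⟩
    · have := (hjne y y hyv hy)
      have hyc : T.join c v n y = c y := by
        have := (hjmem y).not.mp hyv
        rw [join, if_neg (by simpa using this)]
      obtain ⟨w, hw, hw0⟩ := h.label y (by omega)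
      exact ⟨w, by omega, (hj0 w).mpr (Or.inr hw0)⟩
  · intro a b hab ha hb
    have hside : ∀ a b, T.graph.Adj a b → T.join c v n b ≠ 0 → T.join c v n a = v + 1 →
        T.join c v n b = v + 1 := by
      intro a b hab hb ha
      rw [hjmem] at ha ⊢
      rcases (hj0 b).mp hb with hb | hb
      · exact Or.inl hb
      · rcases ha with ha | ⟨u, a1, a2, a3⟩
        · exact Or.inr ⟨b, ha ▸ hab, hb, rfl⟩
        · refine Or.inr ⟨u, a1, a2, ?_⟩
          rw [← h.adj a b hab (by omega) hb, a3]
    by_cases hav : T.join c v n a = v + 1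
    · rw [hav, hside a b hab hb hav]
    · by_cases hbv : T.join c v n b = v + 1
      · rw [hbv, hside b a hab.symm ha hbv]
      · rw [hjne a b hbv hb]
        refine h.adj a b hab ?_ ?_
        · exact ((hj0 a).mp ha).resolve_left (fun e => hav (e ▸ hjv))
        · exact ((hj0 b).mp hb).resolve_left (fun e => hbv (e ▸ hjv))
  · intro y hy
    by_cases hyv : T.join c v n y = v + 1
    · rw [hyv]
      exact hZ
    · simp only [hjne _ y hyv hy]
      exact h.gathered y (((hj0 y).mp hy).resolve_left (fun e => hyv (e ▸ hjv)))
  · obtain ⟨a1, a2, -⟩ := hother (n + 1) (hset _ (Or.inl rfl))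
    exact ⟨a1.trans h.leaf.1, a2.trans h.leaf.2⟩
  · intro y hy
    by_cases hyv : T.join c v n y = v + 1
    · rw [hyv]
      have hvset : Settled (T.join c v n) (v + 1) := Or.inr ⟨v, rfl, by omega⟩
      by_cases hK : x v < (n + 1) ^ K
      · have : Inhabited T.DecisionTree := ⟨DecisionTree.answer v⟩
        choose! D hD1 hD2 using h.stored
        -- A neighbour without a label has no candidate of the component on its side, so an
        -- arbitrary answer is allowed there; the default leaf announces `0`.
        refine ⟨DecisionTree.query v fun u => if c u = 0 then DecisionTree.answer ⟨0, v.pos⟩ else D u,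
          ?_, ?_⟩
        · refine feasible_query hB (hx v).1 hK hZ hvZ hZkey (fun y _ => (hx y).1) ?_
          intro z hz hvz
          simp only [Finset.mem_filter, Finset.mem_univ, true_and] at hz
          obtain ⟨u, hu, hu0, e⟩ := ((hjmem z).mp hz).resolve_left hvz.symm
          refine ⟨Finset.univ.filter fun z => c z = c u, ?_, by simp [hv, hu0.symm], by simp [e], ?_⟩
          · intro w hw
            simp only [Finset.mem_filter, Finset.mem_univ, true_and] at hw ⊢
            exact (hjmem w).mpr (Or.inr ⟨u, hu, hu0, hw⟩)
          · have hrep : (T.reply v z hvz : Fin n) = u := by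
              rw [← T.rep_of_ne hvz, h.gathered u hu0 v (by simp [hv, hu0.symm]) z (by simp [e]) u
                (by simp), T.rep_of_adj hu]
            rw [hrep, if_neg hu0]
            exact hD1 u hu0
        · intro m'' hm
          obtain ⟨a1, a2, a3⟩ := hm _ hvset
          refine ⟨by rw [a1, h2, if_pos hK], by rw [a2, h3], ?_⟩
          intro u
          rw [a3 _ u.1.2, h4 _ u.2]
          by_cases hu0 : c u = 0
          · obtain ⟨b1, b2, -⟩ := hold m'' hm (n + 1) (Or.inl rfl)
            simp only [if_pos hu0]
            exact ⟨by rw [b1, h.leaf.1], by rw [b2, h.leaf.2]⟩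
          · simp only [if_neg hu0]
            exact hD2 u hu0 m'' (hold m'' hm)
      -- The code of `v` reaches the extra box, hence so do all codes of the component, none having
      -- a lower leading position.
      · refine ⟨DecisionTree.answer v, feasible_answer hB (fun v => (hx v).2) hZ hvZ ?_, ?_⟩
        · intro y hy
          have hn : 1 < n + 1 := by
            have := v.pos
            omega
          rw [← Nat.le_log_iff_pow_le hn (hx y).1.ne']
          refine le_trans ?_ (hZkey y hy)
          rw [Nat.le_log_iff_pow_le hn (hx v).1.ne']
          omega
        · intro m'' hm
          obtain ⟨a1, a2, -⟩ := hm _ hvset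
          exact ⟨by rw [a1, h2, if_neg hK], by rw [a2, h3]⟩
    · have hyc : T.join c v n y = c y := by
        have := (hjmem y).not.mp hyv
        rw [join, if_neg (by simpa using this)]
      obtain ⟨D, hD1, hD2⟩ := h.stored y (by omega)
      refine ⟨D, ?_, ?_⟩
      · simp only [hjne _ y hyv hy]
        exact hD1
      · intro m'' hm
        rw [hyc]
        exact hD2 m'' (hold m'' hm)

end Forest

end WeightedTree

namespace WeightedTree

variable {n : ℕ} {T : WeightedTree n} {c : Fin n → ℕ} {u v : Fin n}

theorem join_succ_of_not (h : ¬(T.graph.Adj v u ∧ c u ≠ 0)) (z : Fin n) :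
    T.join c v (u + 1) z = T.join c v u z := by
  have : (z = v ∨ ∃ w : Fin n, (w : ℕ) < u + 1 ∧ T.graph.Adj v w ∧ c w ≠ 0 ∧ c z = c w) ↔
      (z = v ∨ ∃ w : Fin n, (w : ℕ) < u ∧ T.graph.Adj v w ∧ c w ≠ 0 ∧ c z = c w) := by
    refine or_congr_right (exists_congr fun w => and_congr_left fun hw => ?_)
    constructor
    · intro hlt
      rcases Nat.lt_succ_iff_lt_or_eq.mp hlt with hlt | e
      · exact hlt
      · obtain rfl : w = u := Fin.ext e
        exact absurd ⟨hw.1, hw.2.1⟩ h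
    · omega
  classical
  unfold join
  exact if_congr this rfl rfl

/-- Relabelling the vertices whose current label is `c u` is enough, because a vertex of that
component carries either `c u` or already `v + 1`. -/
theorem join_succ (hu : T.graph.Adj v u) (h0 : c u ≠ 0) (z : Fin n) :
    T.join c v (u + 1) z = if T.join c v u z = c u then (v : ℕ) + 1 else T.join c v u z := by
  by_cases hz : c z = c u
  · have h1 : T.join c v (u + 1) z = v + 1 := by
      rw [join, if_pos]
      exact Or.inr ⟨u, Nat.lt_succ_self _, hu, h0, hz⟩
    have h2 : T.join c v u z = v + 1 ∨ T.join c v u z = c u := by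
      unfold join
      split_ifs
      · exact Or.inl rfl
      · exact Or.inr hz
    rw [h1]
    split_ifs with hc
    · rfl
    · exact (h2.resolve_right hc).symm
  · have h1 : T.join c v (u + 1) z = T.join c v u z := by
      classical
      unfold join
      refine if_congr (or_congr_right (exists_congr fun w => and_congr_left fun hw => ?_)) rfl rfl
      constructor
      · intro hlt
        rcases Nat.lt_succ_iff_lt_or_eq.mp hlt with hlt | e
        · exact hlt
        · obtain rfl : w = u := Fin.ext e
          exact absurd hw.2.2 hz
      · omega
    have h2 : T.join c v u z = v + 1 ∨ T.join c v u z = c z := by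
      unfold join
      split_ifs
      · exact Or.inl rfl
      · exact Or.inr rfl
    rw [h1]
    split_ifs with hc
    · exact h2.resolve_right fun e => hz (e.symm.trans hc)
    · rfl

end WeightedTree

/-! ### The program that writes the decision tree -/

namespace Program

open NatExp WeightedTree

/-- Queries the vertex `43` before the vertices of the adjacent components of the forest. -/
def joinVertex : Program :=
  seq (setNat 41 (var 43) (add (var 43) (const 1)))
  (seq (setNat 3 (add (var 43) (const 1)) (var 43))
  (seq (branch (Test.natLt (get 38 (var 43)) (var 11))
      (setNat 2 (add (var 43) (const 1)) (const 1)) (setNat 2 (add (var 43) (const 1)) (const 0)))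
    (forLoop 44 (var 0)
      (branch (Test.both (Test.natEq (get 1 (add (get 16 (var 43)) (var 44))) (const 1))
          (Test.natLt (const 0) (get 41 (var 44))))
        (seq (letNat 46 (get 41 (var 44)))
        (seq (setNat 4 (add (get 16 (add (var 43) (const 1))) (var 44)) (var 46))
          (forLoop 45 (var 0)
            (branch (Test.natEq (get 41 (var 45)) (var 46))
              (setNat 41 (var 45) (add (var 43) (const 1))) skip))))
        (setNat 4 (add (get 16 (add (var 43) (const 1))) (var 44)) (add (var 0) (const 1)))))))

/-- Joins the vertices in the order of decreasing codes, and copies the root to the node `0`. -/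
def output : Program :=
  seq (forLoop 42 (add (var 8) (const 1))
    (seq (letNat 47 (sub (var 8) (var 42)))
      (forLoop 43 (var 0)
        (branch (Test.natEq (get 21 (get 38 (var 43))) (var 47)) joinVertex skip))))
  (seq (letNat 46 (get 41 (const 0)))
  (seq (setNat 2 (const 0) (get 2 (var 46)))
  (seq (setNat 3 (const 0) (get 3 (var 46)))
    (forLoop 44 (var 0) (setNat 4 (var 44) (get 4 (add (get 16 (var 46)) (var 44))))))))

theorem wp_joinVertex {X S n K : ℕ} {m : Memory} {T : WeightedTree n} {x c : Fin n → ℕ}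
    {v : Fin n} (hX : S ≤ X) (hnS : n ≤ S) (hm : HasTables m n K S)
    (hadj : ∀ u v : Fin n, m.nat 1 (u * n + v) = 1 ↔ T.graph.Adj u v)
    (h38 : ∀ v : Fin n, m.nat 38 v = x v) (h41 : ∀ v : Fin n, m.nat 41 v = c v)
    (h43 : m.nat 43 0 = v) (hF : Forest T K x m c) (hv : c v = 0)
    (hB : Growth.Balanced T K Finset.univ x) (hx : ∀ v, 0 < x v ∧ x v < S)
    (hkey : ∀ y, c y ≠ 0 → Nat.log (n + 1) (x v) ≤ Nat.log (n + 1) (x y)) :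
    Wp X joinVertex (fun m' => (∀ y : Fin n, m'.nat 41 y = T.join c v n y) ∧
      Forest T K x m' (T.join c v n)) m := by
  have hvn := v.2
  have e16 : m.nat 16 v = v * n := hm.mulSize v (by omega)
  have e16' : m.nat 16 (v + 1) = (v + 1) * n := hm.mulSize (v + 1) (by omega)
  have hj0 : ∀ y, T.join c v 0 y = if y = v then (v : ℕ) + 1 else c y := by
    intro y
    simp [join]
  apply Wp.seq
  apply Wp.setNat
  apply Wp.seq
  apply Wp.setNat
  apply Wp.seq
  have hloop : ∀ m₁ : Memory, (∀ a, a ≠ 2 → a ≠ 3 → a ≠ 41 → m₁.nat a = m.nat a) →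
      (∀ y : Fin n, m₁.nat 41 y = T.join c v 0 y) → (∀ j : ℕ, j ≠ v + 1 → AgreeAt n m m₁ j) →
      (m₁.nat 2 (v + 1) = if x v < (n + 1) ^ K then 1 else 0) → m₁.nat 3 (v + 1) = v →
      Wp X (forLoop 44 (var 0)
      (branch (Test.both (Test.natEq (get 1 (add (get 16 (var 43)) (var 44))) (const 1))
          (Test.natLt (const 0) (get 41 (var 44))))
        (seq (letNat 46 (get 41 (var 44)))
        (seq (setNat 4 (add (get 16 (add (var 43) (const 1))) (var 44)) (var 46))
          (forLoop 45 (var 0)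
            (branch (Test.natEq (get 41 (var 45)) (var 46))
              (setNat 41 (var 45) (add (var 43) (const 1))) skip))))
        (setNat 4 (add (get 16 (add (var 43) (const 1))) (var 44)) (add (var 0) (const 1)))))
        (fun m' => (∀ y : Fin n, m'.nat 41 y = T.join c v n y) ∧
          Forest T K x m' (T.join c v n)) m₁ := by
    intro m₁ hfr hl hag h2 h3
    apply Wp.forLoop n (by omega) (fun k m' => (∀ y : Fin n, m'.nat 41 y = T.join c v k y) ∧
      (∀ j : ℕ, j ≠ v + 1 → AgreeAt n m m' j) ∧
      ∀ u : Fin n, (u : ℕ) < k → T.graph.Adj v u →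
        m'.nat 4 ((v + 1) * n + u) = if c u = 0 then n + 1 else c u) rfl
      (by intro _ _ _ h; simpa [AgreeAt] using h)
    · intro m' hf
      simp [hf.nat 0 rfl, hfr 0, hm.size]
    · exact ⟨hl, hag, fun u hu => absurd hu (Nat.not_lt_zero _)⟩
    · rintro k m2 hk hf h44 ⟨q1, q2, q3⟩
      obtain ⟨u, rfl⟩ : ∃ u : Fin n, (u : ℕ) = k := ⟨⟨k, hk⟩, rfl⟩
      have g : ∀ a, a ≠ 2 → a ≠ 3 → a ≠ 4 → a ≠ 41 → a ≠ 44 → a ≠ 45 → a ≠ 46 →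
          m2.nat a = m.nat a := by
        intro a h2 h3 h4 h41 h44 h45 h46
        rw [hf.nat a (by simp [forLoop, letNat, writesNat, h4, h41, h44, h45, h46]),
          hfr a h2 h3 h41]
      have g43 : m2.nat 43 0 = v := by rw [g 43] <;> first | exact h43 | norm_num
      have g16 : m2.nat 16 = m.nat 16 := by apply g <;> norm_num
      have g1 : m2.nat 1 = m.nat 1 := by apply g <;> norm_num
      have g0 : m2.nat 0 0 = n := by rw [g 0] <;> first | exact hm.size | norm_num
      have hag4 : ∀ b : ℕ, ∀ j : ℕ, j ≠ v + 1 →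
          AgreeAt n m (m2.setNat 4 ((v + 1) * n + u) b) j := by
        intro b j hj
        obtain ⟨p1, p2, p3⟩ := q2 j hj
        refine ⟨by simpa using p1, by simpa using p2, ?_⟩
        intro w hw
        have : j * n + w ≠ (v + 1) * n + u := fun e => hj ((mul_add_inj hw u.2).mp e).1
        simpa [this] using p3 w hw
      apply Wp.branch
      · intro hb
        simp [h44, g43, g16, g1, e16, hadj, q1] at hb
        obtain ⟨b1, b2⟩ := hb
        -- The test reads the current label; it can be positive only if the old one was, since `u ≠
        -- v` and only labelled vertices are relabelled.
        have b3 : c u ≠ 0 := by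
          intro e
          have hne : ¬(u = v ∨ ∃ w : Fin n, (w : ℕ) < u ∧ T.graph.Adj v w ∧ c w ≠ 0 ∧ c u = c w) := by
            rintro (e' | ⟨w, -, -, hw, e'⟩)
            · exact b1.ne e'.symm
            · exact hw (e' ▸ e)
          rw [join, if_neg hne, e] at b2
          exact lt_irrefl _ b2
        have hlab := hF.join_label hv b1 b3
        apply Wp.seq
        apply Wp.setNat
        apply Wp.seq
        apply Wp.setNat
        set m3 := m2.setNat 46 0 (c u) with hm3
        have hm3' : m2.setNat 46 (eval m2 (const 0)) (eval m2 (get 41 (var 44))) = m3 := by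
          simp [hm3, h44, q1, hlab]
        rw [hm3']
        set m4 := m3.setNat 4 ((v + 1) * n + u) (c u) with hm4
        have hm4' : m3.setNat 4 (eval m3 (add (get 16 (add (var 43) (const 1))) (var 44)))
            (eval m3 (var 46)) = m4 := by
          simp [hm4, hm3, g43, g16, h44, e16']
        rw [hm4']
        have r41 : ∀ y : Fin n, m4.nat 41 y = T.join c v u y := by
          intro y
          simpa [hm4, hm3] using q1 y
        apply Wp.forLoop n (by omega) (fun z m' => ∀ y : Fin n, m'.nat 41 y =
          if (y : ℕ) < z ∧ T.join c v u y = c u then (v : ℕ) + 1 else T.join c v u y) rfl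
          (by intro _ _ _ h; simpa using h)
        · intro m' hf'
          simp [hf'.nat 0 rfl, hm4, hm3, g0]
        · simpa using r41
        · rintro k m5 hk hf5 h45 hI
          obtain ⟨w, rfl⟩ : ∃ w : Fin n, (w : ℕ) = k := ⟨⟨k, hk⟩, rfl⟩
          have s43 : m5.nat 43 0 = v := by simp [hf5.nat 43 rfl, hm4, hm3, g43]
          have s46 : m5.nat 46 0 = c u := by simp [hf5.nat 46 rfl, hm4, hm3]
          have s41 : m5.nat 41 w = T.join c v u w := by simpa using hI w
          apply Wp.branch
          · intro hb
            simp only [Test.holds_natEq, var, eval, h45, s46, s41] at hb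
            apply Wp.setNat
            intro y
            simp only [var, eval, h45, s43, Memory.setNat_nat_self]
            by_cases hyw : y = w
            · simp [hyw, hb]
            · have hyw' : (y : ℕ) ≠ w := fun e => hyw (Fin.ext e)
              have : (y : ℕ) < w + 1 ↔ (y : ℕ) < w := by omega
              simpa [hyw', this] using hI y
          · intro hb
            simp only [Test.holds_natEq, var, eval, h45, s46, s41] at hb
            apply Wp.skip
            intro y
            rw [hI y]
            by_cases hyw : y = w
            · simp [hyw, hb]
            · have hyw' : (y : ℕ) ≠ w := fun e => hyw (Fin.ext e)
              have : (y : ℕ) < w + 1 ↔ (y : ℕ) < w := by omega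
              simp [this]
        · rintro m5 hf5 hI
          have s2 : m5.nat 2 = m2.nat 2 := by simp [hf5.nat 2 rfl, hm4, hm3]
          have s3 : m5.nat 3 = m2.nat 3 := by simp [hf5.nat 3 rfl, hm4, hm3]
          have s4 : m5.nat 4 = (m2.setNat 4 ((v + 1) * n + u) (c u)).nat 4 := by
            simp [hf5.nat 4 rfl, hm4, hm3]
          refine ⟨?_, ?_, ?_⟩
          · intro y
            rw [hI y, join_succ b1 b3 y]
            simp
          · intro j hj
            obtain ⟨p1, p2, p3⟩ := hag4 (c u) j hj
            exact ⟨by rw [s2]; simpa using p1, by rw [s3]; simpa using p2, by rw [s4]; exact p3⟩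
          · intro w hw hvw
            rw [s4]
            by_cases hwu : w = u
            · subst hwu
              simp [b3]
            · have hwu' : (w : ℕ) ≠ u := fun e => hwu (Fin.ext e)
              simpa [hwu'] using q3 w (by omega) hvw
      · intro hb
        have hb' : ¬ (T.graph.Adj v u ∧ c u ≠ 0) := by
          rintro ⟨b1, b2⟩
          apply hb
          have := hF.join_label hv b1 b2
          simp [h44, g43, g16, g1, e16, hadj, q1, b1, this, Nat.pos_of_ne_zero b2]
        apply Wp.setNat
        simp only [var, eval, g43, g16, h44, e16', g0]
        refine ⟨?_, hag4 _, ?_⟩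
        · intro y
          rw [join_succ_of_not hb']
          simpa using q1 y
        · intro w hw hvw
          by_cases hwu : w = u
          · subst hwu
            have : c w = 0 := by
              by_contra h0
              exact hb' ⟨hvw, h0⟩
            simp [this]
          · have hwu' : (w : ℕ) ≠ u := fun e => hwu (Fin.ext e)
            simpa [hwu'] using q3 w (by omega) hvw
    · rintro m' hf ⟨q1, q2, q3⟩
      refine ⟨q1, hF.step hv hB (by rw [← hm.codes_eq]; exact hx) hkey q2 ?_ ?_ (fun u => q3 u u.2)⟩
      · rw [hf.nat 2 rfl, h2]
      · rw [hf.nat 3 rfl, h3]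
  have hn := hm.size
  have e38 := h38 v
  have hfin : ∀ b, b = (if x v < (n + 1) ^ K then 1 else 0) → ∀ m₁ : Memory,
      m₁ = ((m.setNat 41 v (v + 1)).setNat 3 (v + 1) v).setNat 2 (v + 1) b →
      (∀ a, a ≠ 2 → a ≠ 3 → a ≠ 41 → m₁.nat a = m.nat a) ∧
      (∀ y : Fin n, m₁.nat 41 y = T.join c v 0 y) ∧ (∀ j : ℕ, j ≠ v + 1 → AgreeAt n m m₁ j) ∧
      (m₁.nat 2 (v + 1) = if x v < (n + 1) ^ K then 1 else 0) ∧ m₁.nat 3 (v + 1) = v := by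
    rintro b rfl m₁ rfl
    refine ⟨?_, ?_, ?_, ?_, ?_⟩
    · intro a h2 h3 h41
      simp [h2, h3, h41]
    · intro y
      rw [hj0]
      by_cases hyv : y = v
      · simp [hyv]
      · have hyv' : (y : ℕ) ≠ v := fun e => hyv (Fin.ext e)
        simp [hyv, hyv', h41]
    · intro j hj
      exact ⟨by simp [hj], by simp [hj], by simp⟩
    · simp
    · simp
  apply Wp.branch
  · intro hb
    simp [h43, e38, hm.power] at hb
    apply Wp.setNat
    obtain ⟨p1, p2, p3, p4, p5⟩ := hfin 1 (by rw [if_pos hb]) _ rfl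
    simpa [h43] using hloop _ p1 p2 p3 p4 p5
  · intro hb
    simp [h43, e38, hm.power] at hb
    apply Wp.setNat
    obtain ⟨p1, p2, p3, p4, p5⟩ := hfin 0 (by rw [if_neg (by omega)]) _ rfl
    simpa [h43] using hloop _ p1 p2 p3 p4 p5

/-- The vertices enter the forest by decreasing leading position, so each new one has the lowest
position in its component. In the end the whole tree is one component. -/
theorem wp_output {X S n K : ℕ} {Q : Memory → Prop} {m : Memory} {T : WeightedTree n}
    {x : Fin n → ℕ} (hX : S ≤ X) (hn : 0 < n) (hnS : n ≤ S) (hKS : K + 1 ≤ S)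
    (hm : HasTables m n K S)
    (hadj : ∀ u v : Fin n, m.nat 1 (u * n + v) = 1 ↔ T.graph.Adj u v)
    (h38 : ∀ v : Fin n, m.nat 38 v = x v) (h41 : ∀ v, m.nat 41 v = 0)
    (h2 : m.nat 2 (n + 1) = 0) (h3 : m.nat 3 (n + 1) = 0)
    (hB : Growth.Balanced T K Finset.univ x) (hx : ∀ v, 0 < x v ∧ x v < S)
    (hQ : ∀ m', ∀ D : T.DecisionTree, StoredAt m' D 0 → D.Feasible K x Finset.univ → Q m') :
    Wp X output Q m := by
  have hlog : ∀ v, Nat.log (n + 1) (x v) ≤ K := by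
    intro v
    have h1 := (hx v).2
    rw [hm.codes_eq] at h1
    have : x v < (n + 1) ^ (K + 1) := by
      refine h1.trans_le ?_
      rw [pow_succ']
      exact Nat.mul_le_mul_right _ (by omega)
    exact Nat.lt_succ_iff.mp (Nat.log_lt_of_lt_pow (hx v).1.ne' this)
  apply Wp.seq
  -- After `k` rounds, the labelled vertices are those whose leading position exceeds `K - k`; no
  -- leading position exceeds `K`.
  apply Wp.forLoop (K + 1) (by omega) (fun k m' => ∃ c : Fin n → ℕ,
    (∀ v : Fin n, m'.nat 41 v = c v) ∧ Forest T K x m' c ∧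
    ∀ v, c v ≠ 0 ↔ K < Nat.log (n + 1) (x v) + k) rfl
    (by
      rintro k m' j ⟨c, g1, ⟨q1, q2, q3, q4, q5⟩, g3⟩
      exact ⟨c, by simpa using g1, ⟨q1, q2, q3, by simpa using q4,
        by simpa [AgreeAt] using q5⟩, g3⟩)
  · intro m' hf
    simp [hf.nat 8 rfl, hm.boxes]
  · refine ⟨fun _ => 0, fun v => h41 v, ⟨?_, ?_, ?_, ⟨h2, h3⟩, ?_⟩, ?_⟩
    · intro y hy
      exact absurd rfl hy
    · intro a b _ ha
      exact absurd rfl ha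
    · intro y hy
      exact absurd rfl hy
    · intro y hy
      exact absurd rfl hy
    · intro v
      have := hlog v
      simpa using this
  · rintro k m1 hk hf1 h42 ⟨c, g1, g2, g3⟩
    apply Wp.seq
    apply Wp.setNat
    have e8 : m1.nat 8 0 = K := by rw [hf1.nat 8 rfl, hm.boxes]
    have hm2 : m1.setNat 47 (eval m1 (const 0)) (eval m1 (sub (var 8) (var 42))) =
        m1.setNat 47 0 (K - k) := by simp [e8, h42]
    rw [hm2]
    apply Wp.forLoop n (by omega) (fun j m' => ∃ c : Fin n → ℕ,
      (∀ v : Fin n, m'.nat 41 v = c v) ∧ Forest T K x m' c ∧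
      ∀ v : Fin n, c v ≠ 0 ↔ K < Nat.log (n + 1) (x v) + k ∨
        K = Nat.log (n + 1) (x v) + k ∧ (v : ℕ) < j) rfl
      (by
        rintro k m' j ⟨c, g1, ⟨q1, q2, q3, q4, q5⟩, g3⟩
        exact ⟨c, by simpa using g1, ⟨q1, q2, q3, by simpa using q4,
          by simpa [AgreeAt] using q5⟩, g3⟩)
    · intro m' hf
      simp [hf.nat 0 rfl, hf1.nat 0 rfl, hm.size]
    · obtain ⟨q1, q2, q3, q4, q5⟩ := g2
      refine ⟨c, by simpa using g1, ⟨q1, q2, q3, by simpa using q4, by simpa [AgreeAt] using q5⟩, ?_⟩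
      simpa using g3
    · rintro j m3 hj hf3 h43 ⟨c, g1, g2, g3⟩
      obtain ⟨v, rfl⟩ : ∃ v : Fin n, (v : ℕ) = j := ⟨⟨j, hj⟩, rfl⟩
      have e : ∀ a, Program.output.writesNat a = false → m3.nat a = m.nat a := by
        intro a ha
        simp only [Program.output, joinVertex, forLoop, letNat, writesNat, Bool.or_eq_false_iff,
          beq_eq_false_iff_ne] at ha
        rw [hf3.nat a (by simp [forLoop, letNat, writesNat, joinVertex, ha]),
          Memory.setNat_nat_of_ne _ ha.1.2.1.1,
          hf1.nat a (by simp [forLoop, letNat, writesNat, joinVertex, ha])]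
      have hm3 : HasTables m3 n K S := hm.frame (e 0 rfl) (e 8 rfl) (e 10 rfl) (e 11 rfl) (e 14 rfl)
        (e 15 rfl) (e 16 rfl) (e 20 rfl) (e 21 rfl) (e 22 rfl)
      have e38 : ∀ v : Fin n, m3.nat 38 v = x v := by
        intro v
        rw [e 38 rfl, h38]
      have e47 : m3.nat 47 0 = K - k := by simp [hf3.nat 47 rfl]
      have hlogv := hm3.log _ (hx v).2
      apply Wp.branch
      · intro hb
        simp only [Test.holds_natEq, var, eval, h43, e38, hlogv, e47] at hb
        have hcv : c v = 0 := by
          by_contra h0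
          have := (g3 v).mp h0
          omega
        apply (wp_joinVertex hX hnS hm3 (by rw [e 1 rfl]; exact hadj) e38 g1 h43 g2 hcv hB hx
          (fun y hy => by
            have := (g3 y).mp hy
            omega)).mono
        rintro m4 - ⟨r1, r2⟩
        refine ⟨_, r1, r2, ?_⟩
        intro y
        have hy : T.join c v n y ≠ 0 ↔ y = v ∨ c y ≠ 0 := by
          unfold WeightedTree.join
          split_ifs with hc
          · rcases hc with rfl | ⟨u, -, -, hu, e⟩
            · simp
            · simp [e, hu]
          · push Not at hc
            simp [hc.1]
        rw [hy, g3 y]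
        by_cases hyv : y = v
        · subst hyv
          simp
          omega
        · have hyv' : (y : ℕ) ≠ v := fun e => hyv (Fin.ext e)
          simp only [hyv, false_or]
          omega
      · intro hb
        simp only [Test.holds_natEq, var, eval, h43, e38, hlogv, e47] at hb
        apply Wp.skip
        refine ⟨c, g1, g2, ?_⟩
        intro y
        rw [g3 y]
        by_cases hyv : y = v
        · subst hyv
          omega
        · have hyv' : (y : ℕ) ≠ v := fun e => hyv (Fin.ext e)
          omega
    · rintro m3 - ⟨c, g1, g2, g3⟩
      refine ⟨c, g1, g2, ?_⟩
      intro v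
      rw [g3 v]
      have := v.2
      omega
  rintro m1 hf1 ⟨c, g1, g2, g3⟩
  have hc0 : ∀ v, c v ≠ 0 := fun v => (g3 v).mpr (by omega)
  have hc : ∀ v, c v = c ⟨0, hn⟩ := by
    intro v
    have key : ∀ {u v : Fin n}, T.graph.Walk u v → c u = c v := by
      intro u v p
      induction p with
      | nil => rfl
      | cons hadj _ ih => exact (g2.adj _ _ hadj (hc0 _) (hc0 _)).trans ih
    obtain ⟨p⟩ := T.isTree.connected.preconnected v ⟨0, hn⟩
    exact key p
  obtain ⟨D, hD1, hD2⟩ := g2.stored ⟨0, hn⟩ (hc0 _)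
  rw [Finset.filter_true_of_mem (fun v _ => hc v)] at hD1
  obtain ⟨w, hw, -⟩ := g2.label ⟨0, hn⟩ (hc0 _)
  set l := c ⟨0, hn⟩ with hl
  have hl0 : l ≠ 0 := hc0 _
  have hwn := w.2
  have e16 : m1.nat 16 l = l * n := by
    rw [hf1.nat 16 rfl]
    exact hm.mulSize l (by omega)
  have e41 : m1.nat 41 0 = l := g1 ⟨0, hn⟩
  apply Wp.seq
  apply Wp.setNat
  apply Wp.seq
  apply Wp.setNat
  apply Wp.seq
  apply Wp.setNat
  apply Wp.forLoop n (by omega) (fun k m' => m'.nat 2 0 = m1.nat 2 l ∧ m'.nat 3 0 = m1.nat 3 l ∧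
    (∀ u < k, m'.nat 4 u = m1.nat 4 (l * n + u)) ∧ ∀ j ≠ 0, AgreeAt n m1 m' j) rfl
    (by intro _ _ _ h; simpa [AgreeAt] using h)
  · intro m' hf
    simp [hf.nat 0 rfl, hf1.nat 0 rfl, hm.size]
  · refine ⟨by simp [e41], by simp [e41], by simp, ?_⟩
    intro j hj
    exact ⟨by simp [hj], by simp [hj], by simp⟩
  · rintro k m2 hk hf2 h44 ⟨q1, q2, q3, q4⟩
    have e46 : m2.nat 46 0 = l := by simp [hf2.nat 46 rfl, e41]
    have e16' : m2.nat 16 l = l * n := by simp [hf2.nat 16 rfl, e16]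
    apply Wp.setNat
    -- Node `0` was reserved for the copy of the root: its successors occupy the first `n` entries,
    -- and those of any other node come later.
    have hbig : ∀ j ≠ 0, ∀ u < n, j * n + u ≠ k := by
      intro j hj u hu h
      have : 1 * n ≤ j * n := Nat.mul_le_mul_right _ (by omega)
      omega
    refine ⟨by simpa using q1, by simpa using q2, ?_, ?_⟩
    · intro u hu
      by_cases huk : u = k
      · subst huk
        simp [h44, e46, e16', (q4 l hl0).2.2 u hk]
      · simpa [h44, huk] using q3 u (by omega)
    · intro j hj
      obtain ⟨p1, p2, p3⟩ := q4 j hj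
      refine ⟨by simpa using p1, by simpa using p2, ?_⟩
      intro u hu
      simpa [h44, hbig j hj u hu] using p3 u hu
  · rintro m2 - ⟨q1, q2, q3, q4⟩
    have hst : StoredAt m2 D l := hD2 m2 (by
      rintro k (rfl | ⟨w, rfl, -⟩)
      · exact q4 _ (by omega)
      · exact q4 _ (by omega))
    obtain ⟨p1, p2, p3⟩ := q4 l hl0
    refine hQ m2 D ?_ hD1
    cases D with
    | answer v => exact ⟨by rw [q1, ← p1]; exact hst.1, by rw [q2, ← p2]; exact hst.2⟩
    | query v next =>
      obtain ⟨s1, s2, s3⟩ := hst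
      refine ⟨by rw [q1, ← p1]; exact s1, by rw [q2, ← p2]; exact s2, ?_⟩
      intro u
      have hu := u.1.2
      rw [Nat.zero_mul, Nat.zero_add, q3 _ hu, ← p3 _ hu]
      exact s3 u

end Program

/-! ### The cost of the resulting strategy -/

namespace WeightedTree

variable {n : ℕ} {T : WeightedTree n}

/-- Linear search: queries the vertices in the given order. -/
def DecisionTree.linear (v₀ : Fin n) : List (Fin n) → T.DecisionTree
  | [] => answer v₀
  | v :: L => query v fun _ => linear v₀ L

theorem DecisionTree.located_linear {v₀ x : Fin n} {L : List (Fin n)} (h : x ∈ L) :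
    (linear v₀ L : T.DecisionTree).located x = x := by
  induction L with
  | nil => simp at h
  | cons v L ih =>
    by_cases hv : v = x
    · simp [linear, located, hv]
    · rw [linear, located_query_of_ne hv]
      exact ih ((List.mem_cons.mp h).resolve_left (Ne.symm hv))

theorem exists_isStrategy (T : WeightedTree n) : ∃ S : T.DecisionTree, S.IsStrategy := by
  obtain ⟨v₀⟩ := T.isTree.connected.nonempty
  exact ⟨DecisionTree.linear v₀ (List.finRange n),
    fun x => DecisionTree.located_linear (List.mem_finRange x)⟩

theorem DecisionTree.Feasible.isStrategy {K : ℕ} {x : Fin n → ℕ} {D : T.DecisionTree}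
    (h : D.Feasible K x Finset.univ) : D.IsStrategy :=
  fun y => (h y (Finset.mem_univ y)).1

/-- Each queried vertex is paid for by its units, and a search path uses at most `n` units in each
of the `K` boxes. -/
theorem DecisionTree.Feasible.cost_le {K : ℕ} {x : Fin n → ℕ} {D : T.DecisionTree}
    (h : D.Feasible K x Finset.univ) {η : ℝ} (hη : 0 ≤ η)
    (hw : ∀ v, x v < (n + 1) ^ K → T.weight v ≤ η * digitSum (n + 1) (x v)) :
    D.cost ≤ η * (n * K) := by
  have := T.isTree.connected.nonempty
  refine ciSup_le fun y => ?_
  obtain ⟨-, h2, h3, h4⟩ := h y (Finset.mem_univ y)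
  have hn : 1 < n + 1 := by
    have := y.pos
    omega
  rw [costAt, ← List.sum_toFinset _ h2]
  have h5 : ∀ q ∈ (D.queries y).toFinset,
      T.weight q ≤ η * ((∑ i ∈ Finset.range K, digit (n + 1) (x q) i : ℕ) : ℝ) := by
    intro q hq
    have := (h3 q (List.mem_toFinset.mp hq)).2
    rw [← digitSum_eq_sum hn K _ this]
    exact hw q this
  refine (Finset.sum_le_sum h5).trans ?_
  rw [← Finset.mul_sum]
  refine mul_le_mul_of_nonneg_left ?_ hη
  rw [← Nat.cast_sum, Finset.sum_comm]
  have h6 : ∑ i ∈ Finset.range K, ∑ q ∈ (D.queries y).toFinset, digit (n + 1) (x q) i ≤ K * n := by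
    refine (Finset.sum_le_card_nsmul _ _ n fun i hi => ?_).trans ?_
    · rw [List.sum_toFinset _ h2]
      exact h4 i (Finset.mem_range.mp hi)
    · simp
  calc ((∑ i ∈ Finset.range K, ∑ q ∈ (D.queries y).toFinset, digit (n + 1) (x q) i : ℕ) : ℝ)
      ≤ ((K * n : ℕ) : ℝ) := by exact_mod_cast h6
    _ = n * K := by
      push_cast
      ring

/-- The common factor `cofactor S 0` cancels. A code that reaches the extra box costs nothing,
because its vertex is never queried. -/
theorem unitCost_le_iff {K S : ℕ} {v : Fin n} {x : ℕ} {η : ℝ} (hη : 0 ≤ η) (hx : 0 < x)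
    (hxS : x < S) : T.unitCost K S v x ≤ η * cofactor S 0 ↔
      (x < (n + 1) ^ K → T.weight v ≤ η * digitSum (n + 1) x) := by
  have hn : 1 < n + 1 := by
    have := v.pos
    omega
  unfold unitCost
  split_ifs with h
  · rw [← cofactor_mul (digitSum_pos hn hx) ((digitSum_le x).trans_lt hxS), mul_left_comm,
      mul_comm (T.weight v), mul_le_mul_iff_right₀ (cofactor_pos _ _)]
    simp [h]
  · simp only [h, false_imp_iff, iff_true]
    exact mul_nonneg hη (cofactor_pos _ _).le

end WeightedTree

/-! ### Approximation ratio, running time and the final program -/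

namespace Program

open NatExp WeightedTree

/-- The approximation scheme, for at least two vertices. -/
def scheme : Program :=
  seq parameters (seq tables (seq baseCosts (seq growthOrder (seq mergeTables
    (seq reconstruct output)))))

/-- With `K = N * G` and `N ≥ 2 / ε`, the difference `K - G` is at least `K * (1 - ε / 2)`, and `(1
+ ε) * (1 - ε / 2) ≥ 1` because `ε ≤ 1`. -/
theorem mul_boxCount_le {n : ℕ} {ε : ℝ} (hε : 0 < ε) (hε1 : ε < 1) :
    (boxCount n ε : ℝ) ≤ (1 + ε) * ((boxCount n ε : ℝ) - (Nat.clog 2 n + 1 : ℕ)) := by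
  have hN : 2 ≤ ε * (⌈2 / ε⌉₊ : ℝ) := by
    have := Nat.le_ceil (2 / ε)
    rwa [div_le_iff₀' hε] at this
  simp only [boxCount, Nat.cast_mul]
  have hG : (0 : ℝ) ≤ (Nat.clog 2 n + 1 : ℕ) := Nat.cast_nonneg _
  nlinarith

/-- The output is compared with every strategy `D'` separately, through the unit `η` that makes the
cost of `D'` fit. The slack `δ` keeps `η` positive when `D'` costs nothing. -/
theorem wp_scheme {n S : ℕ} {T : WeightedTree n} {ε : ℝ} (hε : 0 < ε) (hε1 : ε < 1)
    (hS : S = 2 * (n + 1) ^ boxCount n ε) :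
    Wp S scheme (fun m' => ∃ D : T.DecisionTree, StoredAt m' D 0 ∧ D.IsStrategy ∧
      ∀ D' : T.DecisionTree, D'.IsStrategy → ∀ δ > 0, D.cost ≤ (1 + ε) * (D'.cost + δ))
      (input T ε) := by
  classical
  have hn : 0 < n := by
    obtain ⟨v⟩ := T.isTree.connected.nonempty
    exact v.pos
  obtain ⟨K, hK⟩ : ∃ K, boxCount n ε = K := ⟨_, rfl⟩
  obtain ⟨G, hG⟩ : ∃ G, Nat.clog 2 n + 1 = G := ⟨_, rfl⟩
  have hapx := mul_boxCount_le (n := n) hε hε1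
  have hp := wp_parameters (X := S) (m := input T ε) hε hn hS.ge (by simp [input])
    (by simp [input]) (by simp [input]) (by simp [input]) (by simp [input])
  rw [hK] at hS hp hapx
  rw [hG] at hapx
  have hKpos : 0 < K := by
    rw [← hK]
    exact Nat.mul_pos (Nat.ceil_pos.mpr (by positivity)) (Nat.succ_pos _)
  have hKG : (0 : ℝ) < (K : ℝ) - G := by
    have : (0 : ℝ) < K := by exact_mod_cast hKpos
    by_contra hcon
    nlinarith
  have hKS : K + 1 ≤ S := by
    have : K < (n + 1) ^ K := Nat.lt_pow_self (by omega)
    omega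
  have hnS : n ≤ S := by
    have : (n + 1) ^ 1 ≤ (n + 1) ^ K := Nat.pow_le_pow_right (by omega) hKpos
    rw [pow_one] at this
    omega
  have hGlog : Nat.log 2 n + 1 ≤ G := by
    rw [← hG]
    exact Nat.succ_le_succ (Nat.log_le_clog 2 n)
  have hadj : ∀ u v : Fin n, (input T ε).nat 1 (u * n + v) = 1 ↔ T.graph.Adj u v := by
    intro u v
    have : (∃ i j : Fin n, T.graph.Adj i j ∧ (u : ℕ) * n + v = i * n + j) ↔ T.graph.Adj u v := by
      constructor
      · rintro ⟨i, j, hij, e⟩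
        obtain ⟨e1, e2⟩ := (mul_add_inj v.2 j.2).mp e
        rwa [Fin.ext e1, Fin.ext e2]
      · exact fun h => ⟨u, v, h, rfl⟩
    simp [input, this]
  apply Wp.seq
  apply hp.mono
  intro m1 f1 hp1
  apply Wp.seq
  apply (wp_tables hn le_rfl hS hp1).mono
  intro m2 f2 ht2
  apply Wp.seq
  apply wp_baseCosts (T := T) le_rfl ht2 hnS
  · intro v
    rw [f2.real 0 rfl, f1.real 0 rfl]
    simp [input]
  intro m3 f3 hA hV
  have ht3 : HasTables m3 n K S := ht2.frame (f3.nat 0 rfl) (f3.nat 8 rfl) (f3.nat 10 rfl)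
    (f3.nat 11 rfl) (f3.nat 14 rfl) (f3.nat 15 rfl) (f3.nat 16 rfl) (f3.nat 20 rfl) (f3.nat 21 rfl)
    (f3.nat 22 rfl)
  apply Wp.seq
  apply wp_growthOrder (T := T) ⟨0, hn⟩ rfl le_rfl ht3 hnS
  · rw [f3.nat 1 rfl, f2.nat 1 rfl, f1.nat 1 rfl]
    exact hadj
  intro m4 f4 sv su hgr h29 h30
  have ht4 : HasTables m4 n K S := ht3.frame (f4.nat 0 rfl) (f4.nat 8 rfl) (f4.nat 10 rfl)
    (f4.nat 11 rfl) (f4.nat 14 rfl) (f4.nat 15 rfl) (f4.nat 16 rfl) (f4.nat 20 rfl) (f4.nat 21 rfl)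
    (f4.nat 22 rfl)
  apply Wp.seq
  apply wp_mergeTables le_rfl ht4 hnS hgr h29 h30
  intro m5 f5 hcomp hhist
  have ht5 : HasTables m5 n K S := ht4.frame (f5.nat 0 rfl) (f5.nat 8 rfl) (f5.nat 10 rfl)
    (f5.nat 11 rfl) (f5.nat 14 rfl) (f5.nat 15 rfl) (f5.nat 16 rfl) (f5.nat 20 rfl) (f5.nat 21 rfl)
    (f5.nat 22 rfl)
  have hadm : ∀ v : Fin n, ∀ x < S, (Adm m4 S v x ↔ 0 < x) := by
    intro v x hx
    rw [Adm, f4.nat 25 rfl, hA v x hx]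
    split_ifs with h <;> simp <;> omega
  have hval : ∀ v : Fin n, ∀ x < S, 0 < x → val m4 S v x = T.unitCost K S v x := by
    intro v x hx h0
    rw [val, f4.real 3 rfl, hV v x hx h0.ne']
  -- Every strategy yields a root entry of cost at most its `η`, up to the common factor; the chosen
  -- codes are at least as cheap.
  have hopt : ∀ η > 0, ∀ D : T.DecisionTree, D.IsStrategy → D.cost ≤ η * n * ((K : ℝ) - G) →
      ∃ z < S, Adm m5 S 0 z ∧ val m5 S 0 z ≤ η * cofactor S 0 := by
    intro η hη D hD hc
    obtain ⟨x, hx, hB, hw⟩ := exists_balanced hGlog hη D hD hn hc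
    rw [← hS] at hx
    have := hcomp x (fun v => (hx v).2) hB (η * cofactor S 0) (fun v =>
      ⟨(hadm v _ (hx v).2).mpr (hx v).1, by
        rw [hval v _ (hx v).2 (hx v).1, unitCost_le_iff hη.le (hx v).1 (hx v).2]
        exact hw v⟩) ⟨0, hn⟩
    refine ⟨_, ?_, this⟩
    rw [hS] at hx ⊢
    exact (hgr.merge_mergeState (fun v => (hx v).2) hB (n - 1) le_rfl).1 _
  -- The unit is chosen so that `c + δ` fills exactly `K - G` boxes; all `K` boxes then cost at most
  -- `1 + ε` times as much.
  have hscale : ∀ c ≥ 0, ∀ δ > 0, ∃ η > 0, c ≤ η * n * ((K : ℝ) - G) ∧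
      η * (n * K) ≤ (1 + ε) * (c + δ) := by
    intro c hc δ hδ
    have hn' : (0 : ℝ) < n := by exact_mod_cast hn
    have e : (c + δ) / (n * (K - G)) * n * (K - G) = c + δ := by
      field_simp
    refine ⟨(c + δ) / (n * (K - G)), by positivity, by linarith, ?_⟩
    calc (c + δ) / (n * (K - G)) * (n * K)
        ≤ (c + δ) / (n * (K - G)) * (n * ((1 + ε) * (K - G))) := by gcongr
      _ = (1 + ε) * ((c + δ) / (n * (K - G)) * n * (K - G)) := by ring
      _ = (1 + ε) * (c + δ) := by rw [e]
  obtain ⟨D₀, hD₀⟩ := T.exists_isStrategy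
  -- The search for a minimum needs at least one admissible entry, which linear search provides.
  obtain ⟨z, hzS, hz, -⟩ : ∃ z < S, Adm m5 S 0 z ∧ True := by
    obtain ⟨η, hη, h1, -⟩ := hscale D₀.cost D₀.cost_nonneg 1 one_pos
    obtain ⟨z, h2, h3, -⟩ := hopt η hη D₀ hD₀ h1
    exact ⟨z, h2, h3, trivial⟩
  apply Wp.seq
  apply wp_reconstruct le_rfl ht5 hnS rfl hgr (by rwa [f5.nat 29 rfl]) (by rwa [f5.nat 30 rfl])
    hhist hzS hz
  intro m6 f6 x h38 hxA hxV hB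
  have ht6 : HasTables m6 n K S := ht5.frame (f6.nat 0 rfl) (f6.nat 8 rfl) (f6.nat 10 rfl)
    (f6.nat 11 rfl) (f6.nat 14 rfl) (f6.nat 15 rfl) (f6.nat 16 rfl) (f6.nat 20 rfl) (f6.nat 21 rfl)
    (f6.nat 22 rfl)
  have hx : ∀ v, 0 < x v ∧ x v < S := fun v =>
    ⟨(hadm v _ (hxA v).1).mp (hxA v).2, (hxA v).1⟩
  apply wp_output (T := T) le_rfl hn hnS hKS ht6 _ h38 _ _ _ hB hx
  · intro m7 D hst hF
    refine ⟨D, hst, hF.isStrategy, ?_⟩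
    intro D' hD' δ hδ
    obtain ⟨η, hη, h1, h2⟩ := hscale D'.cost D'.cost_nonneg δ hδ
    refine (hF.cost_le hη.le fun v => ?_).trans h2
    obtain ⟨z, h3, h4, h5⟩ := hopt η hη D' hD' h1
    rw [← unitCost_le_iff (S := S) hη.le (hx v).1 (hx v).2, ← hval v _ (hx v).2 (hx v).1]
    exact (hxV v z h3 h4).trans h5
  · rw [f6.nat 1 rfl, f5.nat 1 rfl, f4.nat 1 rfl, f3.nat 1 rfl, f2.nat 1 rfl, f1.nat 1 rfl]
    exact hadj
  · intro v
    rw [f6.nat 41 rfl, f5.nat 41 rfl, f4.nat 41 rfl, f3.nat 41 rfl, f2.nat 41 rfl, f1.nat 41 rfl]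
    simp [input]
  · rw [f6.nat 2 rfl, f5.nat 2 rfl, f4.nat 2 rfl, f3.nat 2 rfl, f2.nat 2 rfl, f1.nat 2 rfl]
    simp [input]
  · rw [f6.nat 3 rfl, f5.nat 3 rfl, f4.nat 3 rfl, f3.nat 3 rfl, f2.nat 3 rfl, f1.nat 3 rfl]
    simp [input]

/-- Here `3 / ε` comes from `2 / ε + 1`, and `5 * Real.log n` from `Nat.clog 2 n + 1 ≤ Real.log n /
Real.log 2 + 2`. The number of boxes is thus of order `Real.log n / ε`, and the square of `ε` is
only a weakening. -/
theorem boxCount_le {n : ℕ} (hn : 2 ≤ n) {ε : ℝ} (hε : 0 < ε) (hε1 : ε < 1) :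
    1 + 2 * (boxCount n ε : ℝ) ≤ 32 * Real.log n / ε ^ 2 := by
  have hlog2 := Real.log_two_gt_d9
  have hlog : Real.log 2 ≤ Real.log n := Real.log_le_log (by norm_num) (by exact_mod_cast hn)
  have h1 : (⌈2 / ε⌉₊ : ℝ) ≤ 3 / ε := by
    have h2 := (Nat.ceil_lt_add_one (show 0 ≤ 2 / ε by positivity)).le
    have h3 : 1 ≤ 1 / ε := by
      rw [le_div_iff₀ hε]
      linarith
    calc (⌈2 / ε⌉₊ : ℝ) ≤ 2 / ε + 1 := h2
      _ ≤ 2 / ε + 1 / ε := by linarith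
      _ = 3 / ε := by ring
  have h2 : ((Nat.clog 2 n + 1 : ℕ) : ℝ) ≤ 5 * Real.log n := by
    have h3 := Nat.pow_pred_clog_lt_self (b := 2) (by norm_num) (show 1 < n by omega)
    have h4 : 0 < Nat.clog 2 n := Nat.clog_pos (by norm_num) hn
    obtain ⟨j, hj⟩ : ∃ j, Nat.clog 2 n = j + 1 := ⟨_, (Nat.succ_pred_eq_of_pos h4).symm⟩
    rw [hj, Nat.pred_succ] at h3
    have h5 : (j : ℝ) * Real.log 2 ≤ Real.log n := by
      rw [← Real.log_pow]
      exact Real.log_le_log (by positivity) (by exact_mod_cast h3.le)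
    rw [hj]
    push_cast
    nlinarith [(Nat.cast_nonneg j : (0 : ℝ) ≤ j)]
  have h3 : (boxCount n ε : ℝ) ≤ 15 * Real.log n / ε := by
    rw [boxCount, Nat.cast_mul]
    calc (⌈2 / ε⌉₊ : ℝ) * ((Nat.clog 2 n + 1 : ℕ) : ℝ) ≤ 3 / ε * (5 * Real.log n) := by gcongr
      _ = 15 * Real.log n / ε := by ring
  have h4 : 15 * Real.log n / ε ≤ 15 * Real.log n / ε ^ 2 := by
    apply div_le_div_of_nonneg_left (by linarith) (by positivity)
    nlinarith
  have h5 : 1 ≤ 2 * Real.log n / ε ^ 2 := by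
    rw [le_div_iff₀ (by positivity)]
    nlinarith
  calc 1 + 2 * (boxCount n ε : ℝ) ≤ 2 * Real.log n / ε ^ 2 + 2 * (15 * Real.log n / ε ^ 2) := by
        linarith
    _ = 32 * Real.log n / ε ^ 2 := by ring

/-- For `2 ≤ n` both `2 ≤ n` and `n + 1 ≤ n ^ 2` hold, so the number of codes is at most `n ^ (1 + 2
* K)`. -/
theorem pow_le_rpow {n d : ℕ} (hn : 2 ≤ n) {ε : ℝ} (hε : 0 < ε) (hε1 : ε < 1) :
    (((2 * (n + 1) ^ boxCount n ε) ^ d : ℕ) : ℝ) ≤ (n : ℝ) ^ (32 * d * Real.log n / ε ^ 2) := by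
  have h1 : 2 * (n + 1) ^ boxCount n ε ≤ n ^ (1 + 2 * boxCount n ε) := by
    rw [pow_add, pow_one, pow_mul]
    exact Nat.mul_le_mul hn (Nat.pow_le_pow_left (by nlinarith) _)
  have h2 : (1 : ℝ) ≤ n := by exact_mod_cast (by omega : 1 ≤ n)
  calc (((2 * (n + 1) ^ boxCount n ε) ^ d : ℕ) : ℝ)
      ≤ ((n ^ (1 + 2 * boxCount n ε)) ^ d : ℕ) := by
        exact_mod_cast Nat.pow_le_pow_left h1 d
    _ = (n : ℝ) ^ ((1 + 2 * (boxCount n ε : ℝ)) * d) := by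
      rw [← pow_mul]
      push_cast
      rw [← Real.rpow_natCast]
      push_cast
      rfl
    _ ≤ (n : ℝ) ^ (32 * d * Real.log n / ε ^ 2) := by
      apply Real.rpow_le_rpow_of_exponent_le h2
      calc (1 + 2 * (boxCount n ε : ℝ)) * d ≤ 32 * Real.log n / ε ^ 2 * d :=
            mul_le_mul_of_nonneg_right (boxCount_le hn hε hε1) (Nat.cast_nonneg d)
        _ = 32 * d * Real.log n / ε ^ 2 := by ring

theorem le_mul_opt {n : ℕ} {T : WeightedTree n} {a r : ℝ} (hr : 0 < r)
    (h : ∀ D : T.DecisionTree, D.IsStrategy → ∀ δ > 0, a ≤ r * (D.cost + δ)) : a ≤ r * T.opt := by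
  rw [← div_le_iff₀' hr]
  obtain ⟨D₀, hD₀⟩ := T.exists_isStrategy
  refine le_csInf ⟨D₀.cost, D₀, hD₀, rfl⟩ ?_
  rintro _ ⟨D, hD, rfl⟩
  apply le_of_forall_pos_le_add
  intro δ hδ
  rw [div_le_iff₀' hr]
  exact h D hD δ hδ

theorem exists_approximationScheme :
    ∃ (P : Program) (C : ℝ), ∀ ε : ℝ, 0 < ε → ε < 1 → ∀ (n : ℕ) (T : WeightedTree n),
      ∃ (t : ℕ) (m : Memory), Runs P (input T ε) t m ∧
        (t : ℝ) ≤ C * (n : ℝ) ^ (C * Real.log n / ε ^ 2) ∧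
        ∃ S : T.DecisionTree, StoredAt m S 0 ∧ S.IsStrategy ∧ S.cost ≤ (1 + ε) * T.opt := by
  -- One vertex needs its own branch: the number of codes still grows with `1 / ε`, whereas the
  -- allowed time is then a constant.
  obtain ⟨P, hP⟩ : ∃ P, P = branch (Test.natLt (const 1) (var 0)) scheme skip := ⟨_, rfl⟩
  obtain ⟨d, hd⟩ := P.exists_timeBound_le_pow
  -- The first summand pays for the case of one vertex, `32 * d` is the exponent for at least two,
  -- and the last one ensures that the constant is at least `1`.
  refine ⟨P, P.timeBound 0 + 32 * d + 1, fun ε hε hε1 n T => ?_⟩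
  have hC : (1 : ℝ) ≤ P.timeBound 0 + 32 * d + 1 := by
    linarith [(Nat.cast_nonneg (P.timeBound 0) : (0 : ℝ) ≤ _), (Nat.cast_nonneg d : (0 : ℝ) ≤ d)]
  have hsize : (input T ε).nat 0 0 = n := by simp [input]
  obtain ⟨v₀⟩ := T.isTree.connected.nonempty
  have hn := v₀.pos
  by_cases h1 : 1 < n
  · obtain ⟨S, hS⟩ : ∃ S, S = 2 * (n + 1) ^ boxCount n ε := ⟨_, rfl⟩
    have hS2 : 2 ≤ S := by
      have : 0 < (n + 1) ^ boxCount n ε := by positivity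
      omega
    obtain ⟨t, m, hrun, ht, D, hD1, hD2, hD3⟩ : Wp S P (fun m' => ∃ D : T.DecisionTree,
        StoredAt m' D 0 ∧ D.IsStrategy ∧
        ∀ D' : T.DecisionTree, D'.IsStrategy → ∀ δ > 0, D.cost ≤ (1 + ε) * (D'.cost + δ))
        (input T ε) := by
      rw [hP]
      refine Wp.branch (fun _ => wp_scheme hε hε1 hS) fun hb => absurd ?_ hb
      simpa [hsize] using h1
    refine ⟨t, m, hrun, ?_, D, hD1, hD2, le_mul_opt (by linarith) hD3⟩
    have h2 : (1 : ℝ) ≤ n := by exact_mod_cast hn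
    calc (t : ℝ) ≤ ((S ^ d : ℕ) : ℝ) := by exact_mod_cast ht.trans (hd S hS2)
      _ ≤ (n : ℝ) ^ (32 * d * Real.log n / ε ^ 2) := by
        rw [hS]
        exact pow_le_rpow h1 hε hε1
      _ ≤ (n : ℝ) ^ ((P.timeBound 0 + 32 * d + 1) * Real.log n / ε ^ 2) := by
        apply Real.rpow_le_rpow_of_exponent_le h2
        have := Real.log_nonneg h2
        gcongr
        linarith [(Nat.cast_nonneg (P.timeBound 0) : (0 : ℝ) ≤ _)]
      _ ≤ _ := le_mul_of_one_le_left (by positivity) hC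
  · obtain rfl : n = 1 := by omega
    obtain ⟨t, m, hrun, ht, rfl⟩ : Wp 0 P (fun m' => m' = input T ε) (input T ε) := by
      rw [hP]
      refine Wp.branch (fun hb => absurd hb ?_) fun _ => Wp.skip rfl
      simp [hsize]
    have hS : (DecisionTree.answer 0 : T.DecisionTree).IsStrategy :=
      fun x => (Subsingleton.elim 0 x : (0 : Fin 1) = x)
    -- The zeros of the initial memory already store the leaf that announces the vertex `0`.
    refine ⟨t, _, hrun, ?_, DecisionTree.answer 0, ⟨by simp [input], by simp [input]⟩, hS, ?_⟩
    · have : (t : ℝ) ≤ P.timeBound 0 := by exact_mod_cast ht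
      simp only [Nat.cast_one, Real.one_rpow, mul_one]
      linarith [(Nat.cast_nonneg d : (0 : ℝ) ≤ d)]
    · refine le_mul_opt (by linarith) fun D _ δ hδ => ?_
      have h0 : (DecisionTree.answer 0 : T.DecisionTree).cost = 0 := by
        simp [DecisionTree.cost, DecisionTree.costAt, DecisionTree.queries]
      rw [h0]
      have := D.cost_nonneg
      positivity

end Program

end TreeSearch

theorem theorem1 :
    ∃ (P : TreeSearch.Program) (C : ℝ),
      ∀ (ε : ℝ), 0 < ε → ε < 1 →
      ∀ (n : ℕ) (T : TreeSearch.WeightedTree n),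
        ∃ (t : ℕ) (m : TreeSearch.Memory),
          TreeSearch.Runs P (TreeSearch.input T ε) t m ∧
          (t : ℝ) ≤ C * (n : ℝ) ^ (C * Real.log n / ε ^ 2) ∧
          ∃ S : T.DecisionTree,
            TreeSearch.StoredAt m S 0 ∧ S.IsStrategy ∧ S.cost ≤ (1 + ε) * T.opt :=
  TreeSearch.Program.exists_approximationScheme
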